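/- Let $d\ge 2$, $\gamma\in[1,2)$, $v(x)=|x|^{-\gamma}$ on $\mathbb R^d$, let $g:[0,\infty)\to(0,\infty)$ be a probability density with finite first moment and $\sup_{t\ge0}(1+t)g(t)<\infty$, and let $\alpha>0$. Let $\mathcal W$ be the $d$-dimensional Wiener measure on $C([0,\infty),\mathbb R^d)$ with coordinate process $X$, write $X_{s,t}=X_t-X_s$, and for $T>0$ put $$\mathbb P_{\alpha,T}(d\mathbf x)=\frac1{Z_{\alpha,T}}\exp\Big(\frac\alpha2\int_0^T\!\!\int_0^T g(|t-s|)\,v(\mathbf x_{s,t})\,ds\,dt\Big)\mathcal W(d\mathbf x).$$ The diffusion constant is $\sigma^2(\alpha)=\lim_{T\to\infty}\frac1{dT}\mathbb E_{\alpha,T}\big[|X_{0,T}|^2\big]$. For $\varepsilon\ge0$ let $v_\varepsilon=v+\varepsilon$, and let $\nu_\varepsilon(du)=\frac{2^{(2-\gamma)/2}}{\Gamma(\gamma/2)}u^{\gamma-1}du+\varepsilon\,\delta_0(du)$ on $[0,\infty)$. Let $\triangle=\{(s,t):s<t\}$ and $\triangle^\cup=\bigcup_{n\ge0}\triangle^n$.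 For $\xi=((s_i,t_i))_{1\le i\le n}\in\triangle^n$ with $s_i\ge 0$ put $N(\xi)=n$, and for $u\in[0,\infty)^n$ define $$F_\varepsilon(\xi)=\mathbb E_{\mathcal W}\Big[\prod_{i=1}^n v_\varepsilon(X_{s_i,t_i})\Big],\qquad \phi(\xi,u)=\mathbb E_{\mathcal W}\Big[e^{-\sum_i u_i^2|X_{s_i,t_i}|^2/2}\Big],$$ $$\mathbf P_{\xi,u}(d\mathbf x)=\frac{1}{\phi(\xi,u)}e^{-\sum_i u_i^2|\mathbf x_{s_i,t_i}|^2/2}\,\mathcal W(d\mathbf x),\qquad \kappa_\varepsilon(\xi,du)=\frac{\phi(\xi,u)}{F_\varepsilon(\xi)}\,\nu_\varepsilon^{\otimes n}(du),$$ $$\sigma_T^2(\xi,u)=\frac1{dT}\mathbb E_{\mathbf P_{\xi,u}}\big[|X_{0,T}|^2\big].$$ Let $\Gamma_{\alpha,T}$ be the law on $\triangle^\cup$ (with symmetrically ordered points) of the Poisson point process with intensity $\mu_{\alpha,T}(ds\,dt)=\alpha g(t-s)\mathbf 1_{\{0\le s<t\le T\}}ds\,dt$, let $c_{\alpha,T}$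 be the total mass of $\mu_{\alpha,T}$, and set $$\widehat\Gamma^\varepsilon_{\alpha,T}(d\xi)=\frac{e^{c_{\alpha,T}}}{Z^\varepsilon_{\alpha,T}}F_\varepsilon(\xi)\,\Gamma_{\alpha,T}(d\xi),\qquad Z^\varepsilon_{\alpha,T}=\mathbb E_{\mathcal W}\Big[\exp\Big(\alpha\iint_{0\le s<t\le T}g(t-s)v_\varepsilon(X_{s,t})\,ds\,dt\Big)\Big].$$ **Proposition.** The limit defining $\sigma^2(\alpha)$ exists and is finite, and for every $\varepsilon\ge0$ $$\sigma^2(\alpha)=\lim_{T\to\infty}\int_{\triangle^\cup}\widehat\Gamma^\varepsilon_{\alpha,T}(d\xi)\int_{[0,\infty)^{N(\xi)}}\kappa_\varepsilon(\xi,du)\,\sigma_T^2(\xi,u).$$ Moreover, for all $T>0$, $n\ge0$, $\xi=((s_i,t_i))_{1\le i\le n}$ with $0\le s_i<t_i$, and $u\in[0,\infty)^n$, $$\sigma_T^2(\xi,u)=\frac1T\operatorname{dist}_{L^2}\Big(B_{0,T},\ \operatorname{span}\{u_iB_{s_i,t_i}+Z_i:1\le i\le n\}\Big)^2,$$ where $B$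 is a one-dimensional standard Brownian motion, $B_{s,t}=B_t-B_s$, and $Z_1,\dots,Z_n$ are i.i.d. standard Gaussians independent of $B$. -/

import Mathlib

open MeasureTheory ProbabilityTheory Filter Topology Set
open scoped ENNReal NNReal

noncomputable section

namespace Polaron

/-- The path space `C([0, ∞), ℝ^d)`. -/
abbrev PathSpace (d : ℕ) : Type := C(ℝ≥0, EuclideanSpace ℝ (Fin d))

/-- The σ-algebra on path space generated by the evaluations `x ↦ x t` (it is the Borel σ-algebra
of locally uniform convergence). -/
instance instMeasurableSpacePathSpace (d : ℕ) :
    MeasurableSpace C(ℝ≥0, EuclideanSpace ℝ (Fin d)) :=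
  MeasurableSpace.comap (fun (x : C(ℝ≥0, EuclideanSpace ℝ (Fin d))) (t : ℝ≥0) => x t)
    MeasurableSpace.pi

/-- `W` is the `d`-dimensional Wiener measure: under `W` the coordinate processes of the canonical
process are independent one-dimensional standard Brownian motions started at `0`. -/
structure IsWienerMeasure {d : ℕ} (W : Measure (PathSpace d)) : Prop where
  brownian : ∀ i : Fin d, IsBrownianReal (fun (t : ℝ≥0) (x : PathSpace d) => x t i) W
  indep : iIndepFun (fun (i : Fin d) (x : PathSpace d) (t : ℝ≥0) => x t i) W

/-- The increment `x_{s,t} = x_t - x_s`; only used for times `s, t ≥ 0`. -/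
def incr {d : ℕ} (x : PathSpace d) (s t : ℝ) : EuclideanSpace ℝ (Fin d) :=
  x t.toNNReal - x s.toNNReal

/-- The potential `v_ε(y) = 1 / |y|^γ + ε`, with value `∞` at `y = 0`. -/
def potential {d : ℕ} (γ ε : ℝ) (y : EuclideanSpace ℝ (Fin d)) : ℝ≥0∞ :=
  ‖y‖ₑ ^ (-γ) + ENNReal.ofReal ε

/-- The exponential function on `[0, ∞]`, with `exp ∞ = ∞`. -/
def expENN (a : ℝ≥0∞) : ℝ≥0∞ := EReal.exp (a : EReal)

/-- The Gibbs weight `exp ((α/2) ∫_0^T ∫_0^T g(|t - s|) v(x_{s,t}) ds dt)`. -/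
def gibbsWeight {d : ℕ} (γ : ℝ) (g : ℝ → ℝ) (α T : ℝ) (x : PathSpace d) : ℝ≥0∞ :=
  expENN (ENNReal.ofReal (α / 2) *
    ∫⁻ s in Icc 0 T, ∫⁻ t in Icc 0 T, ENNReal.ofReal (g |t - s|) * potential γ 0 (incr x s t))

/-- The path measure `P_{α,T}`, i.e. the Wiener measure weighted by the Gibbs weight and
normalized. -/
def pathMeasure {d : ℕ} (W : Measure (PathSpace d)) (γ : ℝ) (g : ℝ → ℝ) (α T : ℝ) :
    Measure (PathSpace d) :=
  (∫⁻ x, gibbsWeight γ g α T x ∂W)⁻¹ • W.withDensity (gibbsWeight γ g α T)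

/-- `(1 / (d T)) E_Q[|X_{0,T}|²]` for a measure `Q` on path space. -/
def meanSqDisplacement {d : ℕ} (Q : Measure (PathSpace d)) (T : ℝ) : ℝ≥0∞ :=
  (ENNReal.ofReal (d * T))⁻¹ * ∫⁻ x, ‖incr x 0 T‖ₑ ^ 2 ∂Q

/-- `σ2` is the diffusion constant `σ²(α) = lim_{T → ∞} (1 / (d T)) E_{α,T}[|X_{0,T}|²]`. -/
def IsDiffusionConstant {d : ℕ} (W : Measure (PathSpace d)) (γ : ℝ) (g : ℝ → ℝ) (α : ℝ)
    (σ2 : ℝ≥0) : Prop :=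
  Tendsto (fun T : ℝ => meanSqDisplacement (pathMeasure W γ g α T) T) atTop (𝓝 (σ2 : ℝ≥0∞))

/-- Finite ordered configurations of points `(s, t)`. The measures below are concentrated on the
configurations all of whose points satisfy `0 ≤ s < t`. -/
abbrev Config : Type := Σ n : ℕ, (Fin n → ℝ × ℝ)

/-- The law of the Poisson point process with finite intensity measure `μ`, as a symmetric measure
on ordered configurations: `∑_n e^{-μ(univ)} μ^{⊗ n} / n!`. -/
def poissonLaw (μ : Measure (ℝ × ℝ)) : Measure Config :=
  Measure.sum fun n : ℕ =>
    (ENNReal.ofReal (Real.exp (-(μ univ).toReal)) / (n.factorial : ℝ≥0∞)) •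
      (Measure.pi fun _ : Fin n => μ).map (fun p => (⟨n, p⟩ : Config))

/-- The intensity `μ_{α,T}(ds dt) = α g(t - s) 1_{0 ≤ s < t ≤ T} ds dt`. -/
def intensity (g : ℝ → ℝ) (α T : ℝ) : Measure (ℝ × ℝ) :=
  (volume.restrict {p : ℝ × ℝ | 0 ≤ p.1 ∧ p.1 < p.2 ∧ p.2 ≤ T}).withDensity
    fun p => ENNReal.ofReal (α * g (p.2 - p.1))

/-- `F_ε(ξ) = E_W[∏_i v_ε(X_{s_i,t_i})]`. -/
def weightF {d : ℕ} (W : Measure (PathSpace d)) (γ ε : ℝ) (ξ : Config) : ℝ≥0∞ :=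
  ∫⁻ x, ∏ i, potential γ ε (incr x (ξ.2 i).1 (ξ.2 i).2) ∂W

/-- `Z^ε_{α,T} = E_W[exp (α ∬_{0 ≤ s < t ≤ T} g(t - s) v_ε(X_{s,t}) ds dt)]`. -/
def partitionFunction {d : ℕ} (W : Measure (PathSpace d)) (γ : ℝ) (g : ℝ → ℝ) (ε α T : ℝ) :
    ℝ≥0∞ :=
  ∫⁻ x, expENN (∫⁻ p, potential γ ε (incr x p.1 p.2) ∂(intensity g α T)) ∂W

/-- The perturbed point process
`Γ̂^ε_{α,T}(dξ) = (e^{c_{α,T}} / Z^ε_{α,T}) F_ε(ξ) Γ_{α,T}(dξ)`, where `Γ_{α,T}` is the law of the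
Poisson point process with intensity `μ_{α,T}` and `c_{α,T}` is the total mass of `μ_{α,T}`. -/
def perturbedLaw {d : ℕ} (W : Measure (PathSpace d)) (γ : ℝ) (g : ℝ → ℝ) (ε α T : ℝ) :
    Measure Config :=
  (poissonLaw (intensity g α T)).withDensity fun ξ =>
    ENNReal.ofReal (Real.exp ((intensity g α T) univ).toReal) / partitionFunction W γ g ε α T *
      weightF W γ ε ξ

/-- The measure `ν_ε(du) = (2^{(2-γ)/2} / Γ(γ/2)) u^{γ-1} du + ε δ_0(du)` on `[0, ∞)`. -/
def markMeasure (γ ε : ℝ) : Measure ℝ :=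
  (volume.restrict (Ici 0)).withDensity
      (fun u => ENNReal.ofReal (2 ^ ((2 - γ) / 2) / Real.Gamma (γ / 2) * u ^ (γ - 1))) +
    ENNReal.ofReal ε • Measure.dirac 0

/-- The Gaussian weight `exp (-∑_i u_i² |x_{s_i,t_i}|² / 2)`. -/
def gaussWeight {d : ℕ} (ξ : Config) (u : Fin ξ.1 → ℝ) (x : PathSpace d) : ℝ≥0∞ :=
  ENNReal.ofReal (Real.exp (-∑ i, u i ^ 2 * ‖incr x (ξ.2 i).1 (ξ.2 i).2‖ ^ 2 / 2))

/-- `φ(ξ, u) = E_W[exp (-∑_i u_i² |X_{s_i,t_i}|² / 2)]`. -/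
def phi {d : ℕ} (W : Measure (PathSpace d)) (ξ : Config) (u : Fin ξ.1 → ℝ) : ℝ≥0∞ :=
  ∫⁻ x, gaussWeight ξ u x ∂W

/-- The Gaussian path measure `P_{ξ,u}`. -/
def gaussMeasure {d : ℕ} (W : Measure (PathSpace d)) (ξ : Config) (u : Fin ξ.1 → ℝ) :
    Measure (PathSpace d) :=
  (phi W ξ u)⁻¹ • W.withDensity (gaussWeight ξ u)

/-- The kernel `κ_ε(ξ, du) = (φ(ξ, u) / F_ε(ξ)) ν_ε^{⊗ N(ξ)}(du)`. -/
def kappa {d : ℕ} (W : Measure (PathSpace d)) (γ ε : ℝ) (ξ : Config) : Measure (Fin ξ.1 → ℝ) :=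
  (Measure.pi fun _ : Fin ξ.1 => markMeasure γ ε).withDensity
    fun u => phi W ξ u / weightF W γ ε ξ

/-- `σ_T²(ξ, u) = (1 / (d T)) E_{P_{ξ,u}}[|X_{0,T}|²]`. -/
def sigmaSq {d : ℕ} (W : Measure (PathSpace d)) (T : ℝ) (ξ : Config) (u : Fin ξ.1 → ℝ) : ℝ≥0∞ :=
  meanSqDisplacement (gaussMeasure W ξ u) T

/-- `dist_{L²(P)}(f, span {Y_i : i})`. -/
def l2DistSpan {Ω : Type*} [MeasurableSpace Ω] (P : Measure Ω) {n : ℕ} (f : Ω → ℝ)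
    (Y : Fin n → Ω → ℝ) : ℝ≥0∞ :=
  ⨅ h ∈ Submodule.span ℝ (Set.range Y), eLpNorm (f - h) 2 P

end Polaron

end

open Polaron

noncomputable section

namespace Polaron

/-! Three independent arguments give the theorem: existence of the limit, an exact identity for each
`T`, and a Gaussian computation.

Existence. The Riesz potential is a Gaussian mixture, `|y|^(-γ) + ε = ∫ exp(-u²|y|²/2) ν_ε(du)`
(`lintegral_markMeasure`), so the interaction is a positive superposition of energies
`exp(-u²|x_{s,t}|²/2)`. For such energies a Ginibre inequality holds (`ginibre`,
`ginibre_lintegral`): more interaction means less mean square displacement. Its proof duplicates the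
path and rotates the pair by `π/4`, which preserves `W ⊗ W`. The duplicated difference then becomes
a product of positive definite kernels in the two paths, whose double integral is nonnegative.
Dropping the interaction between `[0,T]` and `[T,T+S]` therefore increases the displacement. What
remains is a pair of independent symmetric pieces, whose mean squares add. So `T ↦
E_{α,T}|X_{0,T}|²` is subadditive, and dropping all interaction bounds it by `dT`; Fekete's lemma
gives the limit. Normalization requires finite partition functions (`partitionZ_ne_top`). Jensen's
inequality over the starting time reduces the double time integral to a single one. Khasminskii's
lemma then applies because `E|z + X_t|^(-γ) ≤ C t^(-γ/2)` uniformly in `z`, which is integrable at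
`0` for `γ < 2`.

Mixture identity. Expanding the exponential weight in its power series gives a sum over Poisson
configurations weighted by `F_ε`, and resolving each factor `v_ε` into Gaussians gives the marks.
The shift by `ε` multiplies every path weight by the same constant, which cancels. Hence the mixture
equals the mean square displacement for every `T ≥ 0`, not only in the limit
(`lintegral_perturbedLaw`).

Distance formula. Under `P_{ξ,u}` the coordinates are independent, and for one coordinate the weight
`exp(-∑ b_i²/2)`, `b_i = u_i B_{s_i,t_i}`, is up to a constant the density at `0` of `b + Z` given
`B`. Tilting is thus conditioning on `b + Z = 0`, and the conditional second moment of `B_{0,T}` is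
its residual variance after regression on `b + Z` (`lintegral_sq_mul_exp_eq`, `sigmaSq_eq`). -/

/-! ### Characteristic functions determine laws -/

lemma aestronglyMeasurable_cexp {Ω : Type*} [MeasurableSpace Ω] {μ : Measure Ω} {f : Ω → ℝ}
    (hf : Measurable f) : AEStronglyMeasurable (fun ω => Complex.exp ((f ω : ℝ) * Complex.I)) μ :=
  (Complex.measurable_exp.comp
    ((Complex.measurable_ofReal.comp hf).mul_const _)).aestronglyMeasurable

/-- Two probability measures on a space whose σ-algebra is generated by real functions agree as
soon as the characteristic functions of all finite linear combinations agree. -/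
lemma measure_ext_of_integral_cexp {Ω K : Type*} {m : MeasurableSpace Ω} (f : K → Ω → ℝ)
    (hm : m = MeasurableSpace.comap (fun ω k => f k ω) MeasurableSpace.pi)
    (P Q : Measure Ω) [IsProbabilityMeasure P] [IsProbabilityMeasure Q]
    (h : ∀ (s : Finset K) (a : K → ℝ),
      ∫ ω, Complex.exp ((∑ k ∈ s, a k * f k ω : ℝ) * Complex.I) ∂P
        = ∫ ω, Complex.exp ((∑ k ∈ s, a k * f k ω : ℝ) * Complex.I) ∂Q) : P = Q := by
  classical
  set F : Ω → K → ℝ := fun ω k => f k ω with hF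
  have hFm : Measurable F := by rw [hm]; exact comap_measurable F
  have : IsProbabilityMeasure (P.map F) := Measure.isProbabilityMeasure_map hFm.aemeasurable
  have : IsProbabilityMeasure (Q.map F) := Measure.isProbabilityMeasure_map hFm.aemeasurable
  -- A law on `K → ℝ` is determined by its finite-dimensional marginals, and these by `charFunDual`.
  -- A dual vector on `J → ℝ` is a linear combination of coordinates, which is the case covered by
  -- `h`.
  have key : P.map F = Q.map F := by
    refine IsProjectiveLimit.unique (P := fun J => (P.map F).map J.restrict) (fun J => rfl) ?_
    intro J
    apply Measure.ext_of_charFunDual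
    ext L
    have hJ : Measurable (fun v : K → ℝ => J.restrict v) := Finset.measurable_restrict J
    change charFunDual ((Q.map F).map fun v => J.restrict v) L
      = charFunDual ((P.map F).map fun v => J.restrict v) L
    rw [charFunDual_apply, charFunDual_apply, Measure.map_map hJ hFm, Measure.map_map hJ hFm,
      integral_map (by fun_prop) (by fun_prop), integral_map (by fun_prop) (by fun_prop)]
    have hL : ∀ ω, L ((fun v : K → ℝ => J.restrict v) (F ω))
        = ∑ k ∈ J, (if hk : k ∈ J then L (Pi.single ⟨k, hk⟩ 1) else 0) * f k ω := by
      intro ω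
      rw [← Finset.sum_attach]
      conv_lhs => rw [← Finset.univ_sum_single ((fun v : K → ℝ => J.restrict v) (F ω)), map_sum]
      refine Finset.sum_congr rfl fun k _ => ?_
      have : (Pi.single k (J.restrict (F ω) k) : J → ℝ) = (f k ω) • Pi.single k 1 := by
        rw [← Pi.single_smul]; simp [hF]
      simp only [this, map_smul, smul_eq_mul]
      simp [mul_comm]
    simp only [Function.comp]
    simp_rw [hL]
    exact (h J _).symm
  ext A hA
  obtain ⟨B, hB, rfl⟩ : ∃ B, MeasurableSet B ∧ F ⁻¹' B = A := by rw [hm] at hA; exact hA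
  rw [← Measure.map_apply hFm hB, key, Measure.map_apply hFm hB]

/-! ### Wiener measure: Gaussian covariance and invariances -/

/-- The covariance of `x ↦ x t i` and `x ↦ x s j` under Wiener measure. -/
def wienerCov {d : ℕ} (p q : ℝ≥0 × Fin d) : ℝ := if p.2 = q.2 then min p.1 q.1 else 0

section wiener
variable {d : ℕ} {W : Measure (PathSpace d)}

lemma measurable_eval (t : ℝ≥0) : Measurable (fun x : PathSpace d => x t) :=
  (measurable_pi_apply t).comp (comap_measurable _)

lemma measurable_eval_coord (t : ℝ≥0) (i : Fin d) : Measurable (fun x : PathSpace d => x t i) :=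
  (by fun_prop : Measurable fun y : EuclideanSpace ℝ (Fin d) => y i).comp (measurable_eval t)

lemma measurable_path_of_coord {Ω : Type*} [MeasurableSpace Ω] {f : Ω → PathSpace d}
    (h : ∀ t i, Measurable fun ω => f ω t i) : Measurable f := by
  refine measurable_comap_iff.2 (measurable_pi_lambda _ fun t => ?_)
  change Measurable fun ω => f ω t
  have : Measurable fun ω => WithLp.toLp 2 (fun i => f ω t i) :=
    (by fun_prop : Measurable (WithLp.toLp 2 : (Fin d → ℝ) → _)).comp
      (measurable_pi_lambda _ fun i => h t i)
  exact this

/-- Scalar coordinates already generate the σ-algebra, the form required by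
`measure_ext_of_integral_cexp`. -/
lemma pathSpace_measurableSpace_eq : (instMeasurableSpacePathSpace d) =
    MeasurableSpace.comap (fun (x : PathSpace d) (p : ℝ≥0 × Fin d) => x p.1 p.2)
      MeasurableSpace.pi := by
  refine le_antisymm ?_ ?_
  · let m' : MeasurableSpace (PathSpace d) :=
      MeasurableSpace.comap (fun (x : PathSpace d) (p : ℝ≥0 × Fin d) => x p.1 p.2)
        MeasurableSpace.pi
    have h : @Measurable _ _ m' (instMeasurableSpacePathSpace d) (id : PathSpace d → PathSpace d) :=
      measurable_path_of_coord fun t i =>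
        (measurable_pi_apply (t, i)).comp
          (comap_measurable (fun (x : PathSpace d) (p : ℝ≥0 × Fin d) => x p.1 p.2))
    simpa using h.comap_le
  · refine Measurable.comap_le (measurable_pi_lambda _ fun p => measurable_eval_coord p.1 p.2)

lemma IsWienerMeasure.isProbabilityMeasure (hW : IsWienerMeasure W) : IsProbabilityMeasure W :=
  hW.indep.isProbabilityMeasure

/-- Within one spatial coordinate the combination is a centered Gaussian variable with covariance
`min`; independence multiplies the characteristic functions of different coordinates, so mixed
covariances vanish. -/
lemma IsWienerMeasure.integral_cexp (hW : IsWienerMeasure W) {ι : Type*} (s : Finset ι)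
    (p : ι → ℝ≥0 × Fin d) (a : ι → ℝ) :
    ∫ x, Complex.exp ((∑ k ∈ s, a k * x (p k).1 (p k).2 : ℝ) * Complex.I) ∂W
      = Complex.exp ((-(∑ k ∈ s, ∑ l ∈ s, a k * a l * wienerCov (p k) (p l)) / 2 : ℝ)) := by
  classical
  have := hW.isProbabilityMeasure
  -- Sorts the coefficients by spatial coordinate, so that independence applies to the inner sums.
  set c : Fin d → ι → ℝ := fun i k => if (p k).2 = i then a k else 0 with hc
  have hsum : ∀ x : PathSpace d, ∑ k ∈ s, a k * x (p k).1 (p k).2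
      = ∑ i, ∑ k ∈ s, c i k * x (p k).1 i := by
    intro x
    rw [Finset.sum_comm]
    refine Finset.sum_congr rfl fun k _ => ?_
    simp [hc]
  have hone : ∀ i, ∫ x, Complex.exp ((∑ k ∈ s, c i k * x (p k).1 i : ℝ) * Complex.I) ∂W
      = Complex.exp ((-(∑ k ∈ s, ∑ l ∈ s, c i k * c i l * min (p k).1 (p l).1) / 2 : ℝ)) := by
    intro i
    have hB := (hW.brownian i).toIsPreBrownianReal
    have hG := hB.isGaussianProcess
    have hY : HasGaussianLaw (fun x : PathSpace d => ∑ k ∈ s, c i k * x (p k).1 i) W :=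
      ((hG.comp_right fun k => (p k).1).smul (c i)).hasGaussianLaw_fun_sum (I := s)
    have hmean : ∫ x, (∑ k ∈ s, c i k * x (p k).1 i) ∂W = 0 := by
      rw [integral_finsetSum _ fun k _ => (hB.integrable_eval _).const_mul _]
      refine Finset.sum_eq_zero fun k _ => ?_
      rw [integral_const_mul, hB.integral_eval, mul_zero]
    have hvar : Var[fun x : PathSpace d => ∑ k ∈ s, c i k * x (p k).1 i; W]
        = ∑ k ∈ s, ∑ l ∈ s, c i k * c i l * min (p k).1 (p l).1 := by
      rw [variance_fun_sum' fun k _ => (hG.hasGaussianLaw_eval _).memLp_two.const_mul _]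
      refine Finset.sum_congr rfl fun k _ => Finset.sum_congr rfl fun l _ => ?_
      rw [covariance_const_mul_left, covariance_const_mul_right, hB.covariance_fun_eval]
      push_cast
      ring
    have h1 := hY.charFun_map_eq 1
    rw [charFun_apply_real, integral_map hY.aemeasurable (by fun_prop)] at h1
    simp only [Complex.ofReal_one, one_mul] at h1
    rw [h1]
    have e : ∀ z : ℝ, inner ℝ (1 : ℝ) z = z := fun z => by simp
    simp only [e, hmean, hvar]
    congr 1
    push_cast
    ring
  simp_rw [hsum]
  have hprod : ∀ x : PathSpace d,
      Complex.exp ((∑ i, ∑ k ∈ s, c i k * x (p k).1 i : ℝ) * Complex.I)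
        = ∏ i, Complex.exp ((∑ k ∈ s, c i k * x (p k).1 i : ℝ) * Complex.I) := by
    intro x
    rw [← Complex.exp_sum]
    push_cast
    rw [Finset.sum_mul]
  simp_rw [hprod]
  rw [hW.indep.integral_fun_prod_comp
    (f := fun i y => Complex.exp ((∑ k ∈ s, c i k * y (p k).1 : ℝ) * Complex.I))]
  · simp_rw [hone]
    rw [← Complex.exp_sum]
    congr 1
    norm_cast
    rw [← Finset.sum_div, Finset.sum_neg_distrib]
    congr 2
    rw [Finset.sum_comm]
    refine Finset.sum_congr rfl fun k _ => ?_
    rw [Finset.sum_comm]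
    refine Finset.sum_congr rfl fun l _ => ?_
    by_cases h : (p k).2 = (p l).2
    · rw [Finset.sum_eq_single (p k).2]
      · simp [hc, wienerCov, h]
      · intro i _ hi
        simp [hc, hi.symm]
      · simp
    · rw [Finset.sum_eq_zero]
      · simp [wienerCov, h]
      · intro i _
        by_cases h1 : (p k).2 = i
        · have : (p l).2 ≠ i := fun h2 => h (h1.trans h2.symm)
          simp [hc, this]
        · simp [hc, h1]
  · exact fun i => (measurable_pi_lambda _ fun t => measurable_eval_coord t i).aemeasurable
  · intro i
    refine Measurable.aestronglyMeasurable ?_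
    fun_prop

/-- Both components carry coefficients on one index set, because a coordinate of a concatenated or
rotated path involves both paths. -/
lemma IsWienerMeasure.integral_cexp_prod (hW : IsWienerMeasure W) {ι : Type*} (s : Finset ι)
    (p q : ι → ℝ≥0 × Fin d) (a b : ι → ℝ) :
    ∫ z, Complex.exp ((∑ k ∈ s, (a k * z.1 (p k).1 (p k).2 + b k * z.2 (q k).1 (q k).2) : ℝ)
        * Complex.I) ∂(W.prod W)
      = Complex.exp ((-(∑ k ∈ s, ∑ l ∈ s, (a k * a l * wienerCov (p k) (p l)
          + b k * b l * wienerCov (q k) (q l))) / 2 : ℝ)) := by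
  have := hW.isProbabilityMeasure
  have h : ∀ z : PathSpace d × PathSpace d,
      Complex.exp ((∑ k ∈ s, (a k * z.1 (p k).1 (p k).2 + b k * z.2 (q k).1 (q k).2) : ℝ)
        * Complex.I)
      = Complex.exp ((∑ k ∈ s, a k * z.1 (p k).1 (p k).2 : ℝ) * Complex.I)
        * Complex.exp ((∑ k ∈ s, b k * z.2 (q k).1 (q k).2 : ℝ) * Complex.I) := by
    intro z
    rw [← Complex.exp_add, Finset.sum_add_distrib]
    push_cast
    ring_nf
  simp_rw [h]
  rw [integral_prod_mul (fun x : PathSpace d =>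
      Complex.exp ((∑ k ∈ s, a k * x (p k).1 (p k).2 : ℝ) * Complex.I))
    (fun x : PathSpace d =>
      Complex.exp ((∑ k ∈ s, b k * x (q k).1 (q k).2 : ℝ) * Complex.I)),
    hW.integral_cexp, hW.integral_cexp, ← Complex.exp_add]
  congr 1
  norm_cast
  simp_rw [Finset.sum_add_distrib]
  ring

/-- Concatenation of paths: follow `x` up to time `T`, then the increments of `y`. -/
def concat (T : ℝ≥0) (z : PathSpace d × PathSpace d) : PathSpace d where
  toFun t := z.1 (min t T) + z.2 (t - T)
  continuous_toFun := by fun_prop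

lemma measurable_concat (T : ℝ≥0) : Measurable (concat (d := d) T) :=
  measurable_path_of_coord fun t i =>
    ((measurable_eval_coord (min t T) i).comp measurable_fst).add
      ((measurable_eval_coord (t - T) i).comp measurable_snd)

/-- The Markov property, checked on covariances: `min (r ∧ T) (s ∧ T) + min (r - T)⁺ (s - T)⁺ = r ∧
s`. -/
lemma IsWienerMeasure.map_concat (hW : IsWienerMeasure W) (T : ℝ≥0) :
    (W.prod W).map (concat T) = W := by
  have := hW.isProbabilityMeasure
  have hm := measurable_concat (d := d) T
  have : IsProbabilityMeasure ((W.prod W).map (concat T)) :=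
    Measure.isProbabilityMeasure_map hm.aemeasurable
  refine measure_ext_of_integral_cexp (fun (p : ℝ≥0 × Fin d) x => x p.1 p.2)
    pathSpace_measurableSpace_eq _ _ fun s a => ?_
  have hmeas : Measurable fun x : PathSpace d => ∑ k ∈ s, a k * x k.1 k.2 :=
    Finset.measurable_sum _ fun k _ => (measurable_eval_coord k.1 k.2).const_mul _
  rw [integral_map hm.aemeasurable (aestronglyMeasurable_cexp hmeas)]
  have e : ∀ z : PathSpace d × PathSpace d, ∑ k ∈ s, a k * concat T z k.1 k.2
      = ∑ k ∈ s, (a k * z.1 (min k.1 T) k.2 + a k * z.2 (k.1 - T) k.2) := by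
    intro z
    refine Finset.sum_congr rfl fun k _ => ?_
    simp [concat, mul_add]
  simp_rw [e]
  rw [hW.integral_cexp_prod s (fun k => (min k.1 T, k.2)) (fun k => (k.1 - T, k.2)) a a,
    hW.integral_cexp s (fun k => k) a]
  congr 5
  refine funext fun k => Finset.sum_congr rfl fun l _ => ?_
  rw [← mul_add]
  congr 1
  simp only [wienerCov]
  split_ifs
  · norm_cast
    rcases le_total k.1 T with h1 | h1 <;> rcases le_total l.1 T with h2 | h2
    · simp [h1, h2, tsub_eq_zero_of_le h1]
    · simp [h1, h2, h1.trans h2, tsub_eq_zero_of_le h1]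
    · simp [h1, h2, h2.trans h1, tsub_eq_zero_of_le h2]
    · rw [min_eq_right h1, min_eq_right h2, min_self]
      rcases le_total k.1 l.1 with h3 | h3
      · rw [min_eq_left h3, min_eq_left (tsub_le_tsub_right h3 T), add_tsub_cancel_of_le h1]
      · rw [min_eq_right h3, min_eq_right (tsub_le_tsub_right h3 T), add_tsub_cancel_of_le h2]
  · simp

/-- The rotation of pairs of paths by the angle `π / 4`. -/
def rotate (z : PathSpace d × PathSpace d) : PathSpace d × PathSpace d :=
  ((√2)⁻¹ • (z.1 + z.2), (√2)⁻¹ • (z.1 - z.2))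

lemma measurable_rotate : Measurable (rotate (d := d)) := by
  refine Measurable.prodMk (measurable_path_of_coord fun t i => ?_)
    (measurable_path_of_coord fun t i => ?_)
  · exact (((measurable_eval_coord t i).comp measurable_fst).add
      ((measurable_eval_coord t i).comp measurable_snd)).const_mul _
  · exact (((measurable_eval_coord t i).comp measurable_fst).sub
      ((measurable_eval_coord t i).comp measurable_snd)).const_mul _

lemma pathSpace_prod_measurableSpace_eq :
    (inferInstance : MeasurableSpace (PathSpace d × PathSpace d)) =
    MeasurableSpace.comap (fun (z : PathSpace d × PathSpace d)
      (k : (ℝ≥0 × Fin d) ⊕ (ℝ≥0 × Fin d)) =>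
        (k.elim (fun p => z.1 p.1 p.2) (fun p => z.2 p.1 p.2) : ℝ)) MeasurableSpace.pi := by
  set G := fun (z : PathSpace d × PathSpace d) (k : (ℝ≥0 × Fin d) ⊕ (ℝ≥0 × Fin d)) =>
        (k.elim (fun p => z.1 p.1 p.2) (fun p => z.2 p.1 p.2) : ℝ) with hG
  refine le_antisymm ?_ ?_
  · let m' : MeasurableSpace (PathSpace d × PathSpace d) :=
      MeasurableSpace.comap G MeasurableSpace.pi
    have h1 : @Measurable _ _ m' _ (Prod.fst : PathSpace d × PathSpace d → PathSpace d) :=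
      measurable_path_of_coord fun t i =>
        (measurable_pi_apply (Sum.inl (t, i))).comp (comap_measurable G)
    have h2 : @Measurable _ _ m' _ (Prod.snd : PathSpace d × PathSpace d → PathSpace d) :=
      measurable_path_of_coord fun t i =>
        (measurable_pi_apply (Sum.inr (t, i))).comp (comap_measurable G)
    exact sup_le h1.comap_le h2.comap_le
  · refine Measurable.comap_le (measurable_pi_lambda _ fun k => ?_)
    rcases k with p | p
    · exact (measurable_eval_coord p.1 p.2).comp measurable_fst
    · exact (measurable_eval_coord p.1 p.2).comp measurable_snd

/-- The two components of the pair are independent with equal covariance, so an orthogonal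
transformation mixing them preserves the joint covariance. -/
lemma IsWienerMeasure.map_rotate (hW : IsWienerMeasure W) :
    (W.prod W).map rotate = W.prod W := by
  have := hW.isProbabilityMeasure
  have hm := measurable_rotate (d := d)
  have : IsProbabilityMeasure ((W.prod W).map rotate) :=
    Measure.isProbabilityMeasure_map hm.aemeasurable
  refine measure_ext_of_integral_cexp (fun (k : (ℝ≥0 × Fin d) ⊕ (ℝ≥0 × Fin d)) z =>
    k.elim (fun p => z.1 p.1 p.2) (fun p => z.2 p.1 p.2))
    pathSpace_prod_measurableSpace_eq _ _ fun s a => ?_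
  have hmeas : Measurable fun z : PathSpace d × PathSpace d =>
      ∑ k ∈ s, a k * k.elim (fun p => z.1 p.1 p.2) (fun p => z.2 p.1 p.2) := by
    refine Finset.measurable_sum _ fun k _ => Measurable.const_mul ?_ _
    rcases k with p | p
    · exact (measurable_eval_coord p.1 p.2).comp measurable_fst
    · exact (measurable_eval_coord p.1 p.2).comp measurable_snd
  rw [integral_map hm.aemeasurable (aestronglyMeasurable_cexp hmeas)]
  set p : (ℝ≥0 × Fin d) ⊕ (ℝ≥0 × Fin d) → ℝ≥0 × Fin d := fun k => k.elim id id
  have h2 : (√2)⁻¹ * (√2)⁻¹ = (1 / 2 : ℝ) := by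
    rw [← mul_inv, Real.mul_self_sqrt (by norm_num)]; norm_num
  have e1 : ∀ z : PathSpace d × PathSpace d,
      ∑ k ∈ s, a k * k.elim (fun p => (rotate z).1 p.1 p.2) (fun p => (rotate z).2 p.1 p.2)
      = ∑ k ∈ s, (((√2)⁻¹ * a k) * z.1 (p k).1 (p k).2
        + ((√2)⁻¹ * a k * k.elim (fun _ => 1) (fun _ => -1)) * z.2 (p k).1 (p k).2) := by
    intro z
    refine Finset.sum_congr rfl fun k _ => ?_
    rcases k with k | k <;> simp [rotate, p] <;> ring
  have e2 : ∀ z : PathSpace d × PathSpace d,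
      ∑ k ∈ s, a k * k.elim (fun p => z.1 p.1 p.2) (fun p => z.2 p.1 p.2)
      = ∑ k ∈ s, ((a k * k.elim (fun _ => 1) (fun _ => 0)) * z.1 (p k).1 (p k).2
        + (a k * k.elim (fun _ => 0) (fun _ => 1)) * z.2 (p k).1 (p k).2) := by
    intro z
    refine Finset.sum_congr rfl fun k _ => ?_
    rcases k with k | k <;> simp [p]
  simp_rw [e1, e2]
  rw [hW.integral_cexp_prod, hW.integral_cexp_prod]
  congr 5
  refine funext fun k => Finset.sum_congr rfl fun l _ => ?_
  rw [← add_mul, ← add_mul]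
  congr 1
  generalize a k = A, a l = B
  rcases k with k | k <;> rcases l with l | l <;> simp only [Sum.elim_inl, Sum.elim_inr]
  · linear_combination (2 * A * B) * h2
  · ring
  · ring
  · linear_combination (2 * A * B) * h2

lemma measurable_neg_path : Measurable (fun x : PathSpace d => -x) :=
  measurable_path_of_coord fun t i => (measurable_eval_coord t i).neg

/-- The covariance is quadratic in the coefficients. This symmetry later removes the cross term
between independent displacements. -/
lemma IsWienerMeasure.map_neg (hW : IsWienerMeasure W) : W.map (fun x => -x) = W := by
  have := hW.isProbabilityMeasure
  have hm := measurable_neg_path (d := d)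
  have : IsProbabilityMeasure (W.map (fun x => -x)) :=
    Measure.isProbabilityMeasure_map hm.aemeasurable
  refine measure_ext_of_integral_cexp (fun (p : ℝ≥0 × Fin d) x => x p.1 p.2)
    pathSpace_measurableSpace_eq _ _ fun s a => ?_
  have hmeas : Measurable fun x : PathSpace d => ∑ k ∈ s, a k * x k.1 k.2 :=
    Finset.measurable_sum _ fun k _ => (measurable_eval_coord k.1 k.2).const_mul _
  rw [integral_map hm.aemeasurable (aestronglyMeasurable_cexp hmeas)]
  have e : ∀ x : PathSpace d, ∑ k ∈ s, a k * (-x) k.1 k.2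
      = ∑ k ∈ s, (-a k) * x k.1 k.2 := by
    intro z
    refine Finset.sum_congr rfl fun k _ => ?_
    simp
  simp_rw [e]
  rw [hW.integral_cexp s (fun k => k), hW.integral_cexp s (fun k => k) a]
  simp

end wiener

/-! ### Positive definite kernels -/

/-- A real kernel all of whose finite Gram matrices are positive semidefinite. -/
def IsPosDefKernel {X : Type*} (K : X → X → ℝ) : Prop :=
  ∀ (n : ℕ) (x : Fin n → X), (Matrix.of fun i j => K (x i) (x j)).PosSemidef

namespace IsPosDefKernel
variable {X : Type*} {K K' : X → X → ℝ}

lemma iff : IsPosDefKernel K ↔ (∀ x y, K x y = K y x) ∧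
    ∀ (n : ℕ) (x : Fin n → X) (c : Fin n → ℝ), 0 ≤ ∑ i, ∑ j, c i * K (x i) (x j) * c j := by
  have e : ∀ (n : ℕ) (x : Fin n → X) (c : Fin n → ℝ),
      star c ⬝ᵥ ((Matrix.of fun i j => K (x i) (x j)).mulVec c)
        = ∑ i, ∑ j, c i * K (x i) (x j) * c j := by
    intro n x c
    simp [dotProduct, Matrix.mulVec, Finset.mul_sum, mul_assoc]
  constructor
  · intro h
    refine ⟨fun x y => ?_, fun n x c => ?_⟩
    · have := (h 2 ![x, y]).1.apply 1 0
      simpa using this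
    · rw [← e]; exact (h n x).dotProduct_mulVec_nonneg c
  · rintro ⟨h1, h2⟩ n x
    refine Matrix.PosSemidef.of_dotProduct_mulVec_nonneg ?_ fun c => ?_
    · ext i j
      simp [h1 (x i)]
    · rw [e]; exact h2 n x c

lemma symm (h : IsPosDefKernel K) (x y : X) : K x y = K y x := (iff.1 h).1 x y

/-- Schur's product theorem. Together with sums and limits it makes the class stable under power
series with nonnegative coefficients. -/
lemma mul (h : IsPosDefKernel K) (h' : IsPosDefKernel K') :
    IsPosDefKernel fun x y => K x y * K' x y :=
  fun n x => (h n x).hadamard (h' n x)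

lemma add (h : IsPosDefKernel K) (h' : IsPosDefKernel K') :
    IsPosDefKernel fun x y => K x y + K' x y :=
  fun n x => (h n x).add (h' n x)

lemma rankOne (f : X → ℝ) : IsPosDefKernel fun x y => f x * f y := by
  refine iff.2 ⟨fun x y => mul_comm _ _, fun n x c => ?_⟩
  have : ∑ i, ∑ j, c i * (f (x i) * f (x j)) * c j = (∑ i, c i * f (x i)) ^ 2 := by
    rw [sq, Finset.sum_mul_sum]
    refine Finset.sum_congr rfl fun i _ => Finset.sum_congr rfl fun j _ => ?_
    ring
  rw [this]
  positivity

lemma const {a : ℝ} (ha : 0 ≤ a) : IsPosDefKernel fun _ _ : X => a := by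
  simpa [Real.mul_self_sqrt ha] using rankOne (X := X) fun _ => √a

lemma const_mul (h : IsPosDefKernel K) {a : ℝ} (ha : 0 ≤ a) :
    IsPosDefKernel fun x y => a * K x y :=
  (const ha).mul h

lemma pow (h : IsPosDefKernel K) (n : ℕ) : IsPosDefKernel fun x y => K x y ^ n := by
  induction n with
  | zero => simpa using const (X := X) zero_le_one
  | succ n ih => simpa [pow_succ] using ih.mul h

lemma sum {ι : Type*} (s : Finset ι) {K : ι → X → X → ℝ} (h : ∀ i ∈ s, IsPosDefKernel (K i)) :
    IsPosDefKernel fun x y => ∑ i ∈ s, K i x y := by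
  classical
  induction s using Finset.induction_on with
  | empty => simpa using const (X := X) le_rfl
  | insert i s hi ih =>
    simp only [Finset.sum_insert hi]
    exact (h i (Finset.mem_insert_self i s)).add
      (ih fun j hj => h j (Finset.mem_insert_of_mem hj))

lemma of_tendsto {ι : Type*} {l : Filter ι} [l.NeBot] {F : ι → X → X → ℝ}
    (h : ∀ i, IsPosDefKernel (F i)) (hl : ∀ x y, Tendsto (fun i => F i x y) l (𝓝 (K x y))) :
    IsPosDefKernel K := by
  refine iff.2 ⟨fun x y => tendsto_nhds_unique (hl x y)
    ((hl y x).congr fun i => ((h i).symm x y).symm), fun n x c => ?_⟩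
  refine ge_of_tendsto' (x := l) (f := fun k => ∑ i, ∑ j, c i * F k (x i) (x j) * c j) ?_
    fun k => (iff.1 (h k)).2 n x c
  exact tendsto_finsetSum _ fun i _ => tendsto_finsetSum _ fun j _ =>
    ((hl _ _).const_mul _).mul_const _

lemma of_hasSum {F : ℕ → X → X → ℝ} (h : ∀ i, IsPosDefKernel (F i))
    (hl : ∀ x y, HasSum (fun i => F i x y) (K x y)) : IsPosDefKernel K :=
  of_tendsto (fun n => sum (Finset.range n) fun i _ => h i) fun x y => (hl x y).tendsto_sum_nat

/-- All Taylor coefficients of `sinh` are nonnegative. -/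
lemma sinh (h : IsPosDefKernel K) : IsPosDefKernel fun x y => Real.sinh (K x y) := by
  refine of_hasSum (F := fun n x y => K x y ^ (2 * n + 1) / (2 * n + 1).factorial) (fun n => ?_)
    fun x y => Real.hasSum_sinh _
  simp_rw [div_eq_inv_mul]
  exact (h.pow _).const_mul (by positivity)

lemma cosh (h : IsPosDefKernel K) : IsPosDefKernel fun x y => Real.cosh (K x y) := by
  refine of_hasSum (F := fun n x y => K x y ^ (2 * n) / (2 * n).factorial) (fun n => ?_)
    fun x y => Real.hasSum_cosh _
  simp_rw [div_eq_inv_mul]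
  exact (h.pow _).const_mul (by positivity)

lemma exp (h : IsPosDefKernel K) : IsPosDefKernel fun x y => Real.exp (K x y) := by
  simp_rw [← Real.cosh_add_sinh]
  exact h.cosh.add h.sinh

lemma integral {Θ : Type*} [MeasurableSpace Θ] (m : Measure Θ) {K : Θ → X → X → ℝ}
    (h : ∀ θ, IsPosDefKernel (K θ)) (hi : ∀ x y, Integrable (fun θ => K θ x y) m) :
    IsPosDefKernel fun x y => ∫ θ, K θ x y ∂m := by
  refine iff.2 ⟨fun x y => integral_congr_ae (ae_of_all _ fun θ => (h θ).symm x y),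
    fun n x c => ?_⟩
  have : ∑ i, ∑ j, c i * (∫ θ, K θ (x i) (x j) ∂m) * c j
      = ∫ θ, ∑ i, ∑ j, c i * K θ (x i) (x j) * c j ∂m := by
    rw [integral_finsetSum _ fun i _ => integrable_finsetSum _ fun j _ =>
      ((hi _ _).const_mul _).mul_const _]
    refine Finset.sum_congr rfl fun i _ => ?_
    rw [integral_finsetSum _ fun j _ => ((hi _ _).const_mul _).mul_const _]
    refine Finset.sum_congr rfl fun j _ => ?_
    rw [integral_mul_const, integral_const_mul]
  rw [this]
  exact integral_nonneg fun θ => (iff.1 (h θ)).2 n x c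

lemma of_inner {E : Type*} [NormedAddCommGroup E] [InnerProductSpace ℝ E] (f : X → E) :
    IsPosDefKernel fun x y => inner ℝ (f x) (f y) := by
  refine iff.2 ⟨fun x y => real_inner_comm _ _, fun n x c => ?_⟩
  have : ∑ i, ∑ j, c i * inner ℝ (f (x i)) (f (x j)) * c j
      = inner ℝ (∑ i, c i • f (x i)) (∑ i, c i • f (x i)) := by
    rw [sum_inner]
    refine Finset.sum_congr rfl fun i _ => ?_
    rw [inner_sum]
    refine Finset.sum_congr rfl fun j _ => ?_
    rw [real_inner_smul_left, real_inner_smul_right]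
    ring
  rw [this]
  exact real_inner_self_nonneg

/-- Two distinct members of an i.i.d. sample form a pair with law `μ ⊗ μ`; used to average a Gram
matrix over a random sample. -/
lemma map_pi_pair {X : Type*} [MeasurableSpace X] (μ : Measure X) [IsProbabilityMeasure μ]
    {n : ℕ} {i j : Fin n} (hij : i ≠ j) :
    (Measure.pi fun _ : Fin n => μ).map (fun x => (x i, x j)) = μ.prod μ := by
  have h := (iIndepFun_pi (μ := fun _ : Fin n => μ) (X := fun _ => id)
    fun _ => aemeasurable_id).indepFun hij
  change IndepFun (fun x : Fin n → X => x i) (fun x : Fin n → X => x j) _ at h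
  rw [indepFun_iff_map_prod_eq_prod_map_map (measurable_pi_apply i).aemeasurable
    (measurable_pi_apply j).aemeasurable] at h
  rw [h]
  congr 1
  · exact (measurePreserving_eval (fun _ : Fin n => μ) i).map_eq
  · exact (measurePreserving_eval (fun _ : Fin n => μ) j).map_eq

/-- The double integral of a positive definite kernel is nonnegative. -/
lemma integral_prod_nonneg [MeasurableSpace X] (h : IsPosDefKernel K) (μ : Measure X)
    [IsProbabilityMeasure μ] (hi : Integrable (fun z : X × X => K z.1 z.2) (μ.prod μ))
    (hd : Integrable (fun x => K x x) μ) : 0 ≤ ∫ z : X × X, K z.1 z.2 ∂(μ.prod μ) := by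
  set J := ∫ z : X × X, K z.1 z.2 ∂(μ.prod μ)
  set D := ∫ x, K x x ∂μ
  -- Averages the all-ones quadratic form of the Gram matrix of `n + 1` i.i.d. points: the diagonal
  -- contributes `n + 1` copies of `D`, the off-diagonal `(n + 1) n` copies of `J`. If `J < 0`, the
  -- latter wins for large `n`. No regularity of the kernel enters beyond integrability.
  have key : ∀ n : ℕ, 0 ≤ ((n : ℝ) + 1) * D + ((n : ℝ) + 1) * n * J := by
    intro n
    set π := Measure.pi fun _ : Fin (n + 1) => μ
    have hint : ∀ i j : Fin (n + 1), Integrable (fun x : Fin (n + 1) → X => K (x i) (x j)) π := by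
      intro i j
      by_cases hij : i = j
      · subst hij
        exact (measurePreserving_eval (fun _ : Fin (n + 1) => μ) i).integrable_comp_of_integrable hd
      · have hm : MeasurePreserving (fun x : Fin (n + 1) → X => (x i, x j)) π (μ.prod μ) :=
          ⟨by fun_prop, map_pi_pair μ hij⟩
        exact hm.integrable_comp_of_integrable hi
    have hval : ∀ i j : Fin (n + 1), ∫ x, K (x i) (x j) ∂π = if i = j then D else J := by
      intro i j
      split_ifs with hij
      · subst hij
        have hm := measurePreserving_eval (fun _ : Fin (n + 1) => μ) i
        have hd' : AEStronglyMeasurable (fun x => K x x) (π.map (Function.eval i)) := by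
          rw [hm.map_eq]; exact hd.1
        have := integral_map hm.measurable.aemeasurable hd'
        rw [hm.map_eq] at this
        exact this.symm
      · have hm : MeasurePreserving (fun x : Fin (n + 1) → X => (x i, x j)) π (μ.prod μ) :=
          ⟨by fun_prop, map_pi_pair μ hij⟩
        have hd' : AEStronglyMeasurable (fun z : X × X => K z.1 z.2)
            (π.map (fun x : Fin (n + 1) → X => (x i, x j))) := by
          rw [hm.map_eq]; exact hi.1
        have := integral_map hm.measurable.aemeasurable hd'
        rw [hm.map_eq] at this
        exact this.symm
    have h0 : 0 ≤ ∫ x, ∑ i, ∑ j, K (x i) (x j) ∂π := by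
      refine integral_nonneg fun x => ?_
      simpa using (iff.1 h).2 (n + 1) x (fun _ => 1)
    rw [integral_finsetSum _ fun i _ => integrable_finsetSum _ fun j _ => hint i j] at h0
    simp_rw [integral_finsetSum _ fun j _ => hint _ j, hval] at h0
    have e : ∀ i : Fin (n + 1), ∑ j, (if i = j then D else J) = D + n * J := by
      intro i
      have : ∀ j, (if i = j then D else J) = (if i = j then D - J else 0) + J := by
        intro j; split_ifs <;> ring
      simp_rw [this, Finset.sum_add_distrib]
      simp
      ring
    simp_rw [e] at h0
    simp only [Finset.sum_const, Finset.card_univ, Fintype.card_fin, nsmul_eq_mul] at h0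
    push_cast at h0
    linarith
  by_contra hJ
  push Not at hJ
  obtain ⟨n, hn⟩ := exists_nat_gt (D / (-J))
  have h1 : D < n * (-J) := (div_lt_iff₀ (by linarith)).1 hn
  have := key n
  nlinarith [(Nat.cast_nonneg n : (0 : ℝ) ≤ n)]

end IsPosDefKernel

/-! ### Ginibre's inequality for finite Gaussian energies -/

variable {d : ℕ} {W : Measure (PathSpace d)}

lemma measurable_eval_uncurry : Measurable fun z : ℝ≥0 × PathSpace d => z.2 z.1 :=
  measurable_uncurry_of_continuous_of_measurable (u := fun (t : ℝ≥0) (x : PathSpace d) => x t)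
    (fun x => x.continuous) measurable_eval

@[fun_prop]
lemma measurable_incr {Ω : Type*} [MeasurableSpace Ω] {f : Ω → PathSpace d} {s t : Ω → ℝ}
    (hf : Measurable f) (hs : Measurable s) (ht : Measurable t) :
    Measurable fun ω => incr (f ω) (s ω) (t ω) :=
  (measurable_eval_uncurry.comp (ht.real_toNNReal.prodMk hf)).sub
    (measurable_eval_uncurry.comp (hs.real_toNNReal.prodMk hf))

lemma IsWienerMeasure.integrable_norm_sq_incr (hW : IsWienerMeasure W) (s t : ℝ) :
    Integrable (fun x => ‖incr x s t‖ ^ 2) W := by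
  simp_rw [EuclideanSpace.norm_sq_eq]
  refine integrable_finsetSum _ fun i _ => ?_
  have hB := (hW.brownian i).toIsPreBrownianReal
  have h := ((hB.isGaussianProcess.hasGaussianLaw_eval t.toNNReal).memLp_two.sub
    (hB.isGaussianProcess.hasGaussianLaw_eval s.toNNReal).memLp_two).integrable_sq
  refine h.congr (ae_of_all _ fun x => ?_)
  simp [incr]

/-- The energy `∫ exp (-u² |x_{s,t}|² / 2) m(ds dt du)`. -/
def gaussEnergy (m : Measure ((ℝ × ℝ) × ℝ)) (x : PathSpace d) : ℝ :=
  ∫ θ, Real.exp (-(θ.2 ^ 2 * ‖incr x θ.1.1 θ.1.2‖ ^ 2 / 2)) ∂m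

section energy
variable (m : Measure ((ℝ × ℝ) × ℝ)) [IsFiniteMeasure m]

lemma integrable_gaussEnergy (x : PathSpace d) :
    Integrable (fun θ : (ℝ × ℝ) × ℝ => Real.exp (-(θ.2 ^ 2 * ‖incr x θ.1.1 θ.1.2‖ ^ 2 / 2))) m := by
  refine Integrable.of_bound (C := 1) (Measurable.aestronglyMeasurable (by fun_prop))
    (ae_of_all _ fun θ => ?_)
  rw [Real.norm_eq_abs, Real.abs_exp, Real.exp_le_one_iff]
  have : 0 ≤ θ.2 ^ 2 * ‖incr x θ.1.1 θ.1.2‖ ^ 2 / 2 := by positivity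
  linarith

lemma gaussEnergy_le (x : PathSpace d) : gaussEnergy m x ≤ m.real univ := by
  have : gaussEnergy m x ≤ ∫ _, (1 : ℝ) ∂m := by
    refine integral_mono (integrable_gaussEnergy m x) (integrable_const _) fun θ => ?_
    rw [Real.exp_le_one_iff]
    have : 0 ≤ θ.2 ^ 2 * ‖incr x θ.1.1 θ.1.2‖ ^ 2 / 2 := by positivity
    linarith
  simpa using this

lemma measurable_gaussEnergy : Measurable (gaussEnergy (d := d) m) := by
  have : StronglyMeasurable fun z : PathSpace d × ((ℝ × ℝ) × ℝ) =>
      Real.exp (-(z.2.2 ^ 2 * ‖incr z.1 z.2.1.1 z.2.1.2‖ ^ 2 / 2)) :=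
    Measurable.stronglyMeasurable (by fun_prop)
  exact (this.integral_prod_right (ν := m)).measurable

lemma incr_rotate_fst (z : PathSpace d × PathSpace d) (s t : ℝ) :
    incr (rotate z).1 s t = (√2)⁻¹ • (incr z.1 s t + incr z.2 s t) := by
  simp only [incr, rotate, ContinuousMap.smul_apply, ContinuousMap.add_apply, ← smul_sub]
  congr 1; abel

lemma incr_rotate_snd (z : PathSpace d × PathSpace d) (s t : ℝ) :
    incr (rotate z).2 s t = (√2)⁻¹ • (incr z.1 s t - incr z.2 s t) := by
  simp only [incr, rotate, ContinuousMap.smul_apply, ContinuousMap.sub_apply, ← smul_sub]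
  congr 1; abel

/-- The rotated squares share a half-sum and differ only by the sign of the inner product. Sums of
the rotated Gaussians thus produce `cosh`, differences `sinh`, of a positive definite kernel. -/
lemma norm_sq_rotate_fst (z : PathSpace d × PathSpace d) (s t : ℝ) :
    ‖incr (rotate z).1 s t‖ ^ 2 = (‖incr z.1 s t‖ ^ 2 + ‖incr z.2 s t‖ ^ 2) / 2
      + inner ℝ (incr z.1 s t) (incr z.2 s t) := by
  rw [incr_rotate_fst, norm_smul, mul_pow, norm_add_sq_real, norm_inv, inv_pow,
    Real.norm_of_nonneg (Real.sqrt_nonneg _), Real.sq_sqrt (by norm_num)]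
  ring

lemma norm_sq_rotate_snd (z : PathSpace d × PathSpace d) (s t : ℝ) :
    ‖incr (rotate z).2 s t‖ ^ 2 = (‖incr z.1 s t‖ ^ 2 + ‖incr z.2 s t‖ ^ 2) / 2
      - inner ℝ (incr z.1 s t) (incr z.2 s t) := by
  rw [incr_rotate_snd, norm_smul, mul_pow, norm_sub_sq_real, norm_inv, inv_pow,
    Real.norm_of_nonneg (Real.sqrt_nonneg _), Real.sq_sqrt (by norm_num)]
  ring

/-- For each `θ` the kernel is a rank-one kernel times `2 cosh` of a nonnegative multiple of the
inner product; integration over `θ` preserves positive definiteness. -/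
lemma isPosDefKernel_gaussEnergy_add : IsPosDefKernel fun p q : PathSpace d =>
    gaussEnergy m (rotate (p, q)).1 + gaussEnergy m (rotate (p, q)).2 := by
  simp_rw [gaussEnergy, ← integral_add (integrable_gaussEnergy m _) (integrable_gaussEnergy m _)]
  refine IsPosDefKernel.integral m (fun θ => ?_) fun p q =>
    (integrable_gaussEnergy m _).add (integrable_gaussEnergy m _)
  have e : ∀ p q : PathSpace d,
      Real.exp (-(θ.2 ^ 2 * ‖incr (rotate (p, q)).1 θ.1.1 θ.1.2‖ ^ 2 / 2))
        + Real.exp (-(θ.2 ^ 2 * ‖incr (rotate (p, q)).2 θ.1.1 θ.1.2‖ ^ 2 / 2))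
      = 2 * ((Real.exp (-(θ.2 ^ 2 * ‖incr p θ.1.1 θ.1.2‖ ^ 2 / 4))
        * Real.exp (-(θ.2 ^ 2 * ‖incr q θ.1.1 θ.1.2‖ ^ 2 / 4)))
        * Real.cosh (θ.2 ^ 2 / 2 * inner ℝ (incr p θ.1.1 θ.1.2) (incr q θ.1.1 θ.1.2))) := by
    intro p q
    rw [norm_sq_rotate_fst, norm_sq_rotate_snd, Real.cosh_eq]
    generalize ‖incr p θ.1.1 θ.1.2‖ ^ 2 = a
    generalize ‖incr q θ.1.1 θ.1.2‖ ^ 2 = b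
    generalize inner ℝ (incr p θ.1.1 θ.1.2) (incr q θ.1.1 θ.1.2) = c
    rw [show -(θ.2 ^ 2 * ((a + b) / 2 + c) / 2)
        = -(θ.2 ^ 2 * a / 4) + -(θ.2 ^ 2 * b / 4) + -(θ.2 ^ 2 / 2 * c) by ring,
      show -(θ.2 ^ 2 * ((a + b) / 2 - c) / 2)
        = -(θ.2 ^ 2 * a / 4) + -(θ.2 ^ 2 * b / 4) + θ.2 ^ 2 / 2 * c by ring]
    simp only [Real.exp_add]
    ring
  simp_rw [e]
  exact ((IsPosDefKernel.rankOne fun p : PathSpace d =>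
    Real.exp (-(θ.2 ^ 2 * ‖incr p θ.1.1 θ.1.2‖ ^ 2 / 4))).mul
    ((IsPosDefKernel.of_inner fun p : PathSpace d => incr p θ.1.1 θ.1.2).const_mul
      (by positivity)).cosh).const_mul zero_le_two

/-- The same computation with `sinh`. The order matters: the second rotated path is the difference,
so its squared increment carries the minus sign and its Gaussian the plus sign in front of the inner
product. -/
lemma isPosDefKernel_gaussEnergy_sub : IsPosDefKernel fun p q : PathSpace d =>
    gaussEnergy m (rotate (p, q)).2 - gaussEnergy m (rotate (p, q)).1 := by
  simp_rw [gaussEnergy, ← integral_sub (integrable_gaussEnergy m _) (integrable_gaussEnergy m _)]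
  refine IsPosDefKernel.integral m (fun θ => ?_) fun p q =>
    (integrable_gaussEnergy m _).sub (integrable_gaussEnergy m _)
  have e : ∀ p q : PathSpace d,
      Real.exp (-(θ.2 ^ 2 * ‖incr (rotate (p, q)).2 θ.1.1 θ.1.2‖ ^ 2 / 2))
        - Real.exp (-(θ.2 ^ 2 * ‖incr (rotate (p, q)).1 θ.1.1 θ.1.2‖ ^ 2 / 2))
      = 2 * ((Real.exp (-(θ.2 ^ 2 * ‖incr p θ.1.1 θ.1.2‖ ^ 2 / 4))
        * Real.exp (-(θ.2 ^ 2 * ‖incr q θ.1.1 θ.1.2‖ ^ 2 / 4)))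
        * Real.sinh (θ.2 ^ 2 / 2 * inner ℝ (incr p θ.1.1 θ.1.2) (incr q θ.1.1 θ.1.2))) := by
    intro p q
    rw [norm_sq_rotate_fst, norm_sq_rotate_snd, Real.sinh_eq]
    generalize ‖incr p θ.1.1 θ.1.2‖ ^ 2 = a
    generalize ‖incr q θ.1.1 θ.1.2‖ ^ 2 = b
    generalize inner ℝ (incr p θ.1.1 θ.1.2) (incr q θ.1.1 θ.1.2) = c
    rw [show -(θ.2 ^ 2 * ((a + b) / 2 + c) / 2)
        = -(θ.2 ^ 2 * a / 4) + -(θ.2 ^ 2 * b / 4) + -(θ.2 ^ 2 / 2 * c) by ring,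
      show -(θ.2 ^ 2 * ((a + b) / 2 - c) / 2)
        = -(θ.2 ^ 2 * a / 4) + -(θ.2 ^ 2 * b / 4) + θ.2 ^ 2 / 2 * c by ring]
    simp only [Real.exp_add]
    ring
  simp_rw [e]
  exact ((IsPosDefKernel.rankOne fun p : PathSpace d =>
    Real.exp (-(θ.2 ^ 2 * ‖incr p θ.1.1 θ.1.2‖ ^ 2 / 4))).mul
    ((IsPosDefKernel.of_inner fun p : PathSpace d => incr p θ.1.1 θ.1.2).const_mul
      (by positivity)).sinh).const_mul zero_le_two

end energy

/-- Ginibre's correlation inequality for Gaussian energies: strengthening the interaction decreases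
the mean square displacement. -/
lemma IsWienerMeasure.ginibre (hW : IsWienerMeasure W) (m₁ m₂ : Measure ((ℝ × ℝ) × ℝ))
    [IsFiniteMeasure m₁] [IsFiniteMeasure m₂] (T : ℝ) :
    (∫ x, Real.exp (gaussEnergy m₁ x + gaussEnergy m₂ x) * ‖incr x 0 T‖ ^ 2 ∂W)
        * ∫ x, Real.exp (gaussEnergy m₁ x) ∂W
      ≤ (∫ x, Real.exp (gaussEnergy m₁ x) * ‖incr x 0 T‖ ^ 2 ∂W)
        * ∫ x, Real.exp (gaussEnergy m₁ x + gaussEnergy m₂ x) ∂W := by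
  have := hW.isProbabilityMeasure
  have hm₁ := measurable_gaussEnergy (d := d) m₁
  have hm₂ := measurable_gaussEnergy (d := d) m₂
  set L : PathSpace d → ℝ := fun x => ‖incr x 0 T‖ ^ 2 with hL
  have hLm : Measurable L := by fun_prop
  have hLi : Integrable L W := hW.integrable_norm_sq_incr 0 T
  set w : PathSpace d → ℝ := fun x => Real.exp (gaussEnergy m₁ x) with hw
  set w' : PathSpace d → ℝ := fun x => Real.exp (gaussEnergy m₁ x + gaussEnergy m₂ x) with hw'
  have hwm : Measurable w := by fun_prop
  have hwm' : Measurable w' := by fun_prop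
  obtain ⟨C, hC⟩ : ∃ C, ∀ x, ‖w x‖ ≤ C :=
    ⟨Real.exp (m₁.real univ), fun x => by
      rw [Real.norm_eq_abs, Real.abs_exp]; exact Real.exp_le_exp.2 (gaussEnergy_le m₁ x)⟩
  obtain ⟨C', hC'⟩ : ∃ C, ∀ x, ‖w' x‖ ≤ C :=
    ⟨Real.exp (m₁.real univ + m₂.real univ), fun x => by
      rw [Real.norm_eq_abs, Real.abs_exp]
      exact Real.exp_le_exp.2 (add_le_add (gaussEnergy_le m₁ x) (gaussEnergy_le m₂ x))⟩
  have hwi : Integrable w W := Integrable.of_bound hwm.aestronglyMeasurable C (ae_of_all _ hC)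
  have hwi' : Integrable w' W := Integrable.of_bound hwm'.aestronglyMeasurable C' (ae_of_all _ hC')
  have hwL : Integrable (fun x => w x * L x) W :=
    hLi.bdd_mul hwm.aestronglyMeasurable (ae_of_all _ hC)
  have hwL' : Integrable (fun x => w' x * L x) W :=
    hLi.bdd_mul hwm'.aestronglyMeasurable (ae_of_all _ hC')
  -- `F = (L₁ - L₂)(w₁ w'₂ - w'₁ w₂)`, the subscripts denoting the two copies; its integral is twice
  -- the right side minus the left side of the claim.
  set F : PathSpace d × PathSpace d → ℝ := fun z =>
    (w z.1 * L z.1) * w' z.2 - (w' z.1 * L z.1) * w z.2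
      - (w z.1 * (w' z.2 * L z.2) - w' z.1 * (w z.2 * L z.2)) with hF
  have i1 := hwL.mul_prod hwi'
  have i2 := hwL'.mul_prod hwi
  have i3 := hwi.mul_prod hwL'
  have i4 := hwi'.mul_prod hwL
  have hFi : Integrable F (W.prod W) := (i1.sub i2).sub (i3.sub i4)
  have hFint : ∫ z, F z ∂(W.prod W)
      = 2 * ((∫ x, w x * L x ∂W) * ∫ x, w' x ∂W) - 2 * ((∫ x, w' x * L x ∂W) * ∫ x, w x ∂W) := by
    refine (integral_sub (i1.sub i2) (i3.sub i4)).trans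
      ((congrArg₂ (· - ·) (integral_sub i1 i2) (integral_sub i3 i4)).trans ?_)
    rw [integral_prod_mul (fun x => w x * L x) w', integral_prod_mul (fun x => w' x * L x) w,
      integral_prod_mul w (fun x => w' x * L x), integral_prod_mul w' (fun x => w x * L x)]
    ring
  have hrot : MeasurePreserving (rotate (d := d)) (W.prod W) (W.prod W) :=
    ⟨measurable_rotate, hW.map_rotate⟩
  -- In rotated variables `L₁ - L₂` is twice an inner product. The weight factor is `exp` of the
  -- summed `m₁` energies times `exp b' - exp a'`, and `exp b' - exp a' = exp ((a' + b')/2) · 2 sinh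
  -- ((b' - a')/2)`. Every factor is positive definite.
  have hK : ∀ p q, F (rotate (p, q)) = 2 * inner ℝ (incr p 0 T) (incr q 0 T)
      * (Real.exp (gaussEnergy m₁ (rotate (p, q)).1 + gaussEnergy m₁ (rotate (p, q)).2)
      * (Real.exp (1 / 2 * (gaussEnergy m₂ (rotate (p, q)).1 + gaussEnergy m₂ (rotate (p, q)).2))
      * (2 * Real.sinh (1 / 2 *
        (gaussEnergy m₂ (rotate (p, q)).2 - gaussEnergy m₂ (rotate (p, q)).1))))) := by
    intro p q
    have e1 : F (rotate (p, q)) = (L (rotate (p, q)).1 - L (rotate (p, q)).2) *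
        (w (rotate (p, q)).1 * w' (rotate (p, q)).2
          - w' (rotate (p, q)).1 * w (rotate (p, q)).2) := by
      simp only [hF]; ring
    have e2 : L (rotate (p, q)).1 - L (rotate (p, q)).2
        = 2 * inner ℝ (incr p 0 T) (incr q 0 T) := by
      simp only [hL, norm_sq_rotate_fst, norm_sq_rotate_snd]; ring
    rw [e1, e2]
    congr 1
    simp only [hw, hw']
    generalize gaussEnergy m₁ (rotate (p, q)).1 = a
    generalize gaussEnergy m₁ (rotate (p, q)).2 = b
    generalize gaussEnergy m₂ (rotate (p, q)).1 = a'
    generalize gaussEnergy m₂ (rotate (p, q)).2 = b'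
    rw [Real.sinh_eq, mul_div_cancel₀ _ (two_ne_zero), mul_sub, mul_sub, ← Real.exp_add,
      ← Real.exp_add, ← Real.exp_add, ← Real.exp_add, ← Real.exp_add, ← Real.exp_add]
    congr 2 <;> ring
  have hPD : IsPosDefKernel fun p q : PathSpace d => F (rotate (p, q)) := by
    simp_rw [hK]
    refine ((IsPosDefKernel.of_inner fun p : PathSpace d => incr p 0 T).const_mul zero_le_two).mul
      ((isPosDefKernel_gaussEnergy_add m₁).exp.mul
      (((isPosDefKernel_gaussEnergy_add m₂).const_mul (by norm_num)).exp.mul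
      (((isPosDefKernel_gaussEnergy_sub m₂).const_mul (by norm_num)).sinh.const_mul zero_le_two)))
  -- Diagonal integrability is required by `integral_prod_nonneg`; the weights are bounded, so it
  -- reduces to the second moment of the increment.
  have hdiag : Integrable (fun x : PathSpace d => F (rotate (x, x))) W := by
    have hrm : Measurable fun x : PathSpace d => rotate (x, x) := measurable_rotate.comp
      (measurable_id.prodMk measurable_id)
    have hrm1 : Measurable fun x : PathSpace d => (rotate (x, x)).1 := hrm.fst
    have hrm2 : Measurable fun x : PathSpace d => (rotate (x, x)).2 := hrm.snd
    have e : ∀ x : PathSpace d, F (rotate (x, x)) = (w (rotate (x, x)).1 * w' (rotate (x, x)).2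
          - w' (rotate (x, x)).1 * w (rotate (x, x)).2) * (2 * L x) := by
      intro x
      have e2 : L (rotate (x, x)).1 - L (rotate (x, x)).2
          = 2 * L x := by
        simp only [hL, norm_sq_rotate_fst, norm_sq_rotate_snd, real_inner_self_eq_norm_sq]; ring
      rw [← e2]
      simp only [hF]; ring
    simp_rw [e]
    refine (hLi.const_mul 2).bdd_mul (c := C * C' + C' * C) ?_ (ae_of_all _ fun x => ?_)
    · exact (((hwm.comp hrm1).mul (hwm'.comp hrm2)).sub
        ((hwm'.comp hrm1).mul (hwm.comp hrm2))).aestronglyMeasurable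
    · refine (norm_sub_le _ _).trans (add_le_add ?_ ?_)
      · rw [norm_mul]
        exact mul_le_mul (hC _) (hC' _) (norm_nonneg _) ((norm_nonneg _).trans (hC x))
      · rw [norm_mul]
        exact mul_le_mul (hC' _) (hC _) (norm_nonneg _) ((norm_nonneg _).trans (hC' x))
  have hfin := hPD.integral_prod_nonneg W (hrot.integrable_comp_of_integrable hFi) hdiag
  have hFm : AEStronglyMeasurable F ((W.prod W).map rotate) := by
    rw [hW.map_rotate]; exact hFi.1
  have e := integral_map measurable_rotate.aemeasurable hFm
  rw [hW.map_rotate] at e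
  simp only [Prod.mk.eta] at hfin
  rw [← e, hFint] at hfin
  linarith

/-! ### The exponential on `[0, ∞]` -/

section expENN

lemma continuous_expENN : Continuous expENN :=
  ENNReal.continuous_exp.comp continuous_coe_ennreal_ereal

@[fun_prop]
lemma measurable_expENN : Measurable expENN := continuous_expENN.measurable

lemma expENN_zero : expENN 0 = 1 := by simp [expENN]

lemma expENN_top : expENN ∞ = ∞ := by simp [expENN]

lemma expENN_ofReal {r : ℝ} (hr : 0 ≤ r) :
    expENN (ENNReal.ofReal r) = ENNReal.ofReal (Real.exp r) := by
  rw [expENN, EReal.coe_ennreal_ofReal, max_eq_left hr, EReal.exp_coe]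

lemma expENN_add (a b : ℝ≥0∞) : expENN (a + b) = expENN a * expENN b := by
  rw [expENN, EReal.coe_ennreal_add, EReal.exp_add]; rfl

lemma expENN_mono : Monotone expENN := fun _ _ h =>
  EReal.exp_monotone (EReal.coe_ennreal_le_coe_ennreal_iff.2 h)

lemma one_le_expENN (a : ℝ≥0∞) : 1 ≤ expENN a := expENN_zero ▸ expENN_mono zero_le

lemma expENN_ne_zero (a : ℝ≥0∞) : expENN a ≠ 0 := (one_pos.trans_le (one_le_expENN a)).ne'

lemma expENN_eq_tsum (a : ℝ≥0∞) : expENN a = ∑' n : ℕ, a ^ n / n.factorial := by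
  rcases eq_or_ne a ∞ with rfl | ha
  · rw [expENN_top, eq_comm, eq_top_iff]
    refine le_trans ?_ (ENNReal.le_tsum 1)
    simp
  · lift a to ℝ≥0 using ha
    have h : (a : ℝ≥0∞) = ENNReal.ofReal a := by simp
    rw [h, expENN_ofReal a.coe_nonneg, Real.exp_eq_exp_ℝ, NormedSpace.exp_eq_tsum_div]
    beta_reduce
    rw [ENNReal.ofReal_tsum_of_nonneg (fun n => by positivity) (Real.summable_pow_div_factorial a)]
    refine tsum_congr fun n => ?_
    rw [ENNReal.ofReal_div_of_pos (by positivity), ENNReal.ofReal_pow a.coe_nonneg,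
      ENNReal.ofReal_natCast]

end expENN

/-! ### Gaussian mixtures and Ginibre's inequality with values in `[0, ∞]` -/

/-- A Gamma integral: rescaling `u` by `r` yields `r^(-γ)`, and the prefactor in `ν_ε` is the
normalization making the constant one. -/
lemma lintegral_rpow_mul_exp {γ r : ℝ} (hγ : 0 < γ) (hr : 0 < r) :
    ∫⁻ u in Ici (0 : ℝ), ENNReal.ofReal (2 ^ ((2 - γ) / 2) / Real.Gamma (γ / 2) * u ^ (γ - 1))
      * ENNReal.ofReal (Real.exp (-(u ^ 2 * r ^ 2 / 2))) = ENNReal.ofReal (r ^ (-γ)) := by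
  have hG : 0 < Real.Gamma (γ / 2) := Real.Gamma_pos_of_pos (by positivity)
  rw [setLIntegral_congr Ioi_ae_eq_Ici.symm]
  have hb : 0 < r ^ 2 / 2 := by positivity
  have hi := (integrableOn_rpow_mul_exp_neg_mul_rpow (s := γ - 1) (p := 2) (by linarith)
    two_pos hb).const_mul (2 ^ ((2 - γ) / 2) / Real.Gamma (γ / 2))
  have e : ∀ u ∈ Ioi (0 : ℝ),
      ENNReal.ofReal (2 ^ ((2 - γ) / 2) / Real.Gamma (γ / 2) * u ^ (γ - 1))
      * ENNReal.ofReal (Real.exp (-(u ^ 2 * r ^ 2 / 2)))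
      = ENNReal.ofReal (2 ^ ((2 - γ) / 2) / Real.Gamma (γ / 2) *
        (u ^ (γ - 1) * Real.exp (-(r ^ 2 / 2) * u ^ (2 : ℝ)))) := by
    intro u hu
    have hu : 0 < u := hu
    rw [← ENNReal.ofReal_mul (by positivity), Real.rpow_two, ← mul_assoc]
    congr 3
    ring
  rw [setLIntegral_congr_fun measurableSet_Ioi e, ← ofReal_integral_eq_lintegral_ofReal hi]
  · rw [integral_const_mul, integral_rpow_mul_exp_neg_mul_rpow two_pos (by linarith) hb]
    congr 1
    rw [show γ - 1 + 1 = γ by ring, Real.div_rpow (by positivity) (by positivity),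
      ← Real.rpow_natCast r 2, ← Real.rpow_mul hr.le,
      show ((2 : ℕ) : ℝ) * (-γ / 2) = -γ by push_cast; ring,
      show (2 - γ) / 2 = 1 + -γ / 2 by ring, Real.rpow_add two_pos, Real.rpow_one]
    have : (2 : ℝ) ^ (-γ / 2) ≠ 0 := by positivity
    field_simp
  · refine (ae_restrict_iff' measurableSet_Ioi).2 (ae_of_all _ fun u hu => ?_)
    have hu : 0 < u := hu
    simp only [Pi.zero_apply]
    positivity

/-- The degenerate case `r = 0`, consistent with the value `∞` of the potential at the origin. -/
lemma lintegral_rpow_Ici {γ : ℝ} (hγ : 0 < γ) :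
    ∫⁻ u in Ici (0 : ℝ), ENNReal.ofReal (2 ^ ((2 - γ) / 2) / Real.Gamma (γ / 2) * u ^ (γ - 1))
      = ∞ := by
  have hG : 0 < Real.Gamma (γ / 2) := Real.Gamma_pos_of_pos (by positivity)
  rw [setLIntegral_congr Ioi_ae_eq_Ici.symm]
  by_contra h
  refine not_integrableOn_Ioi_rpow (γ - 1) ?_
  have h2 : IntegrableOn
      (fun u : ℝ => 2 ^ ((2 - γ) / 2) / Real.Gamma (γ / 2) * u ^ (γ - 1)) (Ioi 0) := by
    refine ⟨Measurable.aestronglyMeasurable (by fun_prop), ?_⟩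
    rw [hasFiniteIntegral_iff_ofReal]
    · exact lt_top_iff_ne_top.2 h
    · refine (ae_restrict_iff' measurableSet_Ioi).2 (ae_of_all _ fun u hu => ?_)
      have hu : 0 < u := hu
      simp only [Pi.zero_apply]
      positivity
  have h3 := h2.const_mul (2 ^ ((2 - γ) / 2) / Real.Gamma (γ / 2))⁻¹
  refine h3.congr (ae_of_all _ fun u => ?_)
  have : (2 ^ ((2 - γ) / 2) / Real.Gamma (γ / 2) : ℝ) ≠ 0 := by positivity
  beta_reduce
  rw [inv_mul_cancel_left₀ this]

instance sigmaFinite_markMeasure (γ ε : ℝ) : SigmaFinite (markMeasure γ ε) := by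
  unfold markMeasure
  have : IsFiniteMeasure (ENNReal.ofReal ε • Measure.dirac (0 : ℝ)) :=
    Measure.smul_finite _ ENNReal.ofReal_ne_top
  infer_instance

variable {d : ℕ} {W : Measure (PathSpace d)}

/-- The reason for the choice of `ν_ε`: its continuous part represents the Riesz potential, and the
atom at `u = 0`, where the Gaussian equals one, contributes `ε`. -/
lemma lintegral_markMeasure {γ : ℝ} (hγ : 0 < γ) (ε : ℝ) (y : EuclideanSpace ℝ (Fin d)) :
    ∫⁻ u, ENNReal.ofReal (Real.exp (-(u ^ 2 * ‖y‖ ^ 2 / 2))) ∂(markMeasure γ ε)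
      = potential γ ε y := by
  rw [markMeasure, lintegral_add_measure, lintegral_smul_measure, lintegral_dirac, potential,
    lintegral_withDensity_eq_lintegral_mul _ (by fun_prop) (by fun_prop)]
  congr 1
  · simp only [Pi.mul_apply]
    rcases eq_or_ne y 0 with rfl | hy
    · simp [lintegral_rpow_Ici hγ, ENNReal.zero_rpow_of_neg (neg_lt_zero.2 hγ)]
    · have hy' : 0 < ‖y‖ := norm_pos_iff.2 hy
      rw [lintegral_rpow_mul_exp hγ hy', ← ofReal_norm, ENNReal.ofReal_rpow_of_pos hy']
  · simp

/-- The energy `∫ exp (-u² |x_{s,t}|² / 2) m(ds dt du)` with values in `[0, ∞]`. -/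
def gaussLEnergy (m : Measure ((ℝ × ℝ) × ℝ)) (x : PathSpace d) : ℝ≥0∞ :=
  ∫⁻ θ, ENNReal.ofReal (Real.exp (-(θ.2 ^ 2 * ‖incr x θ.1.1 θ.1.2‖ ^ 2 / 2))) ∂m

/-- Puts the singular interaction into the form to which Ginibre's inequality applies. -/
lemma gaussLEnergy_prod_markMeasure {γ : ℝ} (hγ : 0 < γ) (ε : ℝ) (μ : Measure (ℝ × ℝ))
    [SFinite μ] (x : PathSpace d) :
    gaussLEnergy (μ.prod (markMeasure γ ε)) x
      = ∫⁻ p, potential γ ε (incr x p.1 p.2) ∂μ := by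
  rw [gaussLEnergy, lintegral_prod _ (by fun_prop)]
  simp_rw [lintegral_markMeasure hγ]

lemma measurable_gaussLEnergy (m : Measure ((ℝ × ℝ) × ℝ)) [SFinite m] :
    Measurable (gaussLEnergy (d := d) m) := by
  have : Measurable fun z : PathSpace d × ((ℝ × ℝ) × ℝ) =>
      ENNReal.ofReal (Real.exp (-(z.2.2 ^ 2 * ‖incr z.1 z.2.1.1 z.2.1.2‖ ^ 2 / 2))) := by
    fun_prop
  exact this.lintegral_prod_right'

lemma ofReal_gaussEnergy (m : Measure ((ℝ × ℝ) × ℝ)) [IsFiniteMeasure m] (x : PathSpace d) :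
    ENNReal.ofReal (gaussEnergy m x) = gaussLEnergy m x :=
  ofReal_integral_eq_lintegral_ofReal (integrable_gaussEnergy m x)
    (ae_of_all _ fun _ => (Real.exp_pos _).le)

/-- Finite measures have bounded energies, so every integral is finite and the real inequality
transfers. -/
lemma IsWienerMeasure.ginibre_lintegral_aux (hW : IsWienerMeasure W)
    (m₁ m₂ : Measure ((ℝ × ℝ) × ℝ)) [IsFiniteMeasure m₁] [IsFiniteMeasure m₂] (T : ℝ) :
    (∫⁻ x, expENN (gaussLEnergy m₁ x + gaussLEnergy m₂ x) * ‖incr x 0 T‖ₑ ^ 2 ∂W)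
        * ∫⁻ x, expENN (gaussLEnergy m₁ x) ∂W
      ≤ (∫⁻ x, expENN (gaussLEnergy m₁ x) * ‖incr x 0 T‖ₑ ^ 2 ∂W)
        * ∫⁻ x, expENN (gaussLEnergy m₁ x + gaussLEnergy m₂ x) ∂W := by
  have := hW.isProbabilityMeasure
  have key : ∀ m : Measure ((ℝ × ℝ) × ℝ), IsFiniteMeasure m →
      (∫⁻ x, expENN (gaussLEnergy m x) * ‖incr x 0 T‖ₑ ^ 2 ∂W
        = ENNReal.ofReal (∫ x, Real.exp (gaussEnergy m x) * ‖incr x 0 T‖ ^ 2 ∂W)) ∧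
      (∫⁻ x, expENN (gaussLEnergy m x) ∂W
        = ENNReal.ofReal (∫ x, Real.exp (gaussEnergy m x) ∂W)) := by
    intro m _
    have hm := measurable_gaussEnergy (d := d) m
    have h0 : ∀ x : PathSpace d, 0 ≤ gaussEnergy m x := fun x =>
      integral_nonneg fun _ => (Real.exp_pos _).le
    have hb : ∀ x : PathSpace d, ‖Real.exp (gaussEnergy m x)‖ ≤ Real.exp (m.real univ) :=
      fun x => by
      rw [Real.norm_eq_abs, Real.abs_exp]; exact Real.exp_le_exp.2 (gaussEnergy_le m x)
    have hi : Integrable (fun x : PathSpace d => Real.exp (gaussEnergy m x)) W :=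
      Integrable.of_bound (by fun_prop) _ (ae_of_all _ hb)
    have hi' : Integrable (fun x : PathSpace d =>
        Real.exp (gaussEnergy m x) * ‖incr x 0 T‖ ^ 2) W :=
      (hW.integrable_norm_sq_incr 0 T).bdd_mul (by fun_prop) (ae_of_all _ hb)
    constructor
    · rw [ofReal_integral_eq_lintegral_ofReal hi' (ae_of_all _ fun x => by
        simp only [Pi.zero_apply]; positivity)]
      refine lintegral_congr fun x => ?_
      rw [← ofReal_gaussEnergy, expENN_ofReal (h0 x), ENNReal.ofReal_mul (Real.exp_pos _).le,
        ENNReal.ofReal_pow (norm_nonneg _), ofReal_norm]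
    · rw [ofReal_integral_eq_lintegral_ofReal hi (ae_of_all _ fun x => (Real.exp_pos _).le)]
      refine lintegral_congr fun x => ?_
      rw [← ofReal_gaussEnergy, expENN_ofReal (h0 x)]
  have hadd : ∀ x : PathSpace d, gaussLEnergy m₁ x + gaussLEnergy m₂ x
      = gaussLEnergy (m₁ + m₂) x := fun x => by
    simp only [gaussLEnergy, lintegral_add_measure]
  have hadd' : ∀ x : PathSpace d, gaussEnergy (m₁ + m₂) x = gaussEnergy m₁ x + gaussEnergy m₂ x :=
    fun x => integral_add_measure (integrable_gaussEnergy m₁ x) (integrable_gaussEnergy m₂ x)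
  simp_rw [hadd]
  rw [(key (m₁ + m₂) inferInstance).1, (key (m₁ + m₂) inferInstance).2,
    (key m₁ inferInstance).1, (key m₁ inferInstance).2]
  rw [← ENNReal.ofReal_mul (integral_nonneg fun x => by positivity),
    ← ENNReal.ofReal_mul (integral_nonneg fun x => by positivity)]
  refine ENNReal.ofReal_le_ofReal ?_
  simp_rw [hadd']
  exact hW.ginibre m₁ m₂ T

/-- Restriction to an exhausting sequence of sets of finite measure, with monotone convergence. -/
lemma exists_isFiniteMeasure_tendsto_gaussLEnergy (m : Measure ((ℝ × ℝ) × ℝ)) [SigmaFinite m] :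
    ∃ r : ℕ → Measure ((ℝ × ℝ) × ℝ), (∀ n, IsFiniteMeasure (r n)) ∧ (∀ n, r n ≤ m) ∧
      (∀ x : PathSpace d, Monotone fun n => gaussLEnergy (r n) x) ∧
      ∀ x : PathSpace d, Tendsto (fun n => gaussLEnergy (r n) x) atTop (𝓝 (gaussLEnergy m x)) := by
  have hmono : ∀ x : PathSpace d,
      Monotone fun n => gaussLEnergy (m.restrict (spanningSets m n)) x :=
    fun x n k hnk => lintegral_mono' (Measure.restrict_mono (monotone_spanningSets m hnk) le_rfl)
      le_rfl
  refine ⟨fun n => m.restrict (spanningSets m n), fun n => ⟨?_⟩, fun n => Measure.restrict_le_self,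
    hmono, fun x => ?_⟩
  · rw [Measure.restrict_apply_univ]
    exact measure_spanningSets_lt_top m n
  · have h := tendsto_atTop_iSup (hmono x)
    convert h using 2
    simp only [gaussLEnergy]
    rw [← setLIntegral_iUnion_of_directed _ (monotone_spanningSets m).directed_le,
      iUnion_spanningSets, Measure.restrict_univ]

/-- Ginibre's correlation inequality for Gaussian energies with values in `[0, ∞]`. -/
lemma IsWienerMeasure.ginibre_lintegral (hW : IsWienerMeasure W)
    (m₁ m₂ : Measure ((ℝ × ℝ) × ℝ)) [SigmaFinite m₁] [SigmaFinite m₂] (T : ℝ) :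
    (∫⁻ x, expENN (gaussLEnergy m₁ x + gaussLEnergy m₂ x) * ‖incr x 0 T‖ₑ ^ 2 ∂W)
        * ∫⁻ x, expENN (gaussLEnergy m₁ x) ∂W
      ≤ (∫⁻ x, expENN (gaussLEnergy m₁ x) * ‖incr x 0 T‖ₑ ^ 2 ∂W)
        * ∫⁻ x, expENN (gaussLEnergy m₁ x + gaussLEnergy m₂ x) ∂W := by
  have := hW.isProbabilityMeasure
  obtain ⟨r₁, hf₁, hle₁, hm₁, ht₁⟩ := exists_isFiniteMeasure_tendsto_gaussLEnergy (d := d) m₁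
  obtain ⟨r₂, hf₂, hle₂, hm₂, ht₂⟩ := exists_isFiniteMeasure_tendsto_gaussLEnergy (d := d) m₂
  have hsm : Monotone fun (n : ℕ) => fun x : PathSpace d =>
      gaussLEnergy (r₁ n) x + gaussLEnergy (r₂ n) x := fun n k h x =>
    add_le_add (hm₁ x h) (hm₂ x h)
  have hst : ∀ x : PathSpace d, Tendsto (fun n => gaussLEnergy (r₁ n) x + gaussLEnergy (r₂ n) x)
      atTop (𝓝 (gaussLEnergy m₁ x + gaussLEnergy m₂ x)) := fun x =>
    (ht₁ x).add (ht₂ x)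
  have hmeas : ∀ n, Measurable fun x : PathSpace d =>
      gaussLEnergy (r₁ n) x + gaussLEnergy (r₂ n) x := fun n =>
    (measurable_gaussLEnergy _).add (measurable_gaussLEnergy _)
  have hA : Tendsto (fun n => ∫⁻ x : PathSpace d,
      expENN (gaussLEnergy (r₁ n) x + gaussLEnergy (r₂ n) x) * ‖incr x 0 T‖ₑ ^ 2 ∂W) atTop
      (𝓝 (∫⁻ x, expENN (gaussLEnergy m₁ x + gaussLEnergy m₂ x) * ‖incr x 0 T‖ₑ ^ 2 ∂W)) := by
    refine lintegral_tendsto_of_tendsto_of_monotone (fun n => ?_) (ae_of_all _ fun x n k h => ?_)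
      (ae_of_all _ fun x => ?_)
    · exact ((measurable_expENN.comp (hmeas n)).mul (by fun_prop)).aemeasurable
    · exact mul_le_mul_left (expENN_mono (hsm h x)) _
    · exact ENNReal.Tendsto.mul_const ((continuous_expENN.tendsto _).comp (hst x))
        (Or.inl (expENN_ne_zero _))
  have hB : Tendsto (fun n => ∫⁻ x : PathSpace d, expENN (gaussLEnergy (r₁ n) x) ∂W) atTop
      (𝓝 (∫⁻ x, expENN (gaussLEnergy m₁ x) ∂W)) := by
    refine lintegral_tendsto_of_tendsto_of_monotone (fun n => ?_) (ae_of_all _ fun x n k h => ?_)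
      (ae_of_all _ fun x => ?_)
    · exact (measurable_expENN.comp (measurable_gaussLEnergy _)).aemeasurable
    · exact expENN_mono (hm₁ x h)
    · exact (continuous_expENN.tendsto _).comp (ht₁ x)
  -- Multiplication on `[0, ∞]` is discontinuous at `0 · ∞`, so a vanishing left factor is treated
  -- apart. The right side needs no limit: it is bounded monotonically for each `n`.
  rcases eq_or_ne (∫⁻ x, expENN (gaussLEnergy m₁ x + gaussLEnergy m₂ x)
    * ‖incr x 0 T‖ₑ ^ 2 ∂W) 0 with hA0 | hA0
  · rw [hA0, zero_mul]; exact zero_le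
  have hB0 : ∫⁻ x, expENN (gaussLEnergy m₁ x) ∂W ≠ 0 := by
    refine (one_pos.trans_le ?_).ne'
    calc (1 : ℝ≥0∞) = ∫⁻ _ : PathSpace d, 1 ∂W := by simp
      _ ≤ _ := lintegral_mono fun x => one_le_expENN _
  refine le_of_tendsto' (ENNReal.Tendsto.mul hA (Or.inl hA0) hB (Or.inl hB0)) fun n => ?_
  refine (hW.ginibre_lintegral_aux (r₁ n) (r₂ n) T).trans ?_
  refine mul_le_mul' (lintegral_mono fun x => mul_le_mul_left (expENN_mono ?_) _)
    (lintegral_mono fun x => expENN_mono (add_le_add ?_ ?_))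
  · exact lintegral_mono' (hle₁ n) le_rfl
  · exact lintegral_mono' (hle₁ n) le_rfl
  · exact lintegral_mono' (hle₂ n) le_rfl

/-! ### Interaction energy and its splitting in time -/

variable {d : ℕ} {W : Measure (PathSpace d)}

/-- The interaction energy `∫ v(x_{s,t}) μ(ds dt)`. -/
def energy (γ : ℝ) (μ : Measure (ℝ × ℝ)) (x : PathSpace d) : ℝ≥0∞ :=
  ∫⁻ p, potential γ 0 (incr x p.1 p.2) ∂μ

@[fun_prop]
lemma measurable_potential (γ ε : ℝ) : Measurable (potential (d := d) γ ε) := by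
  unfold potential
  fun_prop

lemma measurable_energy (γ : ℝ) (μ : Measure (ℝ × ℝ)) [SFinite μ] :
    Measurable (energy (d := d) γ μ) := by
  have : Measurable fun z : PathSpace d × (ℝ × ℝ) => potential γ 0 (incr z.1 z.2.1 z.2.2) := by
    fun_prop
  exact this.lintegral_prod_right'

lemma incr_neg (x : PathSpace d) (s t : ℝ) : incr (-x) s t = -incr x s t := by
  simp only [incr, ContinuousMap.neg_apply]; abel

lemma incr_swap (x : PathSpace d) (s t : ℝ) : incr x t s = -incr x s t := by
  simp [incr]

lemma potential_neg (γ ε : ℝ) (y : EuclideanSpace ℝ (Fin d)) :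
    potential γ ε (-y) = potential γ ε y := by
  simp [potential]

lemma energy_neg (γ : ℝ) (μ : Measure (ℝ × ℝ)) (x : PathSpace d) :
    energy γ μ (-x) = energy γ μ x := by
  simp_rw [energy, incr_neg, potential_neg]

/-- The simplex `0 ≤ s < t ≤ T`. -/
def simplex (T : ℝ) : Set (ℝ × ℝ) := {p | 0 ≤ p.1 ∧ p.1 < p.2 ∧ p.2 ≤ T}

lemma measurableSet_simplex (T : ℝ) : MeasurableSet (simplex T) :=
  (measurableSet_le measurable_const measurable_fst).inter
    ((measurableSet_lt measurable_fst measurable_snd).inter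
      (measurableSet_le measurable_snd measurable_const))

lemma intensity_eq (g : ℝ → ℝ) (α T : ℝ) : intensity g α T =
    (volume.restrict (simplex T)).withDensity fun p => ENNReal.ofReal (α * g (p.2 - p.1)) := rfl

instance (g : ℝ → ℝ) (α T : ℝ) : SigmaFinite (intensity g α T) := by
  rw [intensity_eq]; infer_instance

section intensity
variable {g : ℝ → ℝ}

lemma lintegral_intensity (hg : Measurable g) (α T : ℝ) {f : ℝ × ℝ → ℝ≥0∞}
    (hf : Measurable f) :
    ∫⁻ p, f p ∂(intensity g α T)
      = ∫⁻ p in simplex T, ENNReal.ofReal (α * g (p.2 - p.1)) * f p := by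
  rw [intensity_eq, lintegral_withDensity_eq_lintegral_mul _ (by fun_prop) hf]
  rfl

/-- The integrand is symmetric in `(s, t)` and the diagonal is null, so half the integral over the
square is the integral over the simplex. -/
lemma gibbsWeight_eq (hg : Measurable g) (α : ℝ) (hα : 0 ≤ α) (γ T : ℝ) (x : PathSpace d) :
    gibbsWeight γ g α T x = expENN (energy γ (intensity g α T) x) := by
  rw [gibbsWeight, energy, lintegral_intensity hg _ _ (by fun_prop)]
  congr 1
  set Φ : ℝ × ℝ → ℝ≥0∞ := fun p =>
    ENNReal.ofReal (g |p.2 - p.1|) * potential γ 0 (incr x p.1 p.2) with hΦ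
  have hΦm : Measurable Φ := by
    have h1 : Measurable fun p : ℝ × ℝ => g |p.2 - p.1| :=
      hg.comp (by simp_rw [← Real.norm_eq_abs]; fun_prop)
    exact h1.ennreal_ofReal.mul (by fun_prop)
  have hsym : ∀ p, Φ p.swap = Φ p := fun p => by
    simp only [hΦ, Prod.fst_swap, Prod.snd_swap]
    rw [abs_sub_comm, incr_swap, potential_neg]
  have h1 : ∫⁻ s in Icc 0 T, ∫⁻ t in Icc 0 T,
      ENNReal.ofReal (g |t - s|) * potential γ 0 (incr x s t)
      = ∫⁻ p in Icc 0 T ×ˢ Icc 0 T, Φ p := by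
    rw [Measure.volume_eq_prod, ← Measure.prod_restrict, lintegral_prod _ hΦm.aemeasurable]
  have hset : (Icc 0 T ×ˢ Icc 0 T : Set (ℝ × ℝ)) =ᵐ[volume]
      (simplex T ∪ Prod.swap ⁻¹' simplex T : Set (ℝ × ℝ)) := by
    have hdiag : ∀ᵐ p : ℝ × ℝ, p.1 ≠ p.2 := by
      rw [Measure.volume_eq_prod]
      refine (Measure.ae_prod_iff_ae_ae ?_).2 (ae_of_all _ fun s => ?_)
      · exact (measurableSet_eq_fun measurable_fst measurable_snd).compl
      · have := Measure.ae_ne (volume : Measure ℝ) s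
        filter_upwards [this] with t ht using ht.symm
    filter_upwards [hdiag] with p hp
    refine propext ?_
    change (p ∈ Icc 0 T ×ˢ Icc 0 T) ↔ p ∈ simplex T ∪ Prod.swap ⁻¹' simplex T
    simp only [simplex, mem_prod, mem_Icc, mem_union, mem_ofPred_eq, mem_preimage, Prod.fst_swap,
      Prod.snd_swap]
    constructor
    · rintro ⟨⟨h1, h2⟩, h3, h4⟩
      rcases lt_or_gt_of_ne hp with h | h
      · exact Or.inl ⟨h1, h, h4⟩
      · exact Or.inr ⟨h3, h, h2⟩
    · rintro (⟨h1, h2, h3⟩ | ⟨h1, h2, h3⟩)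
      · exact ⟨⟨h1, by linarith⟩, by linarith, h3⟩
      · exact ⟨⟨by linarith, h3⟩, h1, by linarith⟩
  have hdisj : Disjoint (simplex T) (Prod.swap ⁻¹' simplex T) := by
    rw [Set.disjoint_left]
    rintro p ⟨_, h1, _⟩ ⟨_, h2, _⟩
    exact lt_asymm h1 h2
  have hswap : ∫⁻ p in Prod.swap ⁻¹' simplex T, Φ p = ∫⁻ p in simplex T, Φ p := by
    have hmp : MeasurePreserving (Prod.swap : ℝ × ℝ → ℝ × ℝ) volume volume := by
      rw [Measure.volume_eq_prod]; exact Measure.measurePreserving_swap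
    rw [← hmp.setLIntegral_comp_preimage (measurableSet_simplex T) hΦm]
    simp_rw [hsym]
  rw [h1, setLIntegral_congr hset,
    lintegral_union (measurable_swap (measurableSet_simplex T)) hdisj,
    hswap, ← two_mul, ← mul_assoc]
  rw [show ENNReal.ofReal (α / 2) * 2 = ENNReal.ofReal α by
    rw [← ENNReal.ofReal_ofNat 2, ← ENNReal.ofReal_mul (by positivity)]; congr 1; ring]
  rw [← lintegral_const_mul _ hΦm]
  refine setLIntegral_congr_fun (measurableSet_simplex T) fun p hp => ?_
  simp only [hΦ]
  rw [abs_of_pos (by linarith [hp.2.1] : 0 < p.2 - p.1), ← mul_assoc, ENNReal.ofReal_mul hα]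

/-- The restriction keeps the pairs that do not straddle `T`. They form two simplices, and the later
one is a translate of the simplex of side `S`, since the density depends on `t - s` only. -/
lemma lintegral_intensity_restrict (hg : Measurable g) (α : ℝ) (T S : ℝ≥0)
    {f : ℝ × ℝ → ℝ≥0∞} (hf : Measurable f) :
    ∫⁻ p in {p : ℝ × ℝ | p.2 ≤ T ∨ T ≤ p.1}, f p ∂(intensity g α (T + S : ℝ≥0))
      = ∫⁻ p, f p ∂(intensity g α T) + ∫⁻ p, f (p.1 + T, p.2 + T) ∂(intensity g α S) := by
  have hD : MeasurableSet {p : ℝ × ℝ | p.2 ≤ T ∨ T ≤ p.1} :=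
    (measurableSet_le measurable_snd measurable_const).union
      (measurableSet_le measurable_const measurable_fst)
  set B : Set (ℝ × ℝ) := {p | (T : ℝ) ≤ p.1 ∧ p.1 < p.2 ∧ p.2 ≤ T + S} with hB
  have hBm : MeasurableSet B :=
    (measurableSet_le measurable_const measurable_fst).inter
    ((measurableSet_lt measurable_fst measurable_snd).inter
      (measurableSet_le measurable_snd measurable_const))
  have hset : {p : ℝ × ℝ | p.2 ≤ T ∨ T ≤ p.1} ∩ simplex (T + S : ℝ≥0) = simplex T ∪ B := by
    ext p
    have hT := T.coe_nonneg
    have hS := S.coe_nonneg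
    simp only [simplex, hB, mem_inter_iff, mem_ofPred_eq, mem_union, NNReal.coe_add]
    constructor
    · rintro ⟨h | h, h1, h2, h3⟩
      · exact Or.inl ⟨h1, h2, h⟩
      · exact Or.inr ⟨h, h2, h3⟩
    · rintro (⟨h1, h2, h3⟩ | ⟨h1, h2, h3⟩)
      · exact ⟨Or.inl h3, h1, h2, by linarith⟩
      · exact ⟨Or.inr h1, by linarith, h2, h3⟩
  have hdisj : Disjoint (simplex T) B := by
    rw [Set.disjoint_left]
    rintro p ⟨_, h1, h2⟩ ⟨h3, _, _⟩
    linarith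
  rw [lintegral_intensity hg α T hf, lintegral_intensity hg α S (by fun_prop), intensity_eq,
    restrict_withDensity hD, Measure.restrict_restrict hD, hset,
    lintegral_withDensity_eq_lintegral_mul _ (by fun_prop) hf]
  rw [lintegral_union hBm hdisj]
  congr 1
  rw [← lintegral_indicator hBm, ← lintegral_indicator (measurableSet_simplex S),
    ← lintegral_add_right_eq_self _ ((T : ℝ), (T : ℝ))]
  refine lintegral_congr fun p => ?_
  have hiff : p + ((T : ℝ), (T : ℝ)) ∈ B ↔ p ∈ simplex S := by
    simp only [hB, simplex, mem_ofPred_eq, Prod.fst_add, Prod.snd_add]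
    constructor
    · rintro ⟨h1, h2, h3⟩; exact ⟨by linarith, by linarith, by linarith⟩
    · rintro ⟨h1, h2, h3⟩; exact ⟨by linarith, by linarith, by linarith⟩
  by_cases hp : p ∈ simplex S
  · rw [indicator_of_mem hp, indicator_of_mem (hiff.2 hp)]
    simp only [Pi.mul_apply, Prod.fst_add, Prod.snd_add, add_sub_add_right_eq_sub]
    rfl
  · rw [indicator_of_notMem hp, indicator_of_notMem fun h => hp (hiff.1 h)]

end intensity

lemma incr_concat_of_le (T : ℝ≥0) (z : PathSpace d × PathSpace d) {s t : ℝ} (hs : s ≤ T)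
    (ht : t ≤ T) : incr (concat T z) s t = incr z.1 s t := by
  have hs' : s.toNNReal ≤ T := Real.toNNReal_le_iff_le_coe.2 hs
  have ht' : t.toNNReal ≤ T := Real.toNNReal_le_iff_le_coe.2 ht
  simp [incr, concat, hs', ht', tsub_eq_zero_of_le]

lemma incr_concat_add (T : ℝ≥0) (z : PathSpace d × PathSpace d) {s t : ℝ} (hs : 0 ≤ s)
    (ht : 0 ≤ t) : incr (concat T z) (s + T) (t + T) = incr z.2 s t := by
  simp [incr, concat, Real.toNNReal_add, hs, ht]

lemma incr_zero_concat (T S : ℝ≥0) (z : PathSpace d × PathSpace d) :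
    incr (concat T z) 0 (T + S : ℝ≥0) = incr z.1 0 T + incr z.2 0 S := by
  have h : incr (concat T z) 0 (T + S : ℝ≥0)
      = incr (concat T z) 0 T + incr (concat T z) (0 + T) (S + T) := by
    simp [incr, add_comm]
  rw [h, incr_concat_of_le T z T.coe_nonneg le_rfl, incr_concat_add T z le_rfl S.coe_nonneg]

/-! ### Subadditivity of the mean square displacement -/

/-- The partition function `E[exp (∬ v dμ_{α,T})]`. -/
def partitionZ (W : Measure (PathSpace d)) (γ : ℝ) (g : ℝ → ℝ) (α T : ℝ) : ℝ≥0∞ :=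
  ∫⁻ x, expENN (energy γ (intensity g α T) x) ∂W

/-- The unnormalized mean square displacement. -/
def displacementN (W : Measure (PathSpace d)) (γ : ℝ) (g : ℝ → ℝ) (α T : ℝ) : ℝ≥0∞ :=
  ∫⁻ x, expENN (energy γ (intensity g α T) x) * ‖incr x 0 T‖ₑ ^ 2 ∂W

lemma IsWienerMeasure.partitionZ_ne_zero (hW : IsWienerMeasure W) (γ : ℝ) (g : ℝ → ℝ)
    (α T : ℝ) : partitionZ W γ g α T ≠ 0 := by
  have := hW.isProbabilityMeasure
  refine (one_pos.trans_le ?_).ne'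
  calc (1 : ℝ≥0∞) = ∫⁻ _ : PathSpace d, 1 ∂W := by simp
    _ ≤ _ := lintegral_mono fun x => one_le_expENN _

lemma enorm_add_sq_add_enorm_sub_sq (a b : EuclideanSpace ℝ (Fin d)) :
    ‖a + b‖ₑ ^ 2 + ‖a - b‖ₑ ^ 2 = 2 * (‖a‖ₑ ^ 2 + ‖b‖ₑ ^ 2) := by
  simp only [← ofReal_norm]
  rw [← ENNReal.ofReal_pow (norm_nonneg _), ← ENNReal.ofReal_pow (norm_nonneg _),
    ← ENNReal.ofReal_pow (norm_nonneg _), ← ENNReal.ofReal_pow (norm_nonneg _),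
    ← ENNReal.ofReal_add (by positivity) (by positivity),
    ← ENNReal.ofReal_add (by positivity) (by positivity)]
  have h2 : ∀ r : ℝ, 2 * ENNReal.ofReal r = ENNReal.ofReal (2 * r) := fun r => by
    rw [ENNReal.ofReal_mul two_pos.le, ENNReal.ofReal_ofNat]
  rw [h2]
  congr 1
  have := parallelogram_law_with_norm ℝ a b
  nlinarith

section subadditive
variable {g : ℝ → ℝ} {γ : ℝ}

/-- Displacements of independent symmetric pieces of the path add up in mean square. -/
lemma IsWienerMeasure.lintegral_displacement_prod (α : ℝ) (hW : IsWienerMeasure W) (T S : ℝ) :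
    ∫⁻ z, expENN (energy γ (intensity g α T) z.1 + energy γ (intensity g α S) z.2)
        * ‖incr z.1 0 T + incr z.2 0 S‖ₑ ^ 2 ∂(W.prod W)
      = displacementN W γ g α T * partitionZ W γ g α S
        + partitionZ W γ g α T * displacementN W γ g α S := by
  have := hW.isProbabilityMeasure
  set w₁ : PathSpace d → ℝ≥0∞ := fun x => expENN (energy γ (intensity g α T) x) with hw₁
  set w₂ : PathSpace d → ℝ≥0∞ := fun x => expENN (energy γ (intensity g α S) x) with hw₂
  have hm₁ : Measurable w₁ := measurable_expENN.comp (measurable_energy γ _)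
  have hm₂ : Measurable w₂ := measurable_expENN.comp (measurable_energy γ _)
  set J := ∫⁻ z, expENN (energy γ (intensity g α T) z.1 + energy γ (intensity g α S) z.2)
        * ‖incr z.1 0 T + incr z.2 0 S‖ₑ ^ 2 ∂(W.prod W) with hJ
  have hJ1 : J = ∫⁻ z, w₁ z.1 * w₂ z.2 * ‖incr z.1 0 T + incr z.2 0 S‖ₑ ^ 2 ∂(W.prod W) := by
    simp_rw [hJ, expENN_add, hw₁, hw₂]
  -- Reflecting the second path leaves its law and energy unchanged. Adding the two expressions for
  -- `J` and applying the parallelogram law removes the cross term without leaving `[0, ∞]`.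
  have hJ2 : J = ∫⁻ z, w₁ z.1 * w₂ z.2 * ‖incr z.1 0 T - incr z.2 0 S‖ₑ ^ 2 ∂(W.prod W) := by
    rw [hJ1]
    have hmap : (W.prod W).map (Prod.map id fun x => -x) = W.prod W := by
      rw [← Measure.map_prod_map _ _ measurable_id measurable_neg_path, hW.map_neg, Measure.map_id]
    conv_lhs => rw [← hmap]
    rw [lintegral_map (by fun_prop) (measurable_id.prodMap measurable_neg_path)]
    refine lintegral_congr fun z => ?_
    simp only [Prod.map_fst, Prod.map_snd, id, incr_neg, hw₂, energy_neg, sub_eq_add_neg]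
  have h2 : 2 * J = 2 * (displacementN W γ g α T * partitionZ W γ g α S
        + partitionZ W γ g α T * displacementN W γ g α S) := by
    calc 2 * J = J + J := two_mul J
      _ = ∫⁻ z, w₁ z.1 * w₂ z.2 * ‖incr z.1 0 T + incr z.2 0 S‖ₑ ^ 2
          + w₁ z.1 * w₂ z.2 * ‖incr z.1 0 T - incr z.2 0 S‖ₑ ^ 2 ∂(W.prod W) := by
        rw [lintegral_add_left (by fun_prop), ← hJ1, ← hJ2]
      _ = ∫⁻ z, 2 * ((w₁ z.1 * ‖incr z.1 0 T‖ₑ ^ 2) * w₂ z.2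
          + w₁ z.1 * (w₂ z.2 * ‖incr z.2 0 S‖ₑ ^ 2)) ∂(W.prod W) := by
        refine lintegral_congr fun z => ?_
        rw [← mul_add, enorm_add_sq_add_enorm_sub_sq]
        ring
      _ = _ := by
        rw [lintegral_const_mul _ (by fun_prop), lintegral_add_left (by fun_prop),
          lintegral_prod_mul (f := fun x => w₁ x * ‖incr x 0 T‖ₑ ^ 2) (by fun_prop) (by fun_prop),
          lintegral_prod_mul (g := fun x => w₂ x * ‖incr x 0 S‖ₑ ^ 2) (by fun_prop) (by fun_prop)]
        rfl
  exact (ENNReal.mul_right_inj two_ne_zero ENNReal.ofNat_ne_top).1 h2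

/-- Ginibre's inequality with the straddling pairs as the added interaction. Without them the
concatenated path splits into two independent weighted pieces. The partition functions stay
multiplied out, so no finiteness is needed yet. -/
lemma IsWienerMeasure.displacementN_add_le (hg : Measurable g) (α : ℝ)
    (hW : IsWienerMeasure W) (hγ : 0 < γ) (T S : ℝ≥0) :
    displacementN W γ g α (T + S : ℝ≥0) * (partitionZ W γ g α T * partitionZ W γ g α S)
      ≤ (displacementN W γ g α T * partitionZ W γ g α S
        + partitionZ W γ g α T * displacementN W γ g α S) * partitionZ W γ g α (T + S : ℝ≥0) := by
  have := hW.isProbabilityMeasure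
  set D : Set (ℝ × ℝ) := {p : ℝ × ℝ | p.2 ≤ T ∨ T ≤ p.1}
  have hD : MeasurableSet D :=
    (measurableSet_le measurable_snd measurable_const).union
      (measurableSet_le measurable_const measurable_fst)
  set I := intensity g α (T + S : ℝ≥0)
  have h := hW.ginibre_lintegral ((I.restrict D).prod (markMeasure γ 0))
    ((I.restrict Dᶜ).prod (markMeasure γ 0)) (T + S : ℝ≥0)
  simp_rw [gaussLEnergy_prod_markMeasure hγ] at h
  have hsum : ∀ x : PathSpace d, ∫⁻ p in D, potential γ 0 (incr x p.1 p.2) ∂I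
      + ∫⁻ p in Dᶜ, potential γ 0 (incr x p.1 p.2) ∂I = energy γ I x := fun x =>
    lintegral_add_compl _ hD
  simp_rw [hsum] at h
  have hpart : ∀ z : PathSpace d × PathSpace d,
      ∫⁻ p in D, potential γ 0 (incr (concat T z) p.1 p.2) ∂I
        = energy γ (intensity g α T) z.1 + energy γ (intensity g α S) z.2 := by
    intro z
    rw [lintegral_intensity_restrict hg α T S (f := fun p =>
      potential γ 0 (incr (concat T z) p.1 p.2)) (by fun_prop), energy, energy]
    rw [lintegral_intensity hg _ _ (by fun_prop), lintegral_intensity hg _ _ (by fun_prop),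
      lintegral_intensity hg _ _ (by fun_prop), lintegral_intensity hg _ _ (by fun_prop)]
    congr 1
    · refine setLIntegral_congr_fun (measurableSet_simplex _) fun p hp => ?_
      rw [incr_concat_of_le T z (by linarith [hp.2.1, hp.2.2]) hp.2.2]
    · refine setLIntegral_congr_fun (measurableSet_simplex _) fun p hp => ?_
      rw [incr_concat_add T z hp.1 (by linarith [hp.1, hp.2.1])]
  have hmD : Measurable fun x : PathSpace d => ∫⁻ p in D, potential γ 0 (incr x p.1 p.2) ∂I :=
    measurable_energy γ (I.restrict D)
  have hwD : Measurable fun x : PathSpace d =>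
      expENN (∫⁻ p in D, potential γ 0 (incr x p.1 p.2) ∂I) := measurable_expENN.comp hmD
  have e1 : ∫⁻ x, expENN (∫⁻ p in D, potential γ 0 (incr x p.1 p.2) ∂I) ∂W
      = partitionZ W γ g α T * partitionZ W γ g α S := by
    conv_lhs => rw [← hW.map_concat T]
    rw [lintegral_map hwD (measurable_concat T)]
    simp_rw [hpart, expENN_add]
    exact lintegral_prod_mul (measurable_expENN.comp (measurable_energy γ _)).aemeasurable
      (measurable_expENN.comp (measurable_energy γ _)).aemeasurable
  have e2 : ∫⁻ x, expENN (∫⁻ p in D, potential γ 0 (incr x p.1 p.2) ∂I)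
        * ‖incr x 0 (T + S : ℝ≥0)‖ₑ ^ 2 ∂W
      = displacementN W γ g α T * partitionZ W γ g α S
        + partitionZ W γ g α T * displacementN W γ g α S := by
    conv_lhs => rw [← hW.map_concat T]
    rw [lintegral_map (by fun_prop) (measurable_concat T)]
    simp_rw [hpart, incr_zero_concat]
    exact hW.lintegral_displacement_prod α T S
  rw [e1, e2] at h
  exact h

/-- Ginibre's inequality starting from zero interaction: comparison with free Brownian motion. -/
lemma IsWienerMeasure.displacementN_le (α : ℝ) (hW : IsWienerMeasure W) (hγ : 0 < γ) (T : ℝ) :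
    displacementN W γ g α T ≤ (∫⁻ x, ‖incr x 0 T‖ₑ ^ 2 ∂W) * partitionZ W γ g α T := by
  have := hW.isProbabilityMeasure
  have h := hW.ginibre_lintegral 0 ((intensity g α T).prod (markMeasure γ 0)) T
  simp_rw [gaussLEnergy_prod_markMeasure hγ] at h
  simpa [gaussLEnergy, expENN_zero, displacementN, partitionZ, energy] using h

lemma IsWienerMeasure.lintegral_enorm_sq_incr (hW : IsWienerMeasure W) (T : ℝ≥0) :
    ∫⁻ x, ‖incr x 0 T‖ₑ ^ 2 ∂W = d * T := by
  have := hW.isProbabilityMeasure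
  have h1 : ∀ x : PathSpace d, ‖incr x 0 T‖ₑ ^ 2 = ENNReal.ofReal (‖incr x 0 T‖ ^ 2) := fun x => by
    rw [ENNReal.ofReal_pow (norm_nonneg _), ofReal_norm]
  simp_rw [h1]
  rw [← ofReal_integral_eq_lintegral_ofReal (hW.integrable_norm_sq_incr 0 T)
    (ae_of_all _ fun x => by simp only [Pi.zero_apply]; positivity)]
  have h2 : ∀ i : Fin d, Integrable (fun x : PathSpace d => (incr x 0 T i) ^ 2) W ∧
      ∫ x : PathSpace d, (incr x 0 T i) ^ 2 ∂W = T := by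
    intro i
    have hB := (hW.brownian i).toIsPreBrownianReal
    have hl := hB.hasLaw_sub T 0
    have hv := hl.variance_eq
    have hlp : MemLp ((fun x : PathSpace d => x T i) - fun x : PathSpace d => x 0 i) 2 W :=
      hl.hasGaussianLaw.memLp_two
    have hmean : ∫ x, ((fun x : PathSpace d => x T i) - fun x : PathSpace d => x 0 i) x ∂W = 0 := by
      rw [hl.integral_eq, integral_id_gaussianReal]
    rw [variance_of_integral_eq_zero hlp.aemeasurable hmean] at hv
    have e : ∀ x : PathSpace d, (incr x 0 T i) ^ 2
        = ((fun x : PathSpace d => x T i) - fun x : PathSpace d => x 0 i) x ^ 2 := fun x => by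
      simp [incr]
    simp_rw [e]
    refine ⟨hlp.integrable_sq, hv.trans ?_⟩
    rw [variance_id_gaussianReal]
    simp
  simp_rw [EuclideanSpace.norm_sq_eq, Real.norm_eq_abs, sq_abs]
  rw [integral_finsetSum _ fun i _ => (h2 i).1]
  simp_rw [(h2 _).2]
  simp [ENNReal.ofReal_mul]

end subadditive

/-! ### Fekete's lemma and existence of the diffusion constant -/

/-- **Fekete's lemma** for linearly bounded subadditive functions on the half-line. -/
lemma exists_tendsto_div_of_subadditive {f : ℝ → ℝ} {C : ℝ} (h0 : ∀ t, 0 ≤ t → 0 ≤ f t)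
    (hC : ∀ t, 0 ≤ t → f t ≤ C * t)
    (hadd : ∀ s t, 0 ≤ s → 0 ≤ t → f (s + t) ≤ f s + f t) :
    ∃ σ : ℝ, 0 ≤ σ ∧ Tendsto (fun t => f t / t) atTop (𝓝 σ) := by
  have hCnn : 0 ≤ C := by
    have := (h0 1 zero_le_one).trans (hC 1 zero_le_one); linarith
  set σ := sInf ((fun t => f t / t) '' Ioi 0) with hσ
  have hbdd : BddBelow ((fun t => f t / t) '' Ioi (0 : ℝ)) := by
    refine ⟨0, ?_⟩
    rintro _ ⟨t, ht, rfl⟩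
    exact div_nonneg (h0 t (le_of_lt ht)) (le_of_lt ht)
  have hne : ((fun t => f t / t) '' Ioi (0 : ℝ)).Nonempty := ⟨_, 1, mem_Ioi.2 one_pos, rfl⟩
  have hle : ∀ t, 0 < t → σ ≤ f t / t := fun t ht => csInf_le hbdd ⟨t, ht, rfl⟩
  have hmul : ∀ (n : ℕ) (τ r : ℝ), 0 ≤ τ → 0 ≤ r → f (n * τ + r) ≤ n * f τ + f r := by
    intro n τ r hτ hr
    induction n with
    | zero => simp
    | succ n ih =>
      have := hadd τ (n * τ + r) hτ (by positivity)
      have e : ((n + 1 : ℕ) : ℝ) * τ + r = τ + (n * τ + r) := by push_cast; ring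
      rw [e]
      push_cast
      linarith
  refine ⟨σ, le_csInf hne ?_, ?_⟩
  · rintro _ ⟨t, ht, rfl⟩
    exact div_nonneg (h0 t (le_of_lt ht)) (le_of_lt ht)
  refine tendsto_order.2 ⟨fun a ha => ?_, fun a ha => ?_⟩
  · filter_upwards [eventually_gt_atTop 0] with t ht using ha.trans_le (hle t ht)
  -- For `τ` nearly attaining the infimum write `t = nτ + r` with `0 ≤ r ≤ τ`. Then `f t ≤ n f τ + C
  -- τ`, the linear bound controlling the remainder in place of any regularity of `f`.
  · obtain ⟨_, ⟨τ, hτ, rfl⟩, hτa⟩ := exists_lt_of_csInf_lt hne ha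
    have hτ : 0 < τ := hτ
    have hlim : Tendsto (fun t : ℝ => f τ / τ + C * τ / t) atTop (𝓝 (f τ / τ + 0)) :=
      tendsto_const_nhds.add (tendsto_const_nhds.div_atTop tendsto_id)
    rw [add_zero] at hlim
    filter_upwards [hlim.eventually_lt_const hτa, eventually_gt_atTop 0] with t ht ht0
    refine lt_of_le_of_lt ?_ ht
    set n := ⌊t / τ⌋₊
    have hn : n * τ ≤ t := by
      have := Nat.floor_le (div_nonneg ht0.le hτ.le)
      rwa [le_div_iff₀ hτ] at this
    have hn' : t - n * τ ≤ τ := by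
      have := (Nat.lt_floor_add_one (t / τ)).le
      rw [div_le_iff₀ hτ] at this
      linarith
    have h1 := hmul n τ (t - n * τ) hτ.le (by linarith)
    rw [add_sub_cancel] at h1
    have h2 := hC (t - n * τ) (by linarith)
    have h3 : C * (t - n * τ) ≤ C * τ := mul_le_mul_of_nonneg_left hn' hCnn
    have h4 : n * f τ ≤ t * (f τ / τ) := by
      rw [mul_div_assoc', le_div_iff₀ hτ]
      nlinarith [h0 τ hτ.le]
    rw [div_le_iff₀ ht0]
    have : (f τ / τ + C * τ / t) * t = t * (f τ / τ) + C * τ := by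
      field_simp
    linarith

variable {d : ℕ} {W : Measure (PathSpace d)}

lemma lintegral_pathMeasure {g : ℝ → ℝ} (hg : Measurable g) {α : ℝ} (hα : 0 ≤ α) (γ T : ℝ)
    {f : PathSpace d → ℝ≥0∞} (hf : Measurable f) :
    ∫⁻ x, f x ∂(pathMeasure W γ g α T) = (partitionZ W γ g α T)⁻¹
      * ∫⁻ x, expENN (energy γ (intensity g α T) x) * f x ∂W := by
  have e : gibbsWeight (d := d) γ g α T = fun x => expENN (energy γ (intensity g α T) x) :=
    funext fun x => gibbsWeight_eq hg α hα γ T x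
  have hm : Measurable fun x : PathSpace d => expENN (energy γ (intensity g α T) x) :=
    measurable_expENN.comp (measurable_energy γ _)
  rw [pathMeasure, e, lintegral_smul_measure, lintegral_withDensity_eq_lintegral_mul _ hm hf]
  rfl

lemma meanSqDisplacement_pathMeasure {g : ℝ → ℝ} (hg : Measurable g) {α : ℝ} (hα : 0 ≤ α)
    (γ T : ℝ) : meanSqDisplacement (pathMeasure W γ g α T) T = (ENNReal.ofReal (d * T))⁻¹
      * ((partitionZ W γ g α T)⁻¹ * displacementN W γ g α T) := by
  rw [meanSqDisplacement, lintegral_pathMeasure hg hα γ T (by fun_prop)]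
  rfl

/-- The diffusion constant exists and is finite as soon as all partition functions are finite. -/
lemma IsWienerMeasure.exists_isDiffusionConstant (hW : IsWienerMeasure W) (hd : 0 < d) {γ : ℝ}
    (hγ : 0 < γ) {g : ℝ → ℝ} (hg : Measurable g) {α : ℝ} (hα : 0 ≤ α)
    (hZ : ∀ T : ℝ≥0, partitionZ W γ g α T ≠ ∞) :
    ∃ σ2 : ℝ≥0, IsDiffusionConstant W γ g α σ2 := by
  set A : ℝ → ℝ≥0∞ := fun T => (partitionZ W γ g α T)⁻¹ * displacementN W γ g α T with hA
  have hZ0 : ∀ T, partitionZ W γ g α T ≠ 0 := fun T => hW.partitionZ_ne_zero γ g α T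
  have hAle : ∀ T : ℝ≥0, A T ≤ d * T := by
    intro T
    have h := hW.displacementN_le α (g := g) hγ T
    rw [hW.lintegral_enorm_sq_incr] at h
    calc A T ≤ (partitionZ W γ g α T)⁻¹ * (d * T * partitionZ W γ g α T) :=
          mul_le_mul_right h _
      _ = d * T * ((partitionZ W γ g α T)⁻¹ * partitionZ W γ g α T) := by ring
      _ = d * T := by rw [ENNReal.inv_mul_cancel (hZ0 T) (hZ T), mul_one]
  have hAtop : ∀ T : ℝ≥0, A T ≠ ∞ := fun T => ne_top_of_le_ne_top (by finiteness) (hAle T)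
  -- Divides the multiplied-out inequality by the three partition functions, which are nonzero and
  -- finite.
  have hAadd : ∀ T S : ℝ≥0, A (T + S : ℝ≥0) ≤ A T + A S := by
    intro T S
    have h := hW.displacementN_add_le hg α hγ T S
    set ZT := partitionZ W γ g α T
    set ZS := partitionZ W γ g α S
    set Z := partitionZ W γ g α (T + S : ℝ≥0)
    have hZT : ZT⁻¹ * ZT = 1 := ENNReal.inv_mul_cancel (hZ0 T) (hZ T)
    have hZS : ZS⁻¹ * ZS = 1 := ENNReal.inv_mul_cancel (hZ0 S) (hZ S)
    have hZZ : Z⁻¹ * Z = 1 := ENNReal.inv_mul_cancel (hZ0 _) (hZ (T + S))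
    calc A (T + S : ℝ≥0) = Z⁻¹ * displacementN W γ g α (T + S : ℝ≥0)
          * ((ZT⁻¹ * ZT) * (ZS⁻¹ * ZS)) := by
          rw [hZT, hZS, mul_one, mul_one]
      _ = Z⁻¹ * ZT⁻¹ * ZS⁻¹ * (displacementN W γ g α (T + S : ℝ≥0) * (ZT * ZS)) := by ring
      _ ≤ Z⁻¹ * ZT⁻¹ * ZS⁻¹
          * ((displacementN W γ g α T * ZS + ZT * displacementN W γ g α S) * Z) := by
          gcongr
      _ = (Z⁻¹ * Z) * ((ZS⁻¹ * ZS) * (ZT⁻¹ * displacementN W γ g α T)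
          + (ZT⁻¹ * ZT) * (ZS⁻¹ * displacementN W γ g α S)) := by ring
      _ = A T + A S := by rw [hZZ, hZT, hZS, one_mul, one_mul, one_mul]
  obtain ⟨σ, hσ, hlim⟩ := exists_tendsto_div_of_subadditive (f := fun t => (A t).toReal) (C := d)
    (fun t _ => ENNReal.toReal_nonneg)
    (fun t ht => by
      lift t to ℝ≥0 using ht
      have := ENNReal.toReal_mono (by finiteness) (hAle t)
      simpa using this)
    (fun s t hs ht => by
      lift s to ℝ≥0 using hs
      lift t to ℝ≥0 using ht
      have := ENNReal.toReal_mono (ENNReal.add_ne_top.2 ⟨hAtop s, hAtop t⟩) (hAadd s t)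
      rwa [ENNReal.toReal_add (hAtop s) (hAtop t)] at this)
  refine ⟨(σ / d).toNNReal, ?_⟩
  have hlim2 := ENNReal.tendsto_ofReal (hlim.div_const (d : ℝ))
  refine hlim2.congr' ?_
  filter_upwards [eventually_gt_atTop 0] with T hT
  rw [meanSqDisplacement_pathMeasure hg hα]
  lift T to ℝ≥0 using hT.le
  change _ = _ * A T
  have hd' : (0 : ℝ) < d := by exact_mod_cast hd
  rw [div_div, ENNReal.ofReal_div_of_pos (mul_pos hT hd'), ENNReal.ofReal_toReal (hAtop T),
    mul_comm (T : ℝ), ENNReal.div_eq_inv_mul]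

/-! ### Poisson expansion and the mixture identity -/

lemma lintegral_fin_prod_eq_prod {E : Type*} [MeasurableSpace E] (μ : Measure E) [SigmaFinite μ]
    {n : ℕ} {f : Fin n → E → ℝ≥0∞} (hf : ∀ i, Measurable (f i)) :
    ∫⁻ x : Fin n → E, ∏ i, f i (x i) ∂(Measure.pi fun _ => μ) = ∏ i, ∫⁻ x, f i x ∂μ := by
  induction n with
  | zero => simp
  | succ n ih =>
    have h := (measurePreserving_piFinSuccAbove (fun _ : Fin (n + 1) => μ) 0).symm
    rw [← h.lintegral_comp_emb (MeasurableEquiv.measurableEmbedding _)]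
    simp_rw [Fin.prod_univ_succ]
    rw [← ih fun i => hf i.succ]
    rw [← lintegral_prod_mul (f := f 0) (g := fun x : Fin n → E => ∏ i, f i.succ (x i))
      (hf 0).aemeasurable (Finset.measurable_prod _ fun i _ =>
        (hf i.succ).comp (measurable_pi_apply i)).aemeasurable]
    refine lintegral_congr fun z => ?_
    simp [MeasurableEquiv.piFinSuccAbove_symm_apply]

lemma measurable_config {β : Type*} [MeasurableSpace β] {f : Config → β}
    (h : ∀ n : ℕ, Measurable fun p : Fin n → ℝ × ℝ => f ⟨n, p⟩) : Measurable f := by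
  intro s hs
  rw [MeasurableSpace.measurableSet_iInf]
  exact fun n => h n hs

lemma measurable_config_mk (n : ℕ) :
    Measurable (fun p : Fin n → ℝ × ℝ => (⟨n, p⟩ : Config)) := by
  intro s hs
  exact (MeasurableSpace.measurableSet_iInf.1 hs) n

variable {d : ℕ} {W : Measure (PathSpace d)}

/-- `E_W[∏_i v_ε(X_{s_i,t_i}) h]`. -/
def weightedF (W : Measure (PathSpace d)) (γ ε : ℝ) (h : PathSpace d → ℝ≥0∞) (ξ : Config) : ℝ≥0∞ :=
  ∫⁻ x, (∏ i, potential γ ε (incr x (ξ.2 i).1 (ξ.2 i).2)) * h x ∂W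

lemma measurable_weightedF [SFinite W] (γ ε : ℝ) {h : PathSpace d → ℝ≥0∞} (hh : Measurable h) :
    Measurable (weightedF W γ ε h) := by
  refine measurable_config fun n => ?_
  have : Measurable fun z : (Fin n → ℝ × ℝ) × PathSpace d =>
      (∏ i, potential γ ε (incr z.2 (z.1 i).1 (z.1 i).2)) * h z.2 :=
    (Finset.measurable_prod _ fun i _ => by fun_prop).mul (hh.comp measurable_snd)
  exact this.lintegral_prod_right'

/-- Expansion of the interaction over the Poisson point process. -/
lemma lintegral_poissonLaw_weightedF [SFinite W] (μ : Measure (ℝ × ℝ)) [IsFiniteMeasure μ] (γ ε : ℝ)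
    {h : PathSpace d → ℝ≥0∞} (hh : Measurable h) :
    ∫⁻ ξ, weightedF W γ ε h ξ ∂(poissonLaw μ) = ENNReal.ofReal (Real.exp (-(μ univ).toReal))
      * ∫⁻ x, expENN (∫⁻ p, potential γ ε (incr x p.1 p.2) ∂μ) * h x ∂W := by
  have hE : Measurable fun x : PathSpace d => ∫⁻ p, potential γ ε (incr x p.1 p.2) ∂μ := by
    have : Measurable fun z : PathSpace d × (ℝ × ℝ) => potential γ ε (incr z.1 z.2.1 z.2.2) := by
      fun_prop
    exact this.lintegral_prod_right'
  -- For a fixed path the points enter independently, so the `n`-point term is the `n`-th power of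
  -- the energy; the factors `1/n!` of the Poisson law then assemble the exponential series.
  have hn : ∀ n : ℕ, ∫⁻ p : Fin n → ℝ × ℝ, weightedF W γ ε h ⟨n, p⟩ ∂(Measure.pi fun _ => μ)
      = ∫⁻ x, (∫⁻ p, potential γ ε (incr x p.1 p.2) ∂μ) ^ n * h x ∂W := by
    intro n
    have hm : Measurable fun z : (Fin n → ℝ × ℝ) × PathSpace d =>
        (∏ i, potential γ ε (incr z.2 (z.1 i).1 (z.1 i).2)) * h z.2 :=
      (Finset.measurable_prod _ fun i _ => by fun_prop).mul (hh.comp measurable_snd)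
    simp only [weightedF]
    rw [lintegral_lintegral_swap hm.aemeasurable]
    refine lintegral_congr fun x => ?_
    have hmx : Measurable fun p : Fin n → ℝ × ℝ =>
        ∏ i, potential γ ε (incr x (p i).1 (p i).2) :=
      Finset.measurable_prod _ fun i _ => by fun_prop
    rw [lintegral_mul_const _ hmx,
      lintegral_fin_prod_eq_prod μ (f := fun _ p => potential γ ε (incr x p.1 p.2))
        fun i => by fun_prop]
    simp
  rw [poissonLaw, lintegral_sum_measure]
  simp_rw [lintegral_smul_measure]
  have : ∀ n : ℕ, ∫⁻ ξ, weightedF W γ ε h ξ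
      ∂((Measure.pi fun _ : Fin n => μ).map fun p => (⟨n, p⟩ : Config))
      = ∫⁻ x, (∫⁻ p, potential γ ε (incr x p.1 p.2) ∂μ) ^ n * h x ∂W := fun n => by
    rw [lintegral_map (measurable_weightedF γ ε hh) (measurable_config_mk n), hn]
  simp_rw [this, expENN_eq_tsum, ← ENNReal.tsum_mul_right]
  have hmn : ∀ n : ℕ, Measurable fun x : PathSpace d =>
      (∫⁻ p, potential γ ε (incr x p.1 p.2) ∂μ) ^ n * h x := fun n => (hE.pow_const n).mul hh
  have hmn' : ∀ n : ℕ, Measurable fun x : PathSpace d =>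
      (∫⁻ p, potential γ ε (incr x p.1 p.2) ∂μ) ^ n / n.factorial * h x := fun n =>
    ((hE.pow_const n).div_const _).mul hh
  rw [lintegral_tsum fun n => (hmn' n).aemeasurable, ← ENNReal.tsum_mul_left]
  refine tsum_congr fun n => ?_
  simp_rw [div_eq_mul_inv, smul_eq_mul]
  rw [mul_assoc, ← lintegral_const_mul _ (hmn n)]
  congr 1
  refine lintegral_congr fun x => ?_
  ring

lemma gaussWeight_eq_prod (ξ : Config) (u : Fin ξ.1 → ℝ) (x : PathSpace d) :
    gaussWeight ξ u x
      = ∏ i, ENNReal.ofReal (Real.exp (-(u i ^ 2 * ‖incr x (ξ.2 i).1 (ξ.2 i).2‖ ^ 2 / 2))) := by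
  rw [gaussWeight, ← ENNReal.ofReal_prod_of_nonneg fun i _ => (Real.exp_pos _).le, ← Real.exp_sum,
    Finset.sum_neg_distrib]

lemma measurable_gaussWeight_uncurry (ξ : Config) :
    Measurable fun z : (Fin ξ.1 → ℝ) × PathSpace d => gaussWeight ξ z.1 z.2 := by
  simp_rw [gaussWeight_eq_prod]
  exact Finset.measurable_prod _ fun i _ => by fun_prop

lemma measurable_gaussWeight (ξ : Config) (u : Fin ξ.1 → ℝ) :
    Measurable fun x : PathSpace d => gaussWeight ξ u x := by
  simp_rw [gaussWeight_eq_prod]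
  exact Finset.measurable_prod _ fun i _ => by fun_prop

lemma phi_le_one [IsProbabilityMeasure W] (ξ : Config) (u : Fin ξ.1 → ℝ) : phi W ξ u ≤ 1 := by
  calc phi W ξ u ≤ ∫⁻ _, 1 ∂W := by
        refine lintegral_mono fun x => ?_
        rw [gaussWeight, ENNReal.ofReal_le_one, Real.exp_le_one_iff, neg_nonpos]
        positivity
    _ = 1 := by simp

lemma phi_ne_zero [IsProbabilityMeasure W] (ξ : Config) (u : Fin ξ.1 → ℝ) : phi W ξ u ≠ 0 := by
  rw [phi, Ne, lintegral_eq_zero_iff (measurable_gaussWeight ξ u)]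
  intro h
  obtain ⟨x, hx⟩ := h.exists
  exact (ENNReal.ofReal_pos.2 (Real.exp_pos _)).ne' hx

lemma potential_ne_zero {γ : ℝ} (hγ : 0 < γ) (ε : ℝ) (y : EuclideanSpace ℝ (Fin d)) :
    potential γ ε y ≠ 0 := by
  have : ‖y‖ₑ ^ (-γ) ≠ 0 := by
    rw [ENNReal.rpow_neg]
    exact ENNReal.inv_ne_zero.2 (ENNReal.rpow_ne_top_of_nonneg hγ.le enorm_ne_top)
  simp [potential, this]

lemma weightF_ne_zero [IsProbabilityMeasure W] {γ : ℝ} (hγ : 0 < γ) (ε : ℝ) (ξ : Config) :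
    weightF W γ ε ξ ≠ 0 := by
  rw [weightF, Ne, lintegral_eq_zero_iff (Finset.measurable_prod _ fun i _ => by fun_prop)]
  intro h
  obtain ⟨x, hx⟩ := h.exists
  exact Finset.prod_ne_zero_iff.2 (fun i _ => potential_ne_zero hγ ε _) hx

/-- Integrating out the marks. -/
lemma lintegral_kappa_sigmaSq [IsProbabilityMeasure W] {γ : ℝ} (hγ : 0 < γ) (ε T : ℝ)
    (ξ : Config) : ∫⁻ u, sigmaSq W T ξ u ∂(kappa W γ ε ξ)
      = (ENNReal.ofReal (d * T))⁻¹ * ((weightF W γ ε ξ)⁻¹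
        * weightedF W γ ε (fun x => ‖incr x 0 T‖ₑ ^ 2) ξ) := by
  have hgw := measurable_gaussWeight_uncurry (d := d) ξ
  have hgL : Measurable fun z : (Fin ξ.1 → ℝ) × PathSpace d =>
      gaussWeight ξ z.1 z.2 * ‖incr z.2 0 T‖ₑ ^ 2 := hgw.mul (by fun_prop)
  have hphi : Measurable fun u => phi W ξ u := hgw.lintegral_prod_right'
  have hN : Measurable fun u => ∫⁻ x, gaussWeight ξ u x * ‖incr x 0 T‖ₑ ^ 2 ∂W :=
    hgL.lintegral_prod_right'
  have hs : ∀ u, sigmaSq W T ξ u = (ENNReal.ofReal (d * T))⁻¹ * ((phi W ξ u)⁻¹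
      * ∫⁻ x, gaussWeight ξ u x * ‖incr x 0 T‖ₑ ^ 2 ∂W) := by
    intro u
    rw [sigmaSq, meanSqDisplacement, gaussMeasure, lintegral_smul_measure,
      lintegral_withDensity_eq_lintegral_mul _ (measurable_gaussWeight ξ u) (by fun_prop)]
    rfl
  have hsm : Measurable fun u => sigmaSq W T ξ u := by
    simp_rw [hs]
    exact (hphi.inv.mul hN).const_mul _
  rw [kappa, lintegral_withDensity_eq_lintegral_mul _ (hphi.div_const _) hsm]
  -- The density `φ` in `κ_ε` cancels the normalization of `P_{ξ,u}`. What remains is linear in the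
  -- Gaussian weight, so Tonelli integrates the marks one at a time.
  have e : ∀ u, ((fun u => phi W ξ u / weightF W γ ε ξ) * fun u => sigmaSq W T ξ u) u
      = (ENNReal.ofReal (d * T))⁻¹ * (weightF W γ ε ξ)⁻¹
        * ∫⁻ x, gaussWeight ξ u x * ‖incr x 0 T‖ₑ ^ 2 ∂W := by
    intro u
    have h1 : phi W ξ u * (phi W ξ u)⁻¹ = 1 := ENNReal.mul_inv_cancel (phi_ne_zero ξ u)
      (ne_top_of_le_ne_top ENNReal.one_ne_top (phi_le_one ξ u))
    simp only [Pi.mul_apply, hs, div_eq_mul_inv]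
    calc _ = (phi W ξ u * (phi W ξ u)⁻¹) * ((ENNReal.ofReal (d * T))⁻¹ * (weightF W γ ε ξ)⁻¹
        * ∫⁻ x, gaussWeight ξ u x * ‖incr x 0 T‖ₑ ^ 2 ∂W) := by ring
      _ = _ := by rw [h1, one_mul]
  simp_rw [e]
  rw [lintegral_const_mul _ hN, mul_assoc]
  congr 2
  rw [lintegral_lintegral_swap hgL.aemeasurable, weightedF]
  refine lintegral_congr fun x => ?_
  have hgx : Measurable fun u => gaussWeight ξ u x := by
    simp_rw [gaussWeight_eq_prod]
    exact Finset.measurable_prod _ fun i _ => by fun_prop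
  rw [lintegral_mul_const _ hgx]
  congr 1
  simp_rw [gaussWeight_eq_prod]
  rw [lintegral_fin_prod_eq_prod (markMeasure γ ε) (f := fun i v =>
    ENNReal.ofReal (Real.exp (-(v ^ 2 * ‖incr x (ξ.2 i).1 (ξ.2 i).2‖ ^ 2 / 2))))
      fun i => by fun_prop]
  simp_rw [lintegral_markMeasure hγ]

/-- After the shear `(s, t) ↦ (s, t - s)` the density is dominated by a product of integrable
functions on `[0, T]` and `[0, ∞)`. -/
lemma isFiniteMeasure_intensity {g : ℝ → ℝ}
    (hgi : IntegrableOn g (Ici 0)) (α T : ℝ) : IsFiniteMeasure (intensity g α T) := by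
  refine ⟨?_⟩
  rw [intensity_eq, withDensity_apply _ MeasurableSet.univ, Measure.restrict_univ]
  have hi : Integrable (fun z : ℝ × ℝ => (Icc 0 T).indicator (fun _ => α) z.1
      * (Ici 0).indicator g z.2) (volume.prod volume) :=
    Integrable.mul_prod (f := (Icc 0 T).indicator fun _ => α)
      ((integrable_indicator_iff measurableSet_Icc).2 (by simp))
      ((integrable_indicator_iff measurableSet_Ici).2 hgi)
  have hmp : MeasurePreserving (fun z : ℝ × ℝ => (z.1, z.2 - z.1))
      (volume.prod volume) (volume.prod volume) := by
    simpa [sub_eq_neg_add] using measurePreserving_prod_neg_add (volume : Measure ℝ) volume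
  have hi2 := (hmp.integrable_comp_of_integrable hi).lintegral_lt_top
  refine lt_of_le_of_lt ?_ hi2
  rw [← lintegral_indicator (measurableSet_simplex T), Measure.volume_eq_prod]
  refine lintegral_mono fun z => ?_
  by_cases hz : z ∈ simplex T
  · rw [indicator_of_mem hz]
    have h1 : z.1 ∈ Icc 0 T := ⟨hz.1, by linarith [hz.2.1, hz.2.2]⟩
    have h2 : z.2 - z.1 ∈ Ici (0 : ℝ) := by simpa using hz.2.1.le
    simp [h1.1, h1.2, h2, indicator_of_mem]
  · rw [indicator_of_notMem hz]; exact zero_le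

/-- The shift by `ε` adds the same amount for every path; this is why the mixture does not depend on
`ε`. -/
lemma lintegral_potential (γ ε : ℝ) (μ : Measure (ℝ × ℝ)) (x : PathSpace d) :
    ∫⁻ p, potential γ ε (incr x p.1 p.2) ∂μ = energy γ μ x + ENNReal.ofReal ε * μ univ := by
  simp only [energy, potential]
  rw [lintegral_add_right _ measurable_const, lintegral_const]
  simp

/-- The mixture representation of the mean square displacement. -/
lemma IsWienerMeasure.lintegral_perturbedLaw (hW : IsWienerMeasure W) {γ : ℝ} (hγ : 0 < γ)
    {g : ℝ → ℝ} (hg : Measurable g) (hgi : IntegrableOn g (Ici 0)) {α : ℝ} (hα : 0 ≤ α)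
    (ε T : ℝ) (hZ : partitionZ W γ g α T ≠ ∞) :
    ∫⁻ ξ, (∫⁻ u, sigmaSq W T ξ u ∂(kappa W γ ε ξ)) ∂(perturbedLaw W γ g ε α T)
      = meanSqDisplacement (pathMeasure W γ g α T) T := by
  have := hW.isProbabilityMeasure
  have hfin := isFiniteMeasure_intensity hgi α T
  set I := intensity g α T with hI
  set c := (I univ).toReal
  set C := expENN (ENNReal.ofReal ε * I univ) with hC
  have hC0 : C ≠ 0 := expENN_ne_zero _
  have hCt : C ≠ ∞ := by
    rw [hC, ← ENNReal.ofReal_toReal (measure_ne_top I univ),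
      ← ENNReal.ofReal_mul' ENNReal.toReal_nonneg]
    rw [← max_eq_left (ENNReal.toReal_nonneg (a := I univ))]
    rcases le_total 0 (ε * max (I univ).toReal 0) with h | h
    · rw [expENN_ofReal h]; exact ENNReal.ofReal_ne_top
    · rw [ENNReal.ofReal_of_nonpos h, expENN_zero]; exact ENNReal.one_ne_top
  have hexp : ∀ x : PathSpace d, expENN (∫⁻ p, potential γ ε (incr x p.1 p.2) ∂I)
      = C * expENN (energy γ I x) := fun x => by
    rw [lintegral_potential, expENN_add, mul_comm]
  have hEm : Measurable fun x : PathSpace d => expENN (energy γ I x) :=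
    measurable_expENN.comp (measurable_energy γ _)
  have hPF : partitionFunction W γ g ε α T = C * partitionZ W γ g α T := by
    rw [partitionFunction, ← hI]
    simp_rw [hexp]
    rw [lintegral_const_mul _ hEm]
    rfl
  have hF1 : ∀ ξ, weightF W γ ε ξ = weightedF W γ ε (fun _ => 1) ξ := fun ξ => by
    simp [weightF, weightedF]
  have hFm : Measurable fun ξ => weightF W γ ε ξ := by
    simp_rw [hF1]
    exact measurable_weightedF γ ε measurable_const
  have hGm : Measurable (weightedF W γ ε fun x => ‖incr x 0 T‖ₑ ^ 2) :=
    measurable_weightedF γ ε (by fun_prop)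
  -- `F_ε` has finite Poisson mean because the partition function is finite. Almost sure finiteness
  -- is what permits cancelling `F_ε` against the denominator in `κ_ε`.
  have hFtop : ∀ᵐ ξ ∂(poissonLaw I), weightF W γ ε ξ < ∞ := by
    refine ae_lt_top hFm ?_
    simp_rw [hF1]
    rw [lintegral_poissonLaw_weightedF I γ ε measurable_const]
    simp_rw [hexp, mul_one]
    rw [lintegral_const_mul _ hEm]
    exact ENNReal.mul_ne_top ENNReal.ofReal_ne_top (ENNReal.mul_ne_top hCt hZ)
  set D := (ENNReal.ofReal (d * T))⁻¹
  set ρ := ENNReal.ofReal (Real.exp c) / partitionFunction W γ g ε α T with hρ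
  rw [perturbedLaw, ← hI]
  have hS : Measurable fun ξ => ∫⁻ u, sigmaSq W T ξ u ∂(kappa W γ ε ξ) := by
    simp_rw [lintegral_kappa_sigmaSq hγ]
    exact (hFm.inv.mul hGm).const_mul _
  rw [lintegral_withDensity_eq_lintegral_mul _ (hFm.const_mul _) hS]
  have e : ∀ᵐ ξ ∂(poissonLaw I), ((fun ξ => ρ * weightF W γ ε ξ)
      * fun ξ => ∫⁻ u, sigmaSq W T ξ u ∂(kappa W γ ε ξ)) ξ
      = ρ * D * weightedF W γ ε (fun x => ‖incr x 0 T‖ₑ ^ 2) ξ := by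
    filter_upwards [hFtop] with ξ hξ
    have h1 : weightF W γ ε ξ * (weightF W γ ε ξ)⁻¹ = 1 :=
      ENNReal.mul_inv_cancel (weightF_ne_zero hγ ε ξ) hξ.ne
    simp only [Pi.mul_apply, lintegral_kappa_sigmaSq hγ]
    calc _ = (weightF W γ ε ξ * (weightF W γ ε ξ)⁻¹)
          * (ρ * D * weightedF W γ ε (fun x => ‖incr x 0 T‖ₑ ^ 2) ξ) := by ring
      _ = _ := by rw [h1, one_mul]
  rw [lintegral_congr_ae e, lintegral_const_mul _ hGm,
    lintegral_poissonLaw_weightedF I γ ε (by fun_prop), meanSqDisplacement_pathMeasure hg hα]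
  simp_rw [hexp, mul_assoc C]
  have hEL : Measurable fun x : PathSpace d => expENN (energy γ I x) * ‖incr x 0 T‖ₑ ^ 2 :=
    hEm.mul (by fun_prop)
  rw [lintegral_const_mul _ hEL]
  change ρ * D * (ENNReal.ofReal (Real.exp (-c)) * (C * displacementN W γ g α T)) = _
  have h1 : ENNReal.ofReal (Real.exp c) * ENNReal.ofReal (Real.exp (-c)) = 1 := by
    rw [← ENNReal.ofReal_mul (Real.exp_pos _).le, ← Real.exp_add]; simp
  have h2 : C⁻¹ * C = 1 := ENNReal.inv_mul_cancel hC0 hCt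
  rw [hρ, hPF, ENNReal.div_eq_inv_mul, ENNReal.mul_inv (Or.inl hC0) (Or.inl hCt)]
  calc _ = (ENNReal.ofReal (Real.exp c) * ENNReal.ofReal (Real.exp (-c))) * (C⁻¹ * C)
        * (D * ((partitionZ W γ g α T)⁻¹ * displacementN W γ g α T)) := by ring
    _ = _ := by rw [h1, h2, one_mul, one_mul]

/-! ### Gaussian regression as conditioning on a noisy observation -/

/-- The density of the standard Gaussian measure on `ℝⁿ`. -/
def stdGaussianDensity {n : ℕ} (z : Fin n → ℝ) : ℝ := ∏ i, gaussianPDFReal 0 1 (z i)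

lemma stdGaussianDensity_eq {n : ℕ} (z : Fin n → ℝ) :
    stdGaussianDensity z = (√(2 * Real.pi))⁻¹ ^ n * Real.exp (-∑ i, z i ^ 2 / 2) := by
  simp only [stdGaussianDensity, gaussianPDFReal, NNReal.coe_one, mul_one, sub_zero]
  rw [Finset.prod_mul_distrib, ← Real.exp_sum, Finset.prod_const, Finset.card_univ,
    Fintype.card_fin, ← Finset.sum_neg_distrib]
  exact congrArg _ (congrArg _ (Finset.sum_congr rfl fun i _ => by ring))

lemma continuous_stdGaussianDensity {n : ℕ} : Continuous (stdGaussianDensity (n := n)) := by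
  rw [funext stdGaussianDensity_eq]
  fun_prop

@[fun_prop]
lemma measurable_stdGaussianDensity {n : ℕ} : Measurable (stdGaussianDensity (n := n)) :=
  continuous_stdGaussianDensity.measurable

lemma stdGaussianDensity_nonneg {n : ℕ} (z : Fin n → ℝ) : 0 ≤ stdGaussianDensity z := by
  rw [stdGaussianDensity_eq]; positivity

lemma stdGaussianDensity_le {n : ℕ} (z : Fin n → ℝ) :
    stdGaussianDensity z ≤ (√(2 * Real.pi))⁻¹ ^ n := by
  rw [stdGaussianDensity_eq]
  refine mul_le_of_le_one_right (by positivity) ?_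
  rw [Real.exp_le_one_iff, neg_nonpos]
  positivity

lemma pi_gaussianReal_eq_withDensity (n : ℕ) :
    (Measure.pi fun _ : Fin n => gaussianReal 0 1)
      = volume.withDensity fun z : Fin n → ℝ => ENNReal.ofReal (stdGaussianDensity z) := by
  refine Measure.pi_eq fun s hs => ?_
  rw [withDensity_apply _ (MeasurableSet.univ_pi hs),
    ← lintegral_indicator (MeasurableSet.univ_pi hs)]
  have h1 : ∀ z : Fin n → ℝ, (univ.pi s).indicator
      (fun z => ENNReal.ofReal (stdGaussianDensity z)) z
      = ∏ i, (s i).indicator (gaussianPDF 0 1) (z i) := by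
    intro z
    by_cases hz : z ∈ univ.pi s
    · rw [indicator_of_mem hz, stdGaussianDensity,
        ENNReal.ofReal_prod_of_nonneg fun i _ => gaussianPDFReal_nonneg _ _ _]
      refine Finset.prod_congr rfl fun i _ => ?_
      rw [indicator_of_mem (hz i (mem_univ i))]
      rfl
    · rw [indicator_of_notMem hz]
      simp only [Set.mem_pi, mem_univ, true_implies, not_forall] at hz
      obtain ⟨i, hi⟩ := hz
      exact (Finset.prod_eq_zero (Finset.mem_univ i) (indicator_of_notMem hi _)).symm
  simp_rw [h1, volume_pi]
  rw [lintegral_fin_prod_eq_prod volume (f := fun i => (s i).indicator (gaussianPDF 0 1))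
    fun i => (measurable_gaussianPDF 0 1).indicator (hs i)]
  refine Finset.prod_congr rfl fun i _ => ?_
  rw [lintegral_indicator (hs i), gaussianReal_apply _ one_ne_zero]

section gaussian
variable {n : ℕ} (ν : Measure (ℝ × (Fin n → ℝ))) [IsProbabilityMeasure ν]

/-- Given `v`, the vector `v.2 + Z` has density `y ↦ stdGaussianDensity (y - v.2)`. So the law of
`v.2 + Z` weighted by `f v` has the inner integral as its density. -/
lemma lintegral_prod_pi_gaussianReal {f : ℝ × (Fin n → ℝ) → ℝ≥0∞} (hf : Measurable f)
    {φ : (Fin n → ℝ) → ℝ≥0∞} (hφ : Measurable φ) :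
    ∫⁻ z, f z.1 * φ (z.1.2 + z.2) ∂(ν.prod (Measure.pi fun _ : Fin n => gaussianReal 0 1))
      = ∫⁻ y, φ y * ∫⁻ v, f v * ENNReal.ofReal (stdGaussianDensity (y - v.2)) ∂ν := by
  have hg : Measurable fun z : Fin n → ℝ => ENNReal.ofReal (stdGaussianDensity z) :=
    continuous_stdGaussianDensity.measurable.ennreal_ofReal
  rw [lintegral_prod _ (by fun_prop)]
  have h1 : ∀ v : ℝ × (Fin n → ℝ),
      ∫⁻ z, f v * φ (v.2 + z) ∂(Measure.pi fun _ : Fin n => gaussianReal 0 1)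
      = ∫⁻ y, f v * (ENNReal.ofReal (stdGaussianDensity (y - v.2)) * φ y) := by
    intro v
    rw [pi_gaussianReal_eq_withDensity, lintegral_const_mul _ (by fun_prop),
      lintegral_const_mul _ (by fun_prop),
      lintegral_withDensity_eq_lintegral_mul _ hg (by fun_prop)]
    congr 1
    refine Eq.trans ?_ (lintegral_add_left_eq_self
      (fun y => ENNReal.ofReal (stdGaussianDensity (y - v.2)) * φ y) v.2)
    simp
  simp_rw [h1]
  rw [lintegral_lintegral_swap (Measurable.aemeasurable (by fun_prop))]
  refine lintegral_congr fun y => ?_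
  rw [← lintegral_const_mul _ (by fun_prop)]
  refine lintegral_congr fun v => ?_
  ring

/-- A Gaussian regression identity: if `a - ∑ cᵢ (bᵢ + Zᵢ)` is independent of `b + Z`, where `Z` is
a standard Gaussian vector independent of `(a, b)`, then the mean of `a²` under the tilted law with
weight `exp (-|b|²/2)` is the residual variance. -/
lemma lintegral_sq_mul_exp_eq (c : Fin n → ℝ) (ha : Integrable (fun v => v.1 ^ 2) ν)
    (hind : IndepFun (fun z : (ℝ × (Fin n → ℝ)) × (Fin n → ℝ) =>
        z.1.1 - ∑ i, c i * (z.1.2 i + z.2 i)) (fun z => z.1.2 + z.2)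
      (ν.prod (Measure.pi fun _ : Fin n => gaussianReal 0 1)))
    (hR : MemLp (fun z : (ℝ × (Fin n → ℝ)) × (Fin n → ℝ) =>
        z.1.1 - ∑ i, c i * (z.1.2 i + z.2 i)) 2
      (ν.prod (Measure.pi fun _ : Fin n => gaussianReal 0 1)))
    (hR0 : ∫ z : (ℝ × (Fin n → ℝ)) × (Fin n → ℝ), (z.1.1 - ∑ i, c i * (z.1.2 i + z.2 i))
      ∂(ν.prod (Measure.pi fun _ : Fin n => gaussianReal 0 1)) = 0) :
    ∫⁻ v, ENNReal.ofReal (v.1 ^ 2) * ENNReal.ofReal (Real.exp (-∑ i, v.2 i ^ 2 / 2)) ∂ν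
      = (∫⁻ z : (ℝ × (Fin n → ℝ)) × (Fin n → ℝ),
          ENNReal.ofReal ((z.1.1 - ∑ i, c i * (z.1.2 i + z.2 i)) ^ 2)
          ∂(ν.prod (Measure.pi fun _ : Fin n => gaussianReal 0 1)))
        * ∫⁻ v, ENNReal.ofReal (Real.exp (-∑ i, v.2 i ^ 2 / 2)) ∂ν := by
  set π := Measure.pi fun _ : Fin n => gaussianReal 0 1
  set R : (ℝ × (Fin n → ℝ)) × (Fin n → ℝ) → ℝ := fun z => z.1.1 - ∑ i, c i * (z.1.2 i + z.2 i)
    with hRdef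
  set Y : (ℝ × (Fin n → ℝ)) × (Fin n → ℝ) → Fin n → ℝ := fun z => z.1.2 + z.2 with hY
  have hRm : Measurable R := by fun_prop
  have hYm : Measurable Y := by fun_prop
  set σ2 := ∫ z, R z ^ 2 ∂(ν.prod π) with hσ
  have hσ0 : 0 ≤ σ2 := integral_nonneg fun z => sq_nonneg _
  have hR1 : Integrable R (ν.prod π) := hR.integrable one_le_two
  have hRsq : Integrable (fun z => R z ^ 2) (ν.prod π) := hR.integrable_sq
  have hshift : ∀ t : ℝ, ∫⁻ z, ENNReal.ofReal ((R z + t) ^ 2) ∂(ν.prod π)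
      = ENNReal.ofReal (σ2 + t ^ 2) := by
    intro t
    have e : ∀ z, (R z + t) ^ 2 = R z ^ 2 + 2 * t * R z + t ^ 2 := fun z => by ring
    simp_rw [e]
    have hi : Integrable (fun z => R z ^ 2 + 2 * t * R z) (ν.prod π) := hRsq.add (hR1.const_mul _)
    have hi2 : Integrable (fun z => R z ^ 2 + 2 * t * R z + t ^ 2) (ν.prod π) :=
      hi.add (integrable_const _)
    rw [← ofReal_integral_eq_lintegral_ofReal hi2
      (ae_of_all _ fun z => (sq_nonneg _).trans_eq (e z)),
      integral_add hi (integrable_const _), integral_add hRsq (hR1.const_mul _),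
      integral_const_mul, hR0]
    simp [hσ]
  -- The conditional second moment of `a` given `b + Z = y`: residual variance plus the squared
  -- regression value.
  set q : (Fin n → ℝ) → ℝ := fun y => σ2 + (∑ i, c i * y i) ^ 2 with hq
  have hqm : Measurable q := by fun_prop
  have hq0 : ∀ y, 0 ≤ q y := fun y => by positivity
  -- the two densities
  set J : (Fin n → ℝ) → ℝ := fun y => ∫ v, v.1 ^ 2 * stdGaussianDensity (y - v.2) ∂ν with hJ
  set K : (Fin n → ℝ) → ℝ := fun y => ∫ v, stdGaussianDensity (y - v.2) ∂ν with hK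
  have hdm : ∀ y : Fin n → ℝ, Measurable fun v : ℝ × (Fin n → ℝ) =>
      stdGaussianDensity (y - v.2) := fun y =>
    continuous_stdGaussianDensity.measurable.comp (by fun_prop)
  have hdb : ∀ (y : Fin n → ℝ) (v : ℝ × (Fin n → ℝ)),
      ‖stdGaussianDensity (y - v.2)‖ ≤ (√(2 * Real.pi))⁻¹ ^ n := fun y v => by
    rw [Real.norm_of_nonneg (stdGaussianDensity_nonneg _)]; exact stdGaussianDensity_le _
  have hJi : ∀ y, Integrable (fun v => v.1 ^ 2 * stdGaussianDensity (y - v.2)) ν := fun y => by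
    simpa [mul_comm] using ha.bdd_mul (hdm y).aestronglyMeasurable (ae_of_all _ (hdb y))
  have hKi : ∀ y, Integrable (fun v => stdGaussianDensity (y - v.2)) ν := fun y =>
    Integrable.of_bound (hdm y).aestronglyMeasurable _ (ae_of_all _ (hdb y))
  -- Continuity upgrades the almost everywhere identity of densities below to one at the single
  -- point `y = 0`.
  have hJc : Continuous J := by
    refine continuous_of_dominated (bound := fun v => v.1 ^ 2 * (√(2 * Real.pi))⁻¹ ^ n)
      (fun y => (hJi y).1) (fun y => ae_of_all _ fun v => ?_) (ha.mul_const _)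
      (ae_of_all _ fun v => ?_)
    · rw [norm_mul, Real.norm_of_nonneg (sq_nonneg v.1)]
      exact mul_le_mul_of_nonneg_left (hdb y v) (sq_nonneg _)
    · exact continuous_const.mul (continuous_stdGaussianDensity.comp (by fun_prop))
  have hKc : Continuous K := by
    refine continuous_of_dominated (bound := fun v => (√(2 * Real.pi))⁻¹ ^ n)
      (fun y => (hKi y).1) (fun y => ae_of_all _ (hdb y)) (integrable_const _)
      (ae_of_all _ fun v => ?_)
    exact continuous_stdGaussianDensity.comp (by fun_prop)
  have hJE : ∀ y, ∫⁻ v, ENNReal.ofReal (v.1 ^ 2) * ENNReal.ofReal (stdGaussianDensity (y - v.2)) ∂ν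
      = ENNReal.ofReal (J y) := fun y => by
    rw [hJ, ofReal_integral_eq_lintegral_ofReal (hJi y) (ae_of_all _ fun v =>
      mul_nonneg (sq_nonneg _) (stdGaussianDensity_nonneg _))]
    simp_rw [ENNReal.ofReal_mul (sq_nonneg _)]
  have hKE : ∀ y, ∫⁻ v, 1 * ENNReal.ofReal (stdGaussianDensity (y - v.2)) ∂ν
      = ENNReal.ofReal (K y) := fun y => by
    rw [hK, ofReal_integral_eq_lintegral_ofReal (hKi y) (ae_of_all _ fun v =>
      stdGaussianDensity_nonneg _)]
    simp
  -- Tested on a set `s`: with `a = R + ∑ cᵢ Yᵢ`, `R` centered and independent of `Y = b + Z`, the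
  -- mean of `a²` on `{Y ∈ s}` equals that of `q(Y)`.
  have hae : (fun y => ENNReal.ofReal (J y)) =ᵐ[volume] fun y => ENNReal.ofReal (q y * K y) := by
    refine ae_eq_of_forall_setLIntegral_eq_of_sigmaFinite hJc.measurable.ennreal_ofReal
      (hqm.mul hKc.measurable).ennreal_ofReal fun s hs _ => ?_
    set φ : (Fin n → ℝ) → ℝ≥0∞ := s.indicator fun _ => 1
    have hφ : Measurable φ := measurable_const.indicator hs
    have hind' : ∀ f : (Fin n → ℝ) → ℝ≥0∞, ∫⁻ y in s, f y = ∫⁻ y, φ y * f y := fun f => by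
      rw [← lintegral_indicator hs]
      refine lintegral_congr fun y => ?_
      by_cases hy : y ∈ s <;> simp [φ, hy]
    rw [hind', hind']
    have e1 := lintegral_prod_pi_gaussianReal ν (f := fun v => ENNReal.ofReal (v.1 ^ 2))
      (by fun_prop) hφ
    simp_rw [hJE] at e1
    have e2 := lintegral_prod_pi_gaussianReal ν (f := fun _ => 1) measurable_const
      (φ := fun y => φ y * ENNReal.ofReal (q y)) (hφ.mul hqm.ennreal_ofReal)
    simp_rw [hKE] at e2
    have e3 : ∫⁻ y, φ y * ENNReal.ofReal (q y * K y)
        = ∫⁻ y, φ y * ENNReal.ofReal (q y) * ENNReal.ofReal (K y) := by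
      refine lintegral_congr fun y => ?_
      rw [ENNReal.ofReal_mul (hq0 y), mul_assoc]
    rw [e3, ← e1, ← e2]
    have hmap := (indepFun_iff_map_prod_eq_prod_map_map hRm.aemeasurable hYm.aemeasurable).1 hind
    have h4 : ∀ z : (ℝ × (Fin n → ℝ)) × (Fin n → ℝ), z.1.1 = R z + ∑ i, c i * Y z i := fun z => by
      simp [hRdef, hY]
    have h5 : ∀ z : (ℝ × (Fin n → ℝ)) × (Fin n → ℝ), ENNReal.ofReal (z.1.1 ^ 2) * φ (z.1.2 + z.2)
        = (fun p : ℝ × (Fin n → ℝ) => ENNReal.ofReal ((p.1 + ∑ i, c i * p.2 i) ^ 2) * φ p.2)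
          (R z, Y z) := fun z => by rw [h4 z]
    simp_rw [h5]
    have hFm : Measurable fun p : ℝ × (Fin n → ℝ) =>
        ENNReal.ofReal ((p.1 + ∑ i, c i * p.2 i) ^ 2) * φ p.2 := by fun_prop
    rw [← lintegral_map hFm (hRm.prodMk hYm), hmap]
    have : IsProbabilityMeasure ((ν.prod π).map R) :=
      Measure.isProbabilityMeasure_map hRm.aemeasurable
    have : IsProbabilityMeasure ((ν.prod π).map Y) :=
      Measure.isProbabilityMeasure_map hYm.aemeasurable
    rw [lintegral_prod_symm _ hFm.aemeasurable, lintegral_map (by fun_prop) hYm]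
    refine lintegral_congr fun z => ?_
    have h6 : Measurable fun r : ℝ => ENNReal.ofReal ((r + ∑ i, c i * Y z i) ^ 2) := by fun_prop
    change ∫⁻ r, ENNReal.ofReal ((r + ∑ i, c i * Y z i) ^ 2) * φ (Y z) ∂((ν.prod π).map R)
      = 1 * (φ (Y z) * ENNReal.ofReal (q (Y z)))
    rw [lintegral_mul_const _ h6, lintegral_map h6 hRm, hshift, one_mul, mul_comm]
  have hae' : J =ᵐ[volume] fun y => q y * K y := by
    filter_upwards [hae] with y hy
    have hJ0 : 0 ≤ J y := integral_nonneg fun v =>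
      mul_nonneg (sq_nonneg _) (stdGaussianDensity_nonneg _)
    have hK0 : 0 ≤ K y := integral_nonneg fun v => stdGaussianDensity_nonneg _
    exact (ENNReal.ofReal_eq_ofReal_iff hJ0 (mul_nonneg (hq0 y) hK0)).1 hy
  have hqc : Continuous q := by fun_prop
  have hfun := (Continuous.ae_eq_iff_eq volume hJc (hqc.mul hKc)).1 hae'
  -- At `y = 0` the Gaussian density is a constant times `exp (-|b|²/2)`, and the regression term in
  -- `q` vanishes.
  have h0 := congrFun hfun 0
  have hq00 : q 0 = σ2 := by simp [hq]
  have h1 := hJE 0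
  have h2 := hKE 0
  rw [h0] at h1
  rw [Pi.mul_apply, hq00, ENNReal.ofReal_mul hσ0, ← h2] at h1
  have hC : ENNReal.ofReal ((√(2 * Real.pi))⁻¹ ^ n) ≠ 0 := by
    have : 0 < (√(2 * Real.pi))⁻¹ ^ n := by positivity
    exact (ENNReal.ofReal_pos.2 this).ne'
  have hs0 : ∀ v : ℝ × (Fin n → ℝ), ENNReal.ofReal (stdGaussianDensity (0 - v.2))
      = ENNReal.ofReal ((√(2 * Real.pi))⁻¹ ^ n)
        * ENNReal.ofReal (Real.exp (-∑ i, v.2 i ^ 2 / 2)) := fun v => by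
    rw [stdGaussianDensity_eq, ENNReal.ofReal_mul (by positivity)]
    simp
  have hem : Measurable fun v : ℝ × (Fin n → ℝ) =>
      ENNReal.ofReal (Real.exp (-∑ i, v.2 i ^ 2 / 2)) := by fun_prop
  simp_rw [hs0, one_mul, mul_left_comm (ENNReal.ofReal (_ ^ 2))] at h1
  rw [lintegral_const_mul _ (by fun_prop), lintegral_const_mul _ hem, mul_left_comm] at h1
  have h3 := (ENNReal.mul_right_inj hC ENNReal.ofReal_ne_top).1 h1
  rw [h3, hσ, ofReal_integral_eq_lintegral_ofReal hRsq (ae_of_all _ fun z => sq_nonneg _)]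

end gaussian

lemma indepFun_map_iff {Ω E F G : Type*} [MeasurableSpace Ω] [MeasurableSpace E]
    [MeasurableSpace F] [MeasurableSpace G] {P : Measure Ω} [IsProbabilityMeasure P] {X : Ω → E}
    (hX : AEMeasurable X P) {f : E → F} {g : E → G} (hf : Measurable f) (hg : Measurable g) :
    IndepFun f g (P.map X) ↔ IndepFun (fun ω => f (X ω)) (fun ω => g (X ω)) P := by
  have := Measure.isProbabilityMeasure_map hX
  rw [indepFun_iff_map_prod_eq_prod_map_map hf.aemeasurable hg.aemeasurable,
    indepFun_iff_map_prod_eq_prod_map_map (f := fun ω => f (X ω)) (g := fun ω => g (X ω))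
      (hf.comp_aemeasurable hX) (hg.comp_aemeasurable hX),
    AEMeasurable.map_map_of_aemeasurable hf.aemeasurable hX,
    AEMeasurable.map_map_of_aemeasurable hg.aemeasurable hX,
    AEMeasurable.map_map_of_aemeasurable (hf.prodMk hg).aemeasurable hX]
  rfl

/-! ### Orthogonal projection and the squared distance -/

section projection
variable {Ω : Type*} [MeasurableSpace Ω] {P : Measure Ω} {n : ℕ} {f : Ω → ℝ} {Y : Fin n → Ω → ℝ}

lemma memLp_sub_sum (hf : MemLp f 2 P) (hY : ∀ i, MemLp (Y i) 2 P) (c : Fin n → ℝ) :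
    MemLp (fun ω => f ω - ∑ j, c j * Y j ω) 2 P :=
  hf.sub (memLp_finsetSum _ fun j _ => (hY j).const_mul (c j))

lemma toLp_sub_sum (hf : MemLp f 2 P) (hY : ∀ i, MemLp (Y i) 2 P) (c : Fin n → ℝ) :
    (memLp_sub_sum hf hY c).toLp = hf.toLp - ∑ j, c j • (hY j).toLp := by
  have hs : ∀ s : Finset (Fin n), ∃ h : MemLp (fun ω => ∑ j ∈ s, c j * Y j ω) 2 P,
      h.toLp = ∑ j ∈ s, c j • (hY j).toLp := by
    intro s
    induction s using Finset.cons_induction with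
    | empty => exact ⟨by simp, by simp only [Finset.sum_empty]; exact MemLp.toLp_zero _⟩
    | cons j s hj ih =>
      obtain ⟨h, e⟩ := ih
      have e2 : (fun ω => ∑ j ∈ Finset.cons j s hj, c j * Y j ω)
          = c j • Y j + fun ω => ∑ j ∈ s, c j * Y j ω := by
        ext ω
        simp only [Finset.sum_cons, Pi.add_apply, Pi.smul_apply, smul_eq_mul]
      refine ⟨e2 ▸ ((hY j).const_smul (c j)).add h, ?_⟩
      rw [Finset.sum_cons, ← e, ← MemLp.toLp_const_smul, ← MemLp.toLp_add]
      exact MemLp.toLp_congr _ _ (ae_of_all _ fun ω => congrFun e2 ω)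
  obtain ⟨h, e⟩ := hs Finset.univ
  rw [← e, ← MemLp.toLp_sub]
  rfl

/-- The distance to the span of finitely many square integrable functions is attained at the
orthogonal projection. -/
lemma exists_l2DistSpan_eq (hf : MemLp f 2 P) (hY : ∀ i, MemLp (Y i) 2 P) :
    ∃ c : Fin n → ℝ, (∀ i, ∫ ω, (f ω - ∑ j, c j * Y j ω) * Y i ω ∂P = 0) ∧
      l2DistSpan P f Y ^ 2 = ∫⁻ ω, ENNReal.ofReal ((f ω - ∑ j, c j * Y j ω) ^ 2) ∂P := by
  -- The span is formed in `Lp`, where a finite-dimensional subspace has an orthogonal projection;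
  -- `c` collects coefficients of the projection of `f`.
  set K : Submodule ℝ (Lp ℝ 2 P) := Submodule.span ℝ (range fun i => (hY i).toLp)
  have : FiniteDimensional ℝ K := FiniteDimensional.span_of_finite ℝ (finite_range _)
  obtain ⟨c, hc⟩ := (Submodule.mem_span_range_iff_exists_fun ℝ).1
    (K.starProjection_apply_mem hf.toLp)
  have hres := toLp_sub_sum hf hY c
  rw [hc] at hres
  refine ⟨c, fun i => ?_, ?_⟩
  · have h := K.starProjection_inner_eq_zero hf.toLp (hY i).toLp
      (Submodule.subset_span (mem_range_self i))
    rw [← hres, L2.inner_def] at h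
    rw [← h]
    refine integral_congr_ae ?_
    filter_upwards [(memLp_sub_sum hf hY c).coeFn_toLp, (hY i).coeFn_toLp] with ω h1 h2
    rw [h1, h2]
    simp [mul_comm]
  · have hd : l2DistSpan P f Y = eLpNorm (fun ω => f ω - ∑ j, c j * Y j ω) 2 P := by
      refine le_antisymm ?_ ?_
      · refine iInf₂_le_of_le (∑ j, c j • Y j) (Submodule.sum_mem _ fun j _ =>
          Submodule.smul_mem _ _ (Submodule.subset_span (mem_range_self j))) (le_of_eq ?_)
        congr 1
        ext ω
        simp
      · refine le_iInf₂ fun h hh => ?_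
        obtain ⟨c', rfl⟩ := (Submodule.mem_span_range_iff_exists_fun ℝ).1 hh
        have e : f - ∑ j, c' j • Y j = fun ω => f ω - ∑ j, c' j * Y j ω := by
          ext ω
          simp
        rw [e, ← Lp.enorm_toLp (memLp_sub_sum hf hY c), ← Lp.enorm_toLp (memLp_sub_sum hf hY c'),
          hres, toLp_sub_sum hf hY c', ← ofReal_norm, ← ofReal_norm]
        refine ENNReal.ofReal_le_ofReal ?_
        rw [K.starProjection_minimal]
        exact ciInf_le ⟨0, by rintro _ ⟨x, rfl⟩; exact norm_nonneg _⟩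
          (⟨_, Submodule.sum_mem _ fun j _ => Submodule.smul_mem _ _
            (Submodule.subset_span (mem_range_self j))⟩ : K)
    rw [hd]
    have := eLpNorm_nnreal_pow_eq_lintegral (p := 2) (μ := P)
      (f := fun ω => f ω - ∑ j, c j * Y j ω) two_ne_zero
    simp only [ENNReal.coe_ofNat, NNReal.coe_ofNat, ENNReal.rpow_ofNat] at this
    rw [this]
    refine lintegral_congr fun ω => ?_
    rw [← ofReal_norm, ← ENNReal.ofReal_pow (norm_nonneg _), Real.norm_eq_abs, sq_abs]

end projection

section regression
variable {Ω : Type*} [MeasurableSpace Ω] {P : Measure Ω} {n : ℕ}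

/-- The mean of `a²` under the law tilted by `exp (-|b|²/2)`, for a centered Gaussian vector
`(a, b)`, as a squared distance. -/
lemma lintegral_sq_mul_exp_eq_l2DistSpan {a : Ω → ℝ} {b Z : Fin n → Ω → ℝ}
    (hab : HasGaussianLaw (fun ω => (a ω, fun i => b i ω)) P)
    (ha0 : ∫ ω, a ω ∂P = 0) (hb0 : ∀ i, ∫ ω, b i ω ∂P = 0)
    (hZ : iIndepFun Z P) (hZl : ∀ i, HasLaw (Z i) (gaussianReal 0 1) P)
    (hZab : IndepFun (fun ω i => Z i ω) (fun ω => (a ω, fun i => b i ω)) P) :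
    ∫⁻ ω, ENNReal.ofReal (a ω ^ 2) * ENNReal.ofReal (Real.exp (-∑ i, b i ω ^ 2 / 2)) ∂P
      = l2DistSpan P a (fun i ω => b i ω + Z i ω) ^ 2
        * ∫⁻ ω, ENNReal.ofReal (Real.exp (-∑ i, b i ω ^ 2 / 2)) ∂P := by
  have hP : IsProbabilityMeasure P := hab.isProbabilityMeasure
  have hZp := hZ.hasLaw_pi hZl
  have hZG : HasGaussianLaw (fun ω i => Z i ω) P :=
    hZ.hasGaussianLaw fun i => (hZl i).hasGaussianLaw
  have hjoint : HasGaussianLaw (fun ω => ((a ω, fun i => b i ω), fun i => Z i ω)) P :=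
    hZab.symm.hasGaussianLaw hab hZG
  have ha2 : MemLp a 2 P := hab.fst.memLp_two
  have hb2 : ∀ i, MemLp (b i) 2 P := fun i => (hab.snd.eval i).memLp_two
  have hZ2 : ∀ i, MemLp (Z i) 2 P := fun i => (hZl i).hasGaussianLaw.memLp_two
  have hY2 : ∀ i, MemLp (fun ω => b i ω + Z i ω) 2 P := fun i => (hb2 i).add (hZ2 i)
  have hZ0 : ∀ i, ∫ ω, Z i ω ∂P = 0 := fun i => by
    rw [(hZl i).integral_eq, integral_id_gaussianReal]
  have hY0 : ∀ i, ∫ ω, (b i ω + Z i ω) ∂P = 0 := fun i => by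
    rw [integral_add ((hb2 i).integrable one_le_two) ((hZ2 i).integrable one_le_two), hb0, hZ0,
      add_zero]
  obtain ⟨c, hc, hdist⟩ := exists_l2DistSpan_eq ha2 hY2
  have hR2 := memLp_sub_sum ha2 hY2 c
  have hR0 : ∫ ω, (a ω - ∑ i, c i * (b i ω + Z i ω)) ∂P = 0 := by
    rw [integral_sub (ha2.integrable one_le_two)
      (integrable_finsetSum _ fun i _ => ((hY2 i).integrable one_le_two).const_mul _),
      integral_finsetSum _ fun i _ => ((hY2 i).integrable one_le_two).const_mul _, ha0]
    simp_rw [integral_const_mul, hY0]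
    simp
  set ν := P.map fun ω => (a ω, fun i => b i ω)
  have hν : IsProbabilityMeasure ν := Measure.isProbabilityMeasure_map hab.aemeasurable
  have hlaw : HasLaw (fun ω => ((a ω, fun i => b i ω), fun i => Z i ω))
      (ν.prod (Measure.pi fun _ => gaussianReal 0 1)) P :=
    IndepFun.hasLaw_prod ⟨hab.aemeasurable, rfl⟩ hZp hZab.symm
  -- independence of the residual and `b + Z`
  let L : (ℝ × (Fin n → ℝ)) × (Fin n → ℝ) →ₗ[ℝ] (Unit → ℝ) × (Fin n → ℝ) :=
    { toFun := fun z => (fun _ => z.1.1 - ∑ i, c i * (z.1.2 i + z.2 i), z.1.2 + z.2)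
      map_add' := fun x y => by
        ext i
        · simp [mul_add, Finset.sum_add_distrib]; ring
        · simp; ring
      map_smul' := fun r x => by
        ext i
        · simp [mul_sub, Finset.mul_sum, ← mul_add, mul_left_comm]
        · simp [mul_add] }
  have hRY : HasGaussianLaw (fun ω => ((fun _ : Unit => a ω - ∑ i, c i * (b i ω + Z i ω)),
      fun i => b i ω + Z i ω)) P := hjoint.map_fun L.toContinuousLinearMap
  -- The normal equations `hc` say that the centered residual is uncorrelated with each `b i + Z i`;
  -- under joint Gaussianity this is independence.
  have hind : IndepFun (fun ω => a ω - ∑ i, c i * (b i ω + Z i ω))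
      (fun ω i => b i ω + Z i ω) P := by
    have := HasGaussianLaw.indepFun_of_covariance_eval
      (X := fun (_ : Unit) ω => a ω - ∑ i, c i * (b i ω + Z i ω))
      (Y := fun i ω => b i ω + Z i ω) hRY fun _ i => by
        rw [covariance_eq_sub hR2 (hY2 i), hR0, zero_mul, sub_zero]
        exact hc i
    exact this.comp (φ := fun r : Unit → ℝ => r ()) (ψ := id) (by fun_prop) measurable_id
  have hRm : Measurable fun z : (ℝ × (Fin n → ℝ)) × (Fin n → ℝ) =>
      z.1.1 - ∑ i, c i * (z.1.2 i + z.2 i) := by fun_prop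
  have hYm : Measurable fun z : (ℝ × (Fin n → ℝ)) × (Fin n → ℝ) => z.1.2 + z.2 := by fun_prop
  have key := lintegral_sq_mul_exp_eq ν c ?_ ?_ ?_ ?_
  · rw [← hlaw.map_eq, lintegral_map' (by fun_prop) hjoint.aemeasurable,
      lintegral_map' (by fun_prop) hab.aemeasurable,
      lintegral_map' (by fun_prop) hab.aemeasurable] at key
    rw [hdist]
    exact key
  · exact (integrable_map_measure (by fun_prop) hab.aemeasurable).2 ha2.integrable_sq
  · rw [← hlaw.map_eq]
    exact (indepFun_map_iff hlaw.aemeasurable hRm hYm).2 hind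
  · rw [← hlaw.map_eq]
    exact (memLp_map_measure_iff hRm.aestronglyMeasurable hlaw.aemeasurable).2 hR2
  · rw [← hlaw.map_eq, integral_map hlaw.aemeasurable hRm.aestronglyMeasurable]
    exact hR0

end regression

/-! ### Tilted Brownian increments -/

/-- Only the finite-dimensional law matters, so integrals move freely between a coordinate of the
Wiener path and the Brownian motion that carries the auxiliary noise. -/
lemma IsPreBrownianReal.lintegral_restrict_eq {Ω Ω' : Type*} [MeasurableSpace Ω]
    [MeasurableSpace Ω'] {P : Measure Ω} {P' : Measure Ω'} {B : ℝ≥0 → Ω → ℝ} {B' : ℝ≥0 → Ω' → ℝ}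
    (hB : IsPreBrownianReal B P) (hB' : IsPreBrownianReal B' P') (I : Finset ℝ≥0)
    {F : (I → ℝ) → ℝ≥0∞} (hF : Measurable F) :
    ∫⁻ ω, F (I.restrict (B · ω)) ∂P = ∫⁻ ω, F (I.restrict (B' · ω)) ∂P' := by
  rw [(hB.hasLaw I).lintegral_comp hF.aemeasurable, (hB'.hasLaw I).lintegral_comp hF.aemeasurable]

section transfer
variable {Ω Ω' : Type*} [MeasurableSpace Ω] [MeasurableSpace Ω'] {P : Measure Ω} {P' : Measure Ω'}
  {B : ℝ≥0 → Ω → ℝ} {B' : ℝ≥0 → Ω' → ℝ} {n : ℕ}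

lemma IsPreBrownianReal.lintegral_tilt_eq (s t : Fin n → ℝ≥0) (u : Fin n → ℝ) (T : ℝ≥0)
    (hB : IsPreBrownianReal B P)
    (hB' : IsPreBrownianReal B' P') {m : ℝ → ℝ≥0∞} (hm : Measurable m) :
    ∫⁻ ω, m (B T ω - B 0 ω) *
        ENNReal.ofReal (Real.exp (-∑ i, (u i * (B (t i) ω - B (s i) ω)) ^ 2 / 2)) ∂P
      = ∫⁻ ω, m (B' T ω - B' 0 ω) *
        ENNReal.ofReal (Real.exp (-∑ i, (u i * (B' (t i) ω - B' (s i) ω)) ^ 2 / 2)) ∂P' := by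
  classical
  set I : Finset ℝ≥0 := {0, T} ∪ (Finset.univ.image s ∪ Finset.univ.image t) with hI
  have h0 : 0 ∈ I := by simp [hI]
  have hT : T ∈ I := by simp [hI]
  have hs : ∀ i, s i ∈ I := fun i => by simp [hI]
  have ht : ∀ i, t i ∈ I := fun i => by simp [hI]
  exact IsPreBrownianReal.lintegral_restrict_eq hB hB' I (F := fun y => m (y ⟨T, hT⟩ - y ⟨0, h0⟩) *
    ENNReal.ofReal (Real.exp (-∑ i, (u i * (y ⟨t i, ht i⟩ - y ⟨s i, hs i⟩)) ^ 2 / 2)))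
    (by fun_prop)

/-- The Gaussian regression identity for increments of a Brownian motion. -/
lemma IsPreBrownianReal.lintegral_sq_tilt (s t : Fin n → ℝ≥0) (u : Fin n → ℝ) (T : ℝ≥0)
    (hB : IsPreBrownianReal B P) {Z : Fin n → Ω → ℝ}
    (hZ : iIndepFun Z P)
    (hZl : ∀ i, HasLaw (Z i) (gaussianReal 0 1) P)
    (hZB : IndepFun (fun ω i => Z i ω) (fun ω r => B r ω) P) :
    ∫⁻ ω, ENNReal.ofReal ((B T ω - B 0 ω) ^ 2) *
        ENNReal.ofReal (Real.exp (-∑ i, (u i * (B (t i) ω - B (s i) ω)) ^ 2 / 2)) ∂P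
      = l2DistSpan P (fun ω => B T ω - B 0 ω)
          (fun i ω => u i * (B (t i) ω - B (s i) ω) + Z i ω) ^ 2 *
        ∫⁻ ω, ENNReal.ofReal (Real.exp (-∑ i, (u i * (B (t i) ω - B (s i) ω)) ^ 2 / 2)) ∂P := by
  classical
  have hsub : ∀ a b : ℝ≥0, ∫ ω, (B a ω - B b ω) ∂P = 0 := fun a b => by
    rw [integral_sub (hB.integrable_eval a) (hB.integrable_eval b), hB.integral_eval,
      hB.integral_eval, sub_zero]
  refine lintegral_sq_mul_exp_eq_l2DistSpan (a := fun ω => B T ω - B 0 ω)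
    (b := fun i ω => u i * (B (t i) ω - B (s i) ω)) ?_ (hsub _ _) (fun i => ?_) hZ hZl ?_
  · set I : Finset ℝ≥0 := {0, T} ∪ (Finset.univ.image s ∪ Finset.univ.image t) with hI
    have h0 : 0 ∈ I := by simp [hI]
    have hT : T ∈ I := by simp [hI]
    have hs : ∀ i, s i ∈ I := fun i => by simp [hI]
    have ht : ∀ i, t i ∈ I := fun i => by simp [hI]
    let L : (I → ℝ) →ₗ[ℝ] ℝ × (Fin n → ℝ) :=
      { toFun := fun y => (y ⟨T, hT⟩ - y ⟨0, h0⟩, fun i => u i * (y ⟨t i, ht i⟩ - y ⟨s i, hs i⟩))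
        map_add' := fun x y => by
          ext i
          · simp; ring
          · simp; ring
        map_smul' := fun r x => by
          ext i
          · simp; ring
          · simp; ring }
    exact (hB.isGaussianProcess.hasGaussianLaw I).map_fun L.toContinuousLinearMap
  · rw [integral_const_mul, hsub, mul_zero]
  · exact hZB.comp (φ := id)
      (ψ := fun y : ℝ≥0 → ℝ => (y T - y 0, fun i => u i * (y (t i) - y (s i))))
      measurable_id (by fun_prop)

end transfer

/-! ### Factorization over coordinates and the distance formula -/

section wiener
variable {d : ℕ} {W : Measure (PathSpace d)}
  {n : ℕ} (s t : Fin n → ℝ≥0) (u : Fin n → ℝ)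

/-- The factor of the Gaussian weight that depends on one coordinate. -/
def coordWeight (y : ℝ≥0 → ℝ) : ℝ≥0∞ :=
  ENNReal.ofReal (Real.exp (-∑ i, (u i * (y (t i) - y (s i))) ^ 2 / 2))

@[fun_prop]
lemma measurable_coordWeight : Measurable (coordWeight s t u) := by
  unfold coordWeight
  fun_prop

/-- The squared Euclidean norm is a sum over coordinates, so under `P_{ξ,u}` the coordinates remain
independent. -/
lemma gaussWeight_eq_prod_coordWeight (x : PathSpace d) :
    gaussWeight ⟨n, fun i => ((s i : ℝ), (t i : ℝ))⟩ u x
      = ∏ j, coordWeight s t u fun r => x r j := by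
  simp only [gaussWeight, coordWeight]
  rw [← ENNReal.ofReal_prod_of_nonneg fun _ _ => (Real.exp_pos _).le, ← Real.exp_sum,
    Finset.sum_neg_distrib, Finset.sum_comm]
  congr 3
  refine Finset.sum_congr rfl fun i _ => ?_
  rw [EuclideanSpace.norm_sq_eq, Finset.mul_sum, Finset.sum_div]
  refine Finset.sum_congr rfl fun j _ => ?_
  simp [incr, mul_pow]

lemma enorm_sq_incr_eq (x : PathSpace d) (T : ℝ≥0) :
    ‖incr x 0 T‖ₑ ^ 2 = ∑ j, ENNReal.ofReal ((x T j - x 0 j) ^ 2) := by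
  rw [← ofReal_norm, ← ENNReal.ofReal_pow (norm_nonneg _), EuclideanSpace.norm_sq_eq,
    ENNReal.ofReal_sum_of_nonneg fun _ _ => sq_nonneg _]
  simp [incr]

lemma IsWienerMeasure.lintegral_prod_coord (hW : IsWienerMeasure W)
    (f : Fin d → (ℝ≥0 → ℝ) → ℝ≥0∞) (hf : ∀ j, Measurable (f j)) :
    ∫⁻ x, ∏ j, f j (fun r => x r j) ∂W = ∏ j, ∫⁻ x, f j (fun r => x r j) ∂W :=
  lintegral_prod_eq_prod_lintegral_of_indepFun Finset.univ _ (hW.indep.comp f hf) fun j =>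
    (hf j).comp (measurable_pi_lambda _ fun r => measurable_eval_coord r j)

/-- `σ_T²(ξ, u)` is the squared distance of the Brownian increment to the regression span. -/
theorem IsWienerMeasure.sigmaSq_eq (hW : IsWienerMeasure W) (hd : 0 < d) {T : ℝ} (hT : 0 < T)
    {Ω : Type*} [MeasurableSpace Ω] {P : Measure Ω} {B : ℝ≥0 → Ω → ℝ} {Z : Fin n → Ω → ℝ}
    (hB : IsPreBrownianReal B P) (hZ : iIndepFun Z P)
    (hZl : ∀ i, HasLaw (Z i) (gaussianReal 0 1) P)
    (hZB : IndepFun (fun ω i => Z i ω) (fun ω r => B r ω) P) :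
    sigmaSq W T ⟨n, fun i => ((s i : ℝ), (t i : ℝ))⟩ u = (ENNReal.ofReal T)⁻¹ *
      l2DistSpan P (fun ω => B T.toNNReal ω - B 0 ω)
        (fun i ω => u i * (B (t i) ω - B (s i) ω) + Z i ω) ^ 2 := by
  classical
  have := hW.isProbabilityMeasure
  lift T to ℝ≥0 using hT.le
  rw [Real.toNNReal_coe]
  set D := l2DistSpan P (fun ω => B T ω - B 0 ω)
        (fun i ω => u i * (B (t i) ω - B (s i) ω) + Z i ω) ^ 2 with hD
  set K := ∫⁻ ω, ENNReal.ofReal (Real.exp (-∑ i, (u i * (B (t i) ω - B (s i) ω)) ^ 2 / 2)) ∂P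
    with hK
  have hpath : ∀ j : Fin d, Measurable fun (x : PathSpace d) (r : ℝ≥0) => x r j := fun j =>
    measurable_pi_lambda _ fun r => measurable_eval_coord r j
  have hKj : ∀ j : Fin d, ∫⁻ x, coordWeight s t u (fun r => x r j) ∂W = K := fun j => by
    have h := IsPreBrownianReal.lintegral_tilt_eq s t u T (hW.brownian j).toIsPreBrownianReal hB
      (m := fun _ => 1) measurable_const
    simp only [one_mul] at h
    exact h
  have hNj : ∀ j : Fin d, ∫⁻ x, ENNReal.ofReal ((x T j - x 0 j) ^ 2) *
      coordWeight s t u (fun r => x r j) ∂W = D * K := fun j => by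
    rw [hD, hK, ← IsPreBrownianReal.lintegral_sq_tilt s t u T hB hZ hZl hZB]
    exact IsPreBrownianReal.lintegral_tilt_eq s t u T (hW.brownian j).toIsPreBrownianReal hB
      (m := fun r => ENNReal.ofReal (r ^ 2)) (by fun_prop)
  have hphi : phi W ⟨n, fun i => ((s i : ℝ), (t i : ℝ))⟩ u = K ^ d := by
    simp_rw [phi, gaussWeight_eq_prod_coordWeight]
    rw [hW.lintegral_prod_coord _ fun _ => measurable_coordWeight s t u]
    simp_rw [hKj]
    simp
  -- The squared displacement is a sum over `j`; its `j`-th term contributes `D K` from coordinate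
  -- `j` and `K` from each other one. The resulting factor `d` cancels the `1/d` in `σ_T²`.
  have hnum : ∫⁻ x, gaussWeight ⟨n, fun i => ((s i : ℝ), (t i : ℝ))⟩ u x * ‖incr x 0 T‖ₑ ^ 2 ∂W
      = d * D * K ^ d := by
    simp_rw [gaussWeight_eq_prod_coordWeight, enorm_sq_incr_eq, Finset.mul_sum]
    rw [lintegral_finsetSum]
    · have hj : ∀ j : Fin d, ∫⁻ x, (∏ k, coordWeight s t u fun r => x r k) *
          ENNReal.ofReal ((x T j - x 0 j) ^ 2) ∂W = D * K ^ d := by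
        intro j
        have e : ∀ x : PathSpace d, (∏ k, coordWeight s t u fun r => x r k) *
            ENNReal.ofReal ((x T j - x 0 j) ^ 2)
            = ∏ k, (fun y : ℝ≥0 → ℝ => (if k = j then ENNReal.ofReal ((y T - y 0) ^ 2) else 1) *
              coordWeight s t u y) fun r => x r k := fun x => by
          rw [Finset.prod_mul_distrib, Finset.prod_ite_eq' Finset.univ j, mul_comm]
          simp
        simp_rw [e]
        rw [hW.lintegral_prod_coord fun k (y : ℝ≥0 → ℝ) =>
          (if k = j then ENNReal.ofReal ((y T - y 0) ^ 2) else 1) *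
          coordWeight s t u y]
        · rw [← Finset.mul_prod_erase _ _ (Finset.mem_univ j)]
          simp only [if_true]
          rw [hNj, Finset.prod_congr rfl (g := fun _ => K) fun k hk => by
            simp only [Finset.ne_of_mem_erase hk, if_false, one_mul, hKj]]
          simp only [Finset.prod_const, Finset.card_erase_of_mem (Finset.mem_univ j),
            Finset.card_univ, Fintype.card_fin]
          rw [mul_assoc, ← pow_succ', Nat.sub_add_cancel hd]
        · intro k
          split_ifs <;> fun_prop
      simp_rw [hj]
      simp [mul_assoc]
    · intro j _
      exact (Finset.measurable_prod _ fun k _ =>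
        (measurable_coordWeight s t u).comp (hpath k)).mul
          (((measurable_eval_coord T j).sub (measurable_eval_coord 0 j)).pow_const 2).ennreal_ofReal
  have hφ0 := phi_ne_zero (W := W) ⟨n, fun i => ((s i : ℝ), (t i : ℝ))⟩ u
  have hφ1 : phi W ⟨n, fun i => ((s i : ℝ), (t i : ℝ))⟩ u ≠ ∞ :=
    ((phi_le_one _ _).trans_lt ENNReal.one_lt_top).ne
  rw [sigmaSq, meanSqDisplacement, gaussMeasure, lintegral_smul_measure,
    lintegral_withDensity_eq_lintegral_mul _ (measurable_gaussWeight _ _) (by fun_prop)]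
  simp only [Pi.mul_apply]
  rw [hnum, ← hphi, smul_eq_mul]
  generalize phi W ⟨n, fun i => ((s i : ℝ), (t i : ℝ))⟩ u = Φ at hφ0 hφ1 ⊢
  rw [mul_comm (d * D) Φ, ENNReal.inv_mul_cancel_left hφ0 hφ1,
    ENNReal.ofReal_mul (by positivity), ENNReal.ofReal_natCast, ← mul_assoc,
    ENNReal.mul_inv (by simp) (by simp), mul_comm _ (d : ℝ≥0∞), ← mul_assoc,
    ENNReal.mul_inv_cancel (by simpa using hd.ne') (by simp), one_mul]

end wiener

/-! ### Khasminskii's lemma -/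

/-- The fundamental theorem of calculus for `t ↦ -exp (∫_t^T w)`. -/
lemma exp_integral_eq_one_add {w : ℝ → ℝ} (hw : Continuous w) (T : ℝ) :
    Real.exp (∫ r in 0..T, w r) = 1 + ∫ t in 0..T, w t * Real.exp (∫ r in t..T, w r) := by
  have hd : ∀ t, HasDerivAt (fun t => -Real.exp (∫ r in t..T, w r))
      (w t * Real.exp (∫ r in t..T, w r)) t := fun t => by
    have h := (intervalIntegral.integral_hasDerivAt_left (hw.intervalIntegrable t T)
      (hw.stronglyMeasurableAtFilter _ _) hw.continuousAt).exp.neg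
    exact h.congr_deriv (by ring)
  have hc : Continuous fun t => ∫ r in t..T, w r :=
    continuous_iff_continuousAt.2 fun t =>
      (intervalIntegral.integral_hasDerivAt_left (hw.intervalIntegrable t T)
        (hw.stronglyMeasurableAtFilter _ _) hw.continuousAt).continuousAt
  rw [intervalIntegral.integral_eq_sub_of_hasDerivAt (fun t _ => hd t)
    (Continuous.intervalIntegrable (by fun_prop) _ _)]
  simp

lemma setLIntegral_Ioc_ofReal {w : ℝ → ℝ} (hw : Continuous w) (hw0 : ∀ r, 0 ≤ w r) {a b : ℝ}
    (hab : a ≤ b) :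
    ∫⁻ r in Ioc a b, ENNReal.ofReal (w r) = ENNReal.ofReal (∫ r in a..b, w r) := by
  rw [intervalIntegral.integral_of_le hab, ofReal_integral_eq_lintegral_ofReal
    ((hw.intervalIntegrable a b).1) (ae_of_all _ hw0)]

/-- The inner integral is restarted at time `t`, ready for the Markov property. -/
lemma expENN_lintegral_eq_one_add {w : ℝ → ℝ} (hw : Continuous w) (hw0 : ∀ r, 0 ≤ w r) {T : ℝ}
    (hT : 0 ≤ T) :
    expENN (∫⁻ r in Ioc 0 T, ENNReal.ofReal (w r)) = 1 + ∫⁻ t in Ioc 0 T, ENNReal.ofReal (w t) *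
      expENN (∫⁻ r in Ioc 0 (T - t), ENNReal.ofReal (w (t + r))) := by
  have hnn : ∀ {a b : ℝ}, a ≤ b → 0 ≤ ∫ r in a..b, w r := fun hab =>
    intervalIntegral.integral_nonneg hab fun r _ => hw0 r
  have hc : Continuous fun t => ∫ r in t..T, w r :=
    continuous_iff_continuousAt.2 fun t =>
      (intervalIntegral.integral_hasDerivAt_left (hw.intervalIntegrable t T)
        (hw.stronglyMeasurableAtFilter _ _) hw.continuousAt).continuousAt
  rw [setLIntegral_Ioc_ofReal hw hw0 hT, expENN_ofReal (hnn hT), exp_integral_eq_one_add hw,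
    ENNReal.ofReal_add zero_le_one (intervalIntegral.integral_nonneg hT fun t _ =>
      mul_nonneg (hw0 t) (Real.exp_pos _).le), ENNReal.ofReal_one,
    ← setLIntegral_Ioc_ofReal (by fun_prop) (fun t => mul_nonneg (hw0 t) (Real.exp_pos _).le) hT]
  congr 1
  refine setLIntegral_congr_fun measurableSet_Ioc fun t ht => ?_
  have hshift : ∫ r in 0..(T - t), w (t + r) = ∫ r in t..T, w r := by
    rw [intervalIntegral.integral_comp_add_left (fun r => w r) t]
    simp
  rw [setLIntegral_Ioc_ofReal (w := fun r => w (t + r)) (by fun_prop) (fun r => hw0 _)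
    (sub_nonneg.2 ht.2), hshift, expENN_ofReal (hnn ht.2), ENNReal.ofReal_mul (hw0 t)]

section khasminskii
variable {d : ℕ} {W : Measure (PathSpace d)}

lemma continuous_incr (x : PathSpace d) (s : ℝ) : Continuous fun r => incr x s r := by
  unfold incr
  fun_prop

/-- The exponential moment of the additive functional `∫_0^T V(z + X_r) dr`. -/
def expMoment (W : Measure (PathSpace d)) (V : EuclideanSpace ℝ (Fin d) → ℝ≥0∞)
    (z : EuclideanSpace ℝ (Fin d)) (T : ℝ) : ℝ≥0∞ :=
  ∫⁻ x, expENN (∫⁻ r in Ioc 0 T, V (z + incr x 0 r)) ∂W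

lemma measurable_additive {V : EuclideanSpace ℝ (Fin d) → ℝ≥0∞} (hV : Measurable V)
    (z : EuclideanSpace ℝ (Fin d)) (T : ℝ) : Measurable fun p : PathSpace d × ℝ =>
      ∫⁻ r in Ioc 0 (T - p.2), V (z + incr p.1 0 (p.2 + r)) := by
  have e : ∀ p : PathSpace d × ℝ, ∫⁻ r in Ioc 0 (T - p.2), V (z + incr p.1 0 (p.2 + r))
      = ∫⁻ r, {q : (PathSpace d × ℝ) × ℝ | 0 < q.2 ∧ q.2 ≤ T - q.1.2}.indicator
        (fun q => V (z + incr q.1.1 0 (q.1.2 + q.2))) (p, r) := fun p => by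
    rw [← lintegral_indicator measurableSet_Ioc]
    rfl
  simp_rw [e]
  refine Measurable.lintegral_prod_right' (f := {q : (PathSpace d × ℝ) × ℝ |
    0 < q.2 ∧ q.2 ≤ T - q.1.2}.indicator fun q => V (z + incr q.1.1 0 (q.1.2 + q.2)))
    (Measurable.indicator (by fun_prop) ?_)
  exact (measurableSet_lt measurable_const measurable_snd).inter
    (measurableSet_le measurable_snd (by fun_prop))

lemma measurable_additive_zero {V : EuclideanSpace ℝ (Fin d) → ℝ≥0∞} (hV : Measurable V)
    (z : EuclideanSpace ℝ (Fin d)) (T : ℝ) :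
    Measurable fun x : PathSpace d => ∫⁻ r in Ioc 0 T, V (z + incr x 0 r) :=
  Measurable.lintegral_prod_right' (f := fun q : PathSpace d × ℝ => V (z + incr q.1 0 q.2))
    (by fun_prop)

/-- The Markov property for exponential moments of additive functionals. -/
lemma IsWienerMeasure.lintegral_mul_expENN_shift (hW : IsWienerMeasure W)
    {V : EuclideanSpace ℝ (Fin d) → ℝ≥0∞} (hV : Measurable V)
    (z : EuclideanSpace ℝ (Fin d)) (t : ℝ≥0) (S : ℝ) :
    ∫⁻ x, V (z + incr x 0 t) * expENN (∫⁻ r in Ioc 0 S, V (z + incr x 0 (t + r))) ∂W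
      = ∫⁻ x, V (z + incr x 0 t) * expMoment W V (z + incr x 0 t) S ∂W := by
  have := hW.isProbabilityMeasure
  have hA : Measurable fun x : PathSpace d => ∫⁻ r in Ioc 0 S, V (z + incr x 0 (t + r)) := by
    have := (measurable_additive hV z (t + S)).comp
      (measurable_id.prodMk (measurable_const (a := (t : ℝ))))
    simpa [Function.comp_def] using this
  have hmt : Measurable fun x : PathSpace d =>
      V (z + incr x 0 t) * expENN (∫⁻ r in Ioc 0 S, V (z + incr x 0 (t + r))) := by fun_prop
  conv_lhs => rw [← hW.map_concat t]
  rw [lintegral_map hmt (measurable_concat t)]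
  refine (lintegral_prod _ (hmt.comp (measurable_concat t)).aemeasurable).trans ?_
  refine lintegral_congr fun x => ?_
  have hB : Measurable fun y : PathSpace d =>
      expENN (∫⁻ r in Ioc 0 S, V (z + incr x 0 t + incr y 0 r)) :=
    measurable_expENN.comp (measurable_additive_zero hV _ S)
  rw [expMoment, ← lintegral_const_mul _ hB]
  simp only [Function.comp_def]
  refine lintegral_congr fun y => ?_
  rw [incr_concat_of_le t (x, y) t.2 le_rfl]
  congr 2
  refine setLIntegral_congr_fun measurableSet_Ioc fun r hr => ?_
  have h : incr (concat t (x, y)) 0 (t + r) = incr x 0 t + incr y 0 r :=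
    incr_zero_concat t ⟨r, hr.1.le⟩ (x, y)
  beta_reduce
  rw [h, add_assoc]

/-- Duhamel's formula: the pathwise identity for the exponential, averaged with the Markov property
at time `t`. -/
lemma IsWienerMeasure.expMoment_eq_one_add (hW : IsWienerMeasure W)
    {V : EuclideanSpace ℝ (Fin d) → ℝ} (hV : Continuous V) (hV0 : ∀ y, 0 ≤ V y)
    (z : EuclideanSpace ℝ (Fin d)) {T : ℝ} (hT : 0 ≤ T) :
    expMoment W (fun y => ENNReal.ofReal (V y)) z T
      = 1 + ∫⁻ t in Ioc 0 T, ∫⁻ x, ENNReal.ofReal (V (z + incr x 0 t)) *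
        expMoment W (fun y => ENNReal.ofReal (V y)) (z + incr x 0 t) (T - t) ∂W := by
  have := hW.isProbabilityMeasure
  have hVm : Measurable V := hV.measurable
  have hmul := measurable_additive (d := d) hVm.ennreal_ofReal z T
  have hm : Measurable fun p : PathSpace d × ℝ => ENNReal.ofReal (V (z + incr p.1 0 p.2)) *
      expENN (∫⁻ r in Ioc 0 (T - p.2), ENNReal.ofReal (V (z + incr p.1 0 (p.2 + r)))) := by
    fun_prop
  have e1 : ∀ x : PathSpace d, expENN (∫⁻ r in Ioc 0 T, ENNReal.ofReal (V (z + incr x 0 r)))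
      = 1 + ∫⁻ t in Ioc 0 T, ENNReal.ofReal (V (z + incr x 0 t)) *
        expENN (∫⁻ r in Ioc 0 (T - t), ENNReal.ofReal (V (z + incr x 0 (t + r)))) := fun x =>
    expENN_lintegral_eq_one_add (w := fun r => V (z + incr x 0 r))
      (hV.comp (continuous_const.add (continuous_incr x 0))) (fun r => hV0 _) hT
  rw [expMoment]
  simp_rw [e1]
  rw [lintegral_add_left measurable_const, lintegral_one, measure_univ,
    lintegral_lintegral_swap hm.aemeasurable]
  congr 1
  refine setLIntegral_congr_fun measurableSet_Ioc fun t ht => ?_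
  exact hW.lintegral_mul_expENN_shift hVm.ennreal_ofReal z ⟨t, ht.1.le⟩ (T - t)

/-- Khasminskii's lemma for a bounded potential. -/
lemma IsWienerMeasure.expMoment_le_of_bounded (hW : IsWienerMeasure W)
    {V : EuclideanSpace ℝ (Fin d) → ℝ} (hV : Continuous V) (hV0 : ∀ y, 0 ≤ V y) {M : ℝ}
    (hVM : ∀ y, V y ≤ M) {h : ℝ → ℝ≥0∞} {β : ℝ} (hβ0 : 0 ≤ β)
    (hh : ∀ z t, 0 < t → ∫⁻ x, ENNReal.ofReal (V (z + incr x 0 t)) ∂W ≤ h t)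
    (hβ : ∫⁻ t in Ioi 0, ENNReal.ofReal (Real.exp (-(β * t))) * h t ≤ 2⁻¹)
    (z : EuclideanSpace ℝ (Fin d)) {T : ℝ} (hT : 0 ≤ T) :
    expMoment W (fun y => ENNReal.ofReal (V y)) z T ≤ 2 * ENNReal.ofReal (Real.exp (β * T)) := by
  have := hW.isProbabilityMeasure
  set f := expMoment W (fun y => ENNReal.ofReal (V y)) with hf
  have hM : 0 ≤ M := (hV0 0).trans (hVM 0)
  set e : ℝ → ℝ≥0∞ := fun t => ENNReal.ofReal (Real.exp (-(β * t))) with he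
  have hfb : ∀ z, ∀ S ∈ Icc 0 T, f z S ≤ expENN (ENNReal.ofReal M * ENNReal.ofReal T) := by
    intro z S hS
    calc f z S ≤ ∫⁻ _, expENN (ENNReal.ofReal M * ENNReal.ofReal T) ∂W := by
          refine lintegral_mono fun x => expENN_mono ?_
          calc ∫⁻ r in Ioc 0 S, ENNReal.ofReal (V (z + incr x 0 r))
              ≤ ∫⁻ _ in Ioc 0 S, ENNReal.ofReal M :=
                lintegral_mono fun r => ENNReal.ofReal_le_ofReal (hVM _)
            _ ≤ ENNReal.ofReal M * ENNReal.ofReal T := by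
                rw [setLIntegral_const, Real.volume_Ioc, sub_zero]
                gcongr
                exact hS.2
      _ = _ := by simp
  -- Discounted supremum over starting points and times. Boundedness of `V` enters only through `G <
  -- ∞`, which permits subtraction; the final bound does not involve `M`.
  set G : ℝ≥0∞ := ⨆ (z) (S ∈ Icc 0 T), e S * f z S with hG
  have hGtop : G ≠ ∞ := by
    refine ((iSup_le fun z => iSup₂_le fun S hS => ?_ :
      G ≤ ENNReal.ofReal (Real.exp (|β| * T)) * ENNReal.ofReal (Real.exp (M * T))).trans_lt
        (ENNReal.mul_lt_top ENNReal.ofReal_lt_top ENNReal.ofReal_lt_top)).ne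
    refine mul_le_mul' (ENNReal.ofReal_le_ofReal (Real.exp_le_exp.2 ?_)) ?_
    · calc -(β * S) ≤ |β| * S := by
            rw [← neg_mul]
            exact mul_le_mul_of_nonneg_right (neg_le_abs _) hS.1
        _ ≤ |β| * T := mul_le_mul_of_nonneg_left hS.2 (abs_nonneg _)
    · rw [← expENN_ofReal (mul_nonneg hM hT), ENNReal.ofReal_mul hM]
      exact hfb z S hS
  have hGle : ∀ z, ∀ S ∈ Icc 0 T, e S * f z S ≤ G := fun z S hS =>
    le_iSup_of_le z (le_iSup₂_of_le S hS le_rfl)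
  have he_top : ∀ S, e S ≠ ∞ := fun S => ENNReal.ofReal_ne_top
  -- Splitting `e S = e t * e (S - t)` in Duhamel's formula leaves the truncated Laplace transform
  -- of `h`, at most `1/2`, in front of `G`; hence `G ≤ 2`.
  have hrec : G ≤ 1 + 2⁻¹ * G := by
    refine iSup_le fun z => iSup₂_le fun S hS => ?_
    rw [hf, hW.expMoment_eq_one_add hV hV0 z hS.1, ← hf, mul_add, mul_one]
    refine add_le_add ?_ ?_
    · rw [he, ENNReal.ofReal_le_one, Real.exp_le_one_iff, neg_nonpos]
      exact mul_nonneg hβ0 hS.1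
    calc e S * ∫⁻ t in Ioc 0 S, ∫⁻ x, ENNReal.ofReal (V (z + incr x 0 t)) *
          f (z + incr x 0 t) (S - t) ∂W
        = ∫⁻ t in Ioc 0 S, ∫⁻ x, e S * (ENNReal.ofReal (V (z + incr x 0 t)) *
          f (z + incr x 0 t) (S - t)) ∂W := by
          rw [← lintegral_const_mul' _ _ (he_top S)]
          simp_rw [lintegral_const_mul' (e S) _ (he_top S)]
      _ ≤ ∫⁻ t in Ioc 0 S, e t * h t * G := by
          refine setLIntegral_mono' measurableSet_Ioc fun t ht => ?_
          have hSt : S - t ∈ Icc 0 T := ⟨sub_nonneg.2 ht.2, by linarith [ht.1, hS.2]⟩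
          have heS : e S = e t * e (S - t) := by
            simp only [he]
            rw [← ENNReal.ofReal_mul (Real.exp_pos _).le, ← Real.exp_add]
            congr 2
            ring
          calc ∫⁻ x, e S * (ENNReal.ofReal (V (z + incr x 0 t)) *
                f (z + incr x 0 t) (S - t)) ∂W
              ≤ ∫⁻ x, e t * G * ENNReal.ofReal (V (z + incr x 0 t)) ∂W := by
                refine lintegral_mono fun x => ?_
                calc e S * (ENNReal.ofReal (V (z + incr x 0 t)) * f (z + incr x 0 t) (S - t))
                    = e t * (e (S - t) * f (z + incr x 0 t) (S - t))
                      * ENNReal.ofReal (V (z + incr x 0 t)) := by rw [heS]; ring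
                  _ ≤ e t * G * ENNReal.ofReal (V (z + incr x 0 t)) := by
                    gcongr
                    exact hGle _ _ hSt
            _ = e t * G * ∫⁻ x, ENNReal.ofReal (V (z + incr x 0 t)) ∂W :=
                lintegral_const_mul' _ _ (ENNReal.mul_ne_top (he_top t) hGtop)
            _ ≤ e t * G * h t := by gcongr; exact hh z t ht.1
            _ = e t * h t * G := by ring
      _ = (∫⁻ t in Ioc 0 S, e t * h t) * G := lintegral_mul_const' _ _ hGtop
      _ ≤ 2⁻¹ * G := by
          gcongr
          exact (lintegral_mono_set Ioc_subset_Ioi_self).trans hβ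
  have hG2 : G ≤ 2 := by
    have h1 : 2⁻¹ * G + 2⁻¹ * G ≤ 1 + 2⁻¹ * G := by
      rwa [← add_mul, ENNReal.inv_two_add_inv_two, one_mul]
    have h2 := (ENNReal.add_le_add_iff_right
      (ENNReal.mul_ne_top (by simp) hGtop : 2⁻¹ * G ≠ ∞)).1 h1
    calc G = 2 * (2⁻¹ * G) := by
          rw [← mul_assoc, ENNReal.mul_inv_cancel (by simp) (by simp), one_mul]
      _ ≤ 2 * 1 := by gcongr
      _ = 2 := mul_one 2
  calc f z T = (e T * f z T) * ENNReal.ofReal (Real.exp (β * T)) := by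
        rw [mul_right_comm, he, ← ENNReal.ofReal_mul (Real.exp_pos _).le, ← Real.exp_add]
        simp
    _ ≤ 2 * ENNReal.ofReal (Real.exp (β * T)) := by
        gcongr
        exact (hGle z T ⟨hT, le_rfl⟩).trans hG2

end khasminskii

/-! ### Uniform bounds on the smoothed potential -/

/-- Completing the square leaves a nonpositive exponent depending on `z`, which is dropped; the
centered Gaussian integral remains. -/
lemma lintegral_exp_sq_gaussianReal_le (u z : ℝ) {t : ℝ≥0} (ht : t ≠ 0) :
    ∫⁻ x, ENNReal.ofReal (Real.exp (-(u ^ 2 * (z + x) ^ 2 / 2))) ∂(gaussianReal 0 t)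
      ≤ ENNReal.ofReal ((√(1 + u ^ 2 * t))⁻¹) := by
  have ht0 : (0 : ℝ) < t := by positivity
  set a : ℝ := 1 / t + u ^ 2 with ha
  have ha0 : 0 < a := by positivity
  set b : ℝ := u ^ 2 * z / a with hb
  set F : ℝ → ℝ := fun x => (√(2 * Real.pi * t))⁻¹ * Real.exp (-(a / 2) * x ^ 2) with hF
  have hpt : ∀ x, gaussianPDFReal 0 t x * Real.exp (-(u ^ 2 * (z + x) ^ 2 / 2)) ≤ F (x + b) := by
    intro x
    simp only [gaussianPDFReal, hF, sub_zero]
    rw [mul_assoc, ← Real.exp_add]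
    refine mul_le_mul_of_nonneg_left (Real.exp_le_exp.2 ?_) (by positivity)
    have h1 : -x ^ 2 / (2 * t) + -(u ^ 2 * (z + x) ^ 2 / 2)
        = -(a / 2) * (x + b) ^ 2 - u ^ 2 * z ^ 2 / (2 * t * a) := by
      rw [hb]
      field_simp
      rw [ha]
      field_simp
      ring
    rw [h1]
    have : 0 ≤ u ^ 2 * z ^ 2 / (2 * t * a) := by positivity
    linarith
  rw [gaussianReal_of_var_ne_zero _ ht, lintegral_withDensity_eq_lintegral_mul _
    (measurable_gaussianPDF 0 t) (by fun_prop)]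
  calc ∫⁻ x, (gaussianPDF 0 t * fun x => ENNReal.ofReal (Real.exp (-(u ^ 2 * (z + x) ^ 2 / 2)))) x
      ≤ ∫⁻ x, ENNReal.ofReal (F (x + b)) := by
        refine lintegral_mono fun x => ?_
        rw [Pi.mul_apply, gaussianPDF, ← ENNReal.ofReal_mul (gaussianPDFReal_nonneg _ _ _)]
        exact ENNReal.ofReal_le_ofReal (hpt x)
    _ = ∫⁻ x, ENNReal.ofReal (F x) := lintegral_add_right_eq_self (fun x => ENNReal.ofReal (F x)) b
    _ = ENNReal.ofReal (∫ x, F x) := by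
        rw [ofReal_integral_eq_lintegral_ofReal
          ((integrable_exp_neg_mul_sq (by positivity : 0 < a / 2)).const_mul _)
          (ae_of_all _ fun x => by positivity)]
    _ = ENNReal.ofReal ((√(1 + u ^ 2 * t))⁻¹) := by
        rw [hF, integral_const_mul, integral_gaussian, ← Real.sqrt_inv, ← Real.sqrt_inv,
          ← Real.sqrt_mul (by positivity)]
        congr 2
        rw [ha]
        have := Real.pi_pos
        field_simp

section gaussian
variable {d : ℕ} {W : Measure (PathSpace d)}

/-- The coordinates contribute `(1 + u² t)^(-1/2)` each; with `d ≥ 2` at least two such factors are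
available. -/
lemma IsWienerMeasure.lintegral_exp_sq_norm_le (hW : IsWienerMeasure W) (hd : 2 ≤ d) (u : ℝ)
    (z : EuclideanSpace ℝ (Fin d)) {t : ℝ} (ht : 0 < t) :
    ∫⁻ x, ENNReal.ofReal (Real.exp (-(u ^ 2 * ‖z + incr x 0 t‖ ^ 2 / 2))) ∂W
      ≤ ENNReal.ofReal ((1 + u ^ 2 * t)⁻¹) := by
  lift t to ℝ≥0 using ht.le
  have ht' : t ≠ 0 := by rintro rfl; simp at ht
  have e : ∀ x : PathSpace d, ENNReal.ofReal (Real.exp (-(u ^ 2 * ‖z + incr x 0 t‖ ^ 2 / 2)))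
      = ∏ j, (fun y : ℝ≥0 → ℝ => ENNReal.ofReal
        (Real.exp (-(u ^ 2 * (z j + (y t - y 0)) ^ 2 / 2)))) fun r => x r j := fun x => by
    rw [← ENNReal.ofReal_prod_of_nonneg fun _ _ => (Real.exp_pos _).le, ← Real.exp_sum,
      Finset.sum_neg_distrib, EuclideanSpace.norm_sq_eq, Finset.mul_sum, Finset.sum_div]
    simp [incr]
  simp_rw [e]
  have hf : ∀ j : Fin d, Measurable fun y : ℝ≥0 → ℝ =>
      ENNReal.ofReal (Real.exp (-(u ^ 2 * (z j + (y t - y 0)) ^ 2 / 2))) := fun j => by fun_prop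
  refine (le_of_eq (hW.lintegral_prod_coord _ hf)).trans ?_
  set q := √(1 + u ^ 2 * t) with hq
  have hq1 : 1 ≤ q := Real.one_le_sqrt.2 (by nlinarith [sq_nonneg u, t.2])
  have hone : ∀ j : Fin d, ∫⁻ x, ENNReal.ofReal
      (Real.exp (-(u ^ 2 * (z j + (x t j - x 0 j)) ^ 2 / 2))) ∂W ≤ ENNReal.ofReal q⁻¹ := fun j => by
    have hl := (hW.brownian j).toIsPreBrownianReal.hasLaw_sub t 0
    have h1 := hl.lintegral_comp (f := fun y =>
      ENNReal.ofReal (Real.exp (-(u ^ 2 * (z j + y) ^ 2 / 2)))) (by fun_prop)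
    have hn : nndist t.1 (0 : ℝ≥0).1 = t := by
      ext
      simp
    rw [hn] at h1
    exact (le_of_eq h1).trans (lintegral_exp_sq_gaussianReal_le u (z j) ht')
  calc ∏ j : Fin d, (∫⁻ x, ENNReal.ofReal
        (Real.exp (-(u ^ 2 * (z j + (x t j - x 0 j)) ^ 2 / 2))) ∂W)
      ≤ ∏ _j : Fin d, ENNReal.ofReal q⁻¹ := Finset.prod_le_prod' fun j _ => hone j
    _ = ENNReal.ofReal (q⁻¹ ^ d) := by
        rw [Finset.prod_const, Finset.card_univ, Fintype.card_fin,
          ENNReal.ofReal_pow (by positivity)]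
    _ ≤ ENNReal.ofReal (q⁻¹ ^ 2) :=
        ENNReal.ofReal_le_ofReal
          (pow_le_pow_of_le_one (by positivity) (inv_le_one_of_one_le₀ hq1) hd)
    _ = ENNReal.ofReal ((1 + u ^ 2 * t)⁻¹) := by
        rw [inv_pow, hq, Real.sq_sqrt (by positivity)]

/-- The constant in the bound `E|z + X_t|^{-γ} ≤ C t^{-γ/2}`. -/
def rieszConst (γ : ℝ) : ℝ≥0∞ :=
  ∫⁻ s in Ioi (0 : ℝ), ENNReal.ofReal (Real.exp (-s)) * ENNReal.ofReal (√(2 * s) ^ (-γ))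

/-- Up to a constant this is `Γ(1 - γ/2)`, convergent for `γ < 2`. -/
lemma rieszConst_ne_top {γ : ℝ} (hγ : γ < 2) : rieszConst γ ≠ ∞ := by
  have h := (Real.GammaIntegral_convergent (s := 1 - γ / 2) (by linarith)).const_mul
    (√2 ^ (-γ))
  refine (lt_of_le_of_lt (le_of_eq ?_) h.lintegral_lt_top).ne
  refine setLIntegral_congr_fun measurableSet_Ioi fun s hs => ?_
  have hs' : (0 : ℝ) < s := hs
  rw [← ENNReal.ofReal_mul (Real.exp_pos _).le, Real.sqrt_mul (by norm_num),
    Real.mul_rpow (Real.sqrt_nonneg _) (Real.sqrt_nonneg _), Real.sqrt_eq_rpow s,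
    ← Real.rpow_mul hs'.le]
  congr 1
  rw [show 1 / 2 * -γ = 1 - γ / 2 - 1 by ring]
  ring

/-- Writing `(1 + u² t)⁻¹ = ∫ exp(-s) exp(-u² s t) ds` turns the bound into a Gaussian in `u` with
`|y|² = 2 s t`. The mixture formula, read backwards, integrates out `u` and leaves `(2 s t)^(-γ/2)`,
uniformly in `z`. -/
lemma IsWienerMeasure.lintegral_enorm_rpow_le (hW : IsWienerMeasure W) (hd : 2 ≤ d) {γ : ℝ}
    (hγ : 0 < γ) (z : EuclideanSpace ℝ (Fin d)) {t : ℝ} (ht : 0 < t) :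
    ∫⁻ x, potential γ 0 (z + incr x 0 t) ∂W ≤ rieszConst γ * ENNReal.ofReal (√t ^ (-γ)) := by
  have := hW.isProbabilityMeasure
  have := sigmaFinite_markMeasure γ 0
  simp_rw [← lintegral_markMeasure hγ 0]
  rw [lintegral_lintegral_swap (Measurable.aemeasurable (by fun_prop))]
  calc ∫⁻ u, (∫⁻ x, ENNReal.ofReal (Real.exp (-(u ^ 2 * ‖z + incr x 0 t‖ ^ 2 / 2))) ∂W)
        ∂(markMeasure γ 0)
      ≤ ∫⁻ u, ENNReal.ofReal ((1 + u ^ 2 * t)⁻¹) ∂(markMeasure γ 0) :=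
        lintegral_mono fun u => hW.lintegral_exp_sq_norm_le hd u z ht
    _ = ∫⁻ u, (∫⁻ s in Ioi (0 : ℝ), ENNReal.ofReal (Real.exp (-s)) *
          ENNReal.ofReal (Real.exp (-(u ^ 2 * (√(2 * s * t)) ^ 2 / 2)))) ∂(markMeasure γ 0) := by
        refine lintegral_congr fun u => ?_
        have hp : 0 < 1 + u ^ 2 * t := by positivity
        have h1 := integral_exp_mul_Ioi (a := -(1 + u ^ 2 * t)) (by linarith) 0
        have h2 := integrableOn_exp_mul_Ioi (a := -(1 + u ^ 2 * t)) (by linarith) 0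
        simp only [mul_zero, Real.exp_zero] at h1
        rw [show (1 + u ^ 2 * t)⁻¹ = -1 / -(1 + u ^ 2 * t) by rw [neg_div_neg_eq, one_div], ← h1,
          ofReal_integral_eq_lintegral_ofReal h2 (ae_of_all _ fun _ => (Real.exp_pos _).le)]
        refine setLIntegral_congr_fun measurableSet_Ioi fun s hs => ?_
        have hs' : (0 : ℝ) < s := hs
        rw [← ENNReal.ofReal_mul (Real.exp_pos _).le, ← Real.exp_add, Real.sq_sqrt (by positivity)]
        congr 2
        ring
    _ = ∫⁻ s in Ioi (0 : ℝ), ENNReal.ofReal (Real.exp (-s)) *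
          ∫⁻ u, ENNReal.ofReal (Real.exp (-(u ^ 2 * (√(2 * s * t)) ^ 2 / 2)))
            ∂(markMeasure γ 0) := by
        rw [lintegral_lintegral_swap (Measurable.aemeasurable (by fun_prop))]
        simp_rw [lintegral_const_mul' _ _ ENNReal.ofReal_ne_top]
    _ = rieszConst γ * ENNReal.ofReal (√t ^ (-γ)) := by
        rw [rieszConst, ← lintegral_mul_const' _ _ ENNReal.ofReal_ne_top]
        refine setLIntegral_congr_fun measurableSet_Ioi fun s hs => ?_
        have hs' : (0 : ℝ) < s := hs
        rw [mul_assoc (ENNReal.ofReal _)]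
        congr 1
        rw [← ENNReal.ofReal_mul (by positivity), ← Real.mul_rpow (by positivity) (by positivity),
          ← Real.sqrt_mul (by positivity), markMeasure]
        simp only [ENNReal.ofReal_zero, zero_smul, add_zero]
        rw [lintegral_withDensity_eq_lintegral_mul _ (by fun_prop) (by fun_prop),
          ← lintegral_rpow_mul_exp hγ (by positivity)]
        rfl

/-- The Laplace transform of `t^{-γ/2}` becomes small at infinity. -/
lemma exists_laplace_le {γ : ℝ} (hγ : γ < 2) {c : ℝ≥0∞} (hc : c ≠ ∞) :
    ∃ β : ℝ, 0 ≤ β ∧ ∫⁻ t in Ioi (0 : ℝ), ENNReal.ofReal (Real.exp (-(β * t))) *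
      (c * ENNReal.ofReal (√t ^ (-γ))) ≤ 2⁻¹ := by
  set a := 1 - γ / 2 with ha
  have ha0 : 0 < a := by rw [ha]; linarith
  have hΓ := Real.Gamma_pos_of_pos ha0
  lift c to ℝ≥0 using hc
  -- The transform of `t^(a-1)` is `β^(-a) Γ(a)`, and `β` is chosen with `β^(-a) = ε`. The `c + 1`
  -- keeps `ε` well defined when `c = 0`.
  set ε : ℝ := (2 * (c + 1) * Real.Gamma a)⁻¹ with hε
  have hε0 : 0 < ε := by positivity
  set β : ℝ := (ε ^ (1 / a))⁻¹ with hβ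
  have hβ0 : 0 < β := by positivity
  refine ⟨β, hβ0.le, ?_⟩
  have h1 := Real.integral_rpow_mul_exp_neg_mul_Ioi ha0 hβ0
  have h2 : (1 / β) ^ a = ε := by
    rw [hβ, one_div, inv_inv, ← Real.rpow_mul hε0.le, one_div_mul_cancel ha0.ne', Real.rpow_one]
  -- A non-integrable function would have Bochner integral `0`, contradicting the positive value in
  -- `h1`.
  have hi : IntegrableOn (fun t : ℝ => t ^ (a - 1) * Real.exp (-(β * t))) (Ioi 0) := by
    by_contra hni
    rw [integral_undef hni, h2] at h1
    exact absurd h1.symm (by positivity)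
  have h3 : ∫⁻ t in Ioi (0 : ℝ), ENNReal.ofReal (Real.exp (-(β * t))) *
      (c * ENNReal.ofReal (√t ^ (-γ))) = c * ENNReal.ofReal (ε * Real.Gamma a) := by
    rw [← h2, ← h1, ofReal_integral_eq_lintegral_ofReal hi
      ((ae_restrict_mem measurableSet_Ioi).mono fun t ht =>
        mul_nonneg (Real.rpow_nonneg (le_of_lt ht) _) (Real.exp_pos _).le),
      ← lintegral_const_mul' _ _ ENNReal.coe_ne_top]
    refine setLIntegral_congr_fun measurableSet_Ioi fun t ht => ?_
    have ht' : (0 : ℝ) < t := ht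
    rw [mul_left_comm, ← ENNReal.ofReal_mul (Real.exp_pos _).le, Real.sqrt_eq_rpow,
      ← Real.rpow_mul ht'.le, show 1 / 2 * -γ = a - 1 by rw [ha]; ring, mul_comm (Real.exp _)]
  rw [h3, ← ENNReal.ofReal_coe_nnreal, ← ENNReal.ofReal_mul c.coe_nonneg]
  calc ENNReal.ofReal (c * (ε * Real.Gamma a)) ≤ ENNReal.ofReal 2⁻¹ := by
        refine ENNReal.ofReal_le_ofReal ?_
        rw [hε]
        field_simp
        linarith [c.2]
    _ = 2⁻¹ := by rw [ENNReal.ofReal_inv_of_pos two_pos]; simp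

end gaussian

/-! ### Jensen's inequality and finiteness of the partition function -/

lemma le_expENN (a : ℝ≥0∞) : a ≤ expENN a := by
  rcases eq_or_ne a ∞ with rfl | ha
  · rw [expENN_top]
  lift a to ℝ≥0 using ha
  rw [← ENNReal.ofReal_coe_nnreal, expENN_ofReal a.coe_nonneg]
  exact ENNReal.ofReal_le_ofReal ((by linarith : (a : ℝ) ≤ a + 1).trans (Real.add_one_le_exp _))

/-- The tangent line to `exp` at `m`, rearranged to avoid subtraction in `[0, ∞]`. -/
lemma expENN_mul_one_add_le (m : ℝ≥0) (a : ℝ≥0∞) :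
    expENN m * (1 + a) ≤ expENN a + expENN m * m := by
  rcases eq_or_ne a ∞ with rfl | ha
  · simp [expENN_top]
  lift a to ℝ≥0 using ha
  rw [← ENNReal.ofReal_coe_nnreal, ← ENNReal.ofReal_coe_nnreal, expENN_ofReal a.coe_nonneg,
    expENN_ofReal m.coe_nonneg, ← ENNReal.ofReal_one, ← ENNReal.ofReal_add zero_le_one a.coe_nonneg,
    ← ENNReal.ofReal_mul (Real.exp_pos _).le, ← ENNReal.ofReal_mul (Real.exp_pos _).le,
    ← ENNReal.ofReal_add (Real.exp_pos _).le (mul_nonneg (Real.exp_pos _).le m.coe_nonneg)]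
  refine ENNReal.ofReal_le_ofReal ?_
  have h1 : Real.exp a = Real.exp m * Real.exp (a - m) := by rw [← Real.exp_add]; ring_nf
  have h2 := mul_le_mul_of_nonneg_left (Real.add_one_le_exp ((a : ℝ) - m)) (Real.exp_pos m).le
  rw [h1]
  linarith

/-- Jensen's inequality for the exponential function on `[0, ∞]`. -/
lemma expENN_lintegral_le {Ω : Type*} [MeasurableSpace Ω] (μ : Measure Ω) [IsProbabilityMeasure μ]
    (f : Ω → ℝ≥0∞) :
    expENN (∫⁻ ω, f ω ∂μ) ≤ ∫⁻ ω, expENN (f ω) ∂μ := by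
  rcases eq_or_ne (∫⁻ ω, f ω ∂μ) ∞ with h | h
  · rw [h, expENN_top, ← h]
    exact lintegral_mono fun ω => le_expENN _
  obtain ⟨m, hm⟩ : ∃ m : ℝ≥0, (m : ℝ≥0∞) = ∫⁻ ω, f ω ∂μ := ⟨_, ENNReal.coe_toNNReal h⟩
  have hE : expENN m ≠ ∞ := by
    rw [← ENNReal.ofReal_coe_nnreal, expENN_ofReal m.coe_nonneg]
    exact ENNReal.ofReal_ne_top
  have h1 : ∫⁻ ω, expENN m * (1 + f ω) ∂μ ≤ ∫⁻ ω, (expENN (f ω) + expENN m * m) ∂μ :=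
    lintegral_mono fun ω => expENN_mul_one_add_le m (f ω)
  rw [lintegral_const_mul' _ _ hE, lintegral_add_left measurable_const,
    lintegral_add_right _ measurable_const, ← hm, mul_add] at h1
  simp only [lintegral_const, measure_univ, mul_one] at h1
  rw [← hm]
  exact (ENNReal.add_le_add_iff_right (ENNReal.mul_ne_top hE ENNReal.coe_ne_top)).1 h1

section finiteness
variable {d : ℕ} {W : Measure (PathSpace d)}

/-- The truncations `c · max(|y|, 1/(n+1))^(-γ)` are bounded and increase to the potential.
Khasminskii's bound is the same for all `n`, since it uses only the domination by the full
potential. -/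
lemma IsWienerMeasure.expMoment_potential_ne_top (hW : IsWienerMeasure W) (hd : 2 ≤ d) {γ : ℝ}
    (hγ : 0 < γ) (hγ' : γ < 2) (c : ℝ≥0) {T : ℝ} (hT : 0 ≤ T) :
    expMoment W (fun y => c * potential γ 0 y) 0 T ≠ ∞ := by
  set δ : ℕ → ℝ := fun n => 1 / ((n : ℝ) + 1) with hδ
  have hδ0 : ∀ n, 0 < δ n := fun n => by positivity
  set V : ℕ → EuclideanSpace ℝ (Fin d) → ℝ := fun n y => c * (max ‖y‖ (δ n)) ^ (-γ) with hV
  have hmax : ∀ n (y : EuclideanSpace ℝ (Fin d)), 0 < max ‖y‖ (δ n) := fun n y =>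
    lt_max_of_lt_right (hδ0 n)
  have hVc : ∀ n, Continuous (V n) := fun n => by
    refine continuous_const.mul (Continuous.rpow_const (by fun_prop) fun y => Or.inl (hmax n y).ne')
  have hV0 : ∀ n y, 0 ≤ V n y := fun n y =>
    mul_nonneg c.coe_nonneg (Real.rpow_nonneg (hmax n y).le _)
  have hVM : ∀ n y, V n y ≤ c * δ n ^ (-γ) := fun n y =>
    mul_le_mul_of_nonneg_left (Real.rpow_le_rpow_of_nonpos (hδ0 n) (le_max_right _ _)
      (by linarith)) c.coe_nonneg
  have hVE : ∀ n y, ENNReal.ofReal (V n y) = c * ENNReal.ofReal (max ‖y‖ (δ n)) ^ (-γ) :=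
    fun n y => by
      rw [hV, ENNReal.ofReal_mul c.coe_nonneg, ENNReal.ofReal_coe_nnreal,
        ENNReal.ofReal_rpow_of_pos (hmax n y)]
  have hpot : ∀ y : EuclideanSpace ℝ (Fin d), potential γ 0 y = ENNReal.ofReal ‖y‖ ^ (-γ) :=
    fun y => by simp [potential]
  have hanti : ∀ a b : ℝ≥0∞, a ≤ b → b ^ (-γ) ≤ a ^ (-γ) := fun a b hab => by
    rw [ENNReal.rpow_neg, ENNReal.rpow_neg]
    exact ENNReal.inv_le_inv.2 (ENNReal.rpow_le_rpow hab hγ.le)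
  have hVle : ∀ n y, ENNReal.ofReal (V n y) ≤ c * potential γ 0 y := fun n y => by
    rw [hVE, hpot]
    exact mul_le_mul' le_rfl <| hanti _ _ (ENNReal.ofReal_le_ofReal (le_max_left _ _))
  have hVmono : ∀ y, Monotone fun n => ENNReal.ofReal (V n y) := fun y n m hnm => by
    simp only [hVE]
    refine mul_le_mul' le_rfl <| hanti _ _ (ENNReal.ofReal_le_ofReal (max_le_max le_rfl ?_))
    exact one_div_le_one_div_of_le (by positivity) (by gcongr)
  have hVlim : ∀ y, Tendsto (fun n => ENNReal.ofReal (V n y)) atTop (𝓝 (c * potential γ 0 y)) :=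
    fun y => by
      simp only [hVE, hpot]
      refine ENNReal.Tendsto.const_mul ?_ (Or.inr ENNReal.coe_ne_top)
      refine (ENNReal.continuous_rpow_const.tendsto _).comp (ENNReal.tendsto_ofReal ?_)
      have := (tendsto_const_nhds (x := ‖y‖)).max (tendsto_one_div_add_atTop_nhds_zero_nat (𝕜 := ℝ))
      rw [max_eq_left (norm_nonneg y)] at this
      exact this
  obtain ⟨β, hβ0, hβ⟩ := exists_laplace_le hγ'
    (ENNReal.mul_ne_top (ENNReal.coe_ne_top (r := c)) (rieszConst_ne_top hγ'))
  have hbound : ∀ n, expMoment W (fun y => ENNReal.ofReal (V n y)) 0 T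
      ≤ 2 * ENNReal.ofReal (Real.exp (β * T)) := fun n => by
    refine hW.expMoment_le_of_bounded (hVc n) (hV0 n) (hVM n) hβ0 (fun z t ht => ?_) hβ 0 hT
    calc ∫⁻ x, ENNReal.ofReal (V n (z + incr x 0 t)) ∂W
        ≤ ∫⁻ x, c * potential γ 0 (z + incr x 0 t) ∂W := lintegral_mono fun x => hVle n _
      _ = c * ∫⁻ x, potential γ 0 (z + incr x 0 t) ∂W :=
          lintegral_const_mul' _ _ ENNReal.coe_ne_top
      _ ≤ c * (rieszConst γ * ENNReal.ofReal (√t ^ (-γ))) := by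
          gcongr
          exact hW.lintegral_enorm_rpow_le hd hγ z ht
      _ = _ := (mul_assoc _ _ _).symm
  have hVm : ∀ n, Measurable fun y => ENNReal.ofReal (V n y) := fun n =>
    (hVc n).measurable.ennreal_ofReal
  have hA : ∀ x : PathSpace d, Tendsto
      (fun n => ∫⁻ r in Ioc 0 T, ENNReal.ofReal (V n (0 + incr x 0 r))) atTop
      (𝓝 (∫⁻ r in Ioc 0 T, c * potential γ 0 (0 + incr x 0 r))) := fun x =>
    lintegral_tendsto_of_tendsto_of_monotone
      (fun n => ((hVm n).comp (by fun_prop)).aemeasurable) (ae_of_all _ fun r => hVmono _)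
      (ae_of_all _ fun r => hVlim _)
  have hlim : Tendsto (fun n => expMoment W (fun y => ENNReal.ofReal (V n y)) 0 T) atTop
      (𝓝 (expMoment W (fun y => c * potential γ 0 y) 0 T)) :=
    lintegral_tendsto_of_tendsto_of_monotone
      (fun n => (measurable_expENN.comp (measurable_additive_zero (hVm n) 0 T)).aemeasurable)
      (ae_of_all _ fun x n m hnm => expENN_mono (lintegral_mono fun r => hVmono _ hnm))
      (ae_of_all _ fun x => (continuous_expENN.tendsto _).comp (hA x))
  exact ((le_of_tendsto' hlim hbound).trans_lt
    (ENNReal.mul_lt_top (by simp) ENNReal.ofReal_lt_top)).ne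

/-- In the variables `(s, r = t - s)` the simplex lies in a square, on which the bound on `α g`
leaves an additive functional for each starting time `s`. -/
lemma energy_intensity_le {g : ℝ → ℝ} (hg : Measurable g) {γ α T S : ℝ} (hTS : T ≤ S)
    {c : ℝ≥0} (hc : ∀ t, 0 ≤ t → α * g t ≤ c) (x : PathSpace d) :
    energy γ (intensity g α T) x
      ≤ ∫⁻ s in Icc 0 S, ∫⁻ r in Ioc 0 S, c * potential γ 0 (incr x s (s + r)) := by
  rw [energy, lintegral_intensity hg _ _ (by fun_prop),
    ← lintegral_indicator (measurableSet_simplex T), Measure.volume_eq_prod,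
    lintegral_prod _ (Measurable.indicator (by fun_prop) (measurableSet_simplex T)).aemeasurable,
    ← lintegral_indicator measurableSet_Icc]
  refine lintegral_mono fun s => ?_
  rw [← lintegral_add_left_eq_self _ s]
  by_cases hs : s ∈ Icc 0 S
  · rw [indicator_of_mem hs, ← lintegral_indicator measurableSet_Ioc]
    refine lintegral_mono fun r => ?_
    by_cases hr : (s, s + r) ∈ simplex T
    · have hr' : r ∈ Ioc 0 S := ⟨by linarith [hr.2.1], by linarith [hr.2.2, hr.1]⟩
      rw [indicator_of_mem hr, indicator_of_mem hr']
      gcongr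
      rw [← ENNReal.ofReal_coe_nnreal]
      exact ENNReal.ofReal_le_ofReal (hc _ (by simpa using hr'.1.le))
    · rw [indicator_of_notMem hr]
      exact zero_le
  · rw [indicator_of_notMem hs, nonpos_iff_eq_zero]
    have : ∀ r, (s, s + r) ∉ simplex T := fun r hr =>
      hs ⟨hr.1, by linarith [hr.2.1, hr.2.2]⟩
    simp [indicator_of_notMem (this _)]

/-- Additive functionals of the increments are stationary. -/
lemma IsWienerMeasure.lintegral_expENN_incr (hW : IsWienerMeasure W)
    {V : EuclideanSpace ℝ (Fin d) → ℝ≥0∞} (hV : Measurable V) (s : ℝ≥0) (S : ℝ) :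
    ∫⁻ x, expENN (∫⁻ r in Ioc 0 S, V (incr x s (s + r))) ∂W = expMoment W V 0 S := by
  have := hW.isProbabilityMeasure
  have hm : Measurable fun x : PathSpace d =>
      expENN (∫⁻ r in Ioc 0 S, V (incr x s (s + r))) :=
    measurable_expENN.comp (Measurable.lintegral_prod_right'
      (f := fun q : PathSpace d × ℝ => V (incr q.1 s (s + q.2))) (by fun_prop))
  conv_lhs => rw [← hW.map_concat s]
  rw [lintegral_map hm (measurable_concat s)]
  have e : ∀ z : PathSpace d × PathSpace d, ∫⁻ r in Ioc 0 S, V (incr (concat s z) s (s + r))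
      = ∫⁻ r in Ioc 0 S, V (0 + incr z.2 0 r) := fun z => by
    refine setLIntegral_congr_fun measurableSet_Ioc fun r hr => ?_
    have h := incr_concat_add s z le_rfl hr.1.le
    rw [zero_add] at h
    rw [add_comm (s : ℝ) r, h, zero_add]
  simp_rw [e]
  have hm2 : Measurable fun y : PathSpace d => expENN (∫⁻ r in Ioc 0 S, V (0 + incr y 0 r)) :=
    measurable_expENN.comp (measurable_additive_zero hV 0 _)
  refine (lintegral_prod _ (hm2.comp measurable_snd).aemeasurable).trans ?_
  simp [expMoment]

/-- Jensen's inequality for the uniform law of the starting time `s` moves the `s`-average outside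
the exponential, at the price of a factor `S` in the potential. By stationarity every `s` then gives
the same exponential moment. -/
theorem IsWienerMeasure.partitionZ_ne_top (hW : IsWienerMeasure W) (hd : 2 ≤ d) {γ : ℝ}
    (hγ : 0 < γ) (hγ' : γ < 2) {g : ℝ → ℝ} (hg : Measurable g) {α : ℝ} {c : ℝ≥0}
    (hc : ∀ t, 0 ≤ t → α * g t ≤ c) (T : ℝ≥0) : partitionZ W γ g α T ≠ ∞ := by
  have := hW.isProbabilityMeasure
  -- Enlarged by one so that the uniform law on `[0, S]` exists also for `T = 0`.
  set S : ℝ≥0 := T + 1 with hS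
  have hS0 : (0 : ℝ) < S := by positivity
  have hSE : (S : ℝ≥0∞) ≠ 0 := by simp [hS]
  set μ : Measure ℝ := (S : ℝ≥0∞)⁻¹ • volume.restrict (Icc 0 (S : ℝ)) with hμ
  have : IsProbabilityMeasure μ := ⟨by
    rw [hμ, Measure.smul_apply, Measure.restrict_apply MeasurableSet.univ, univ_inter,
      Real.volume_Icc, sub_zero, ENNReal.ofReal_coe_nnreal, smul_eq_mul,
      ENNReal.inv_mul_cancel hSE ENNReal.coe_ne_top]⟩
  set A : PathSpace d → ℝ → ℝ≥0∞ := fun x s =>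
    ∫⁻ r in Ioc 0 (S : ℝ), (S * c : ℝ≥0) * potential γ 0 (incr x s (s + r)) with hA
  have hAm : Measurable fun p : PathSpace d × ℝ => A p.1 p.2 :=
    Measurable.lintegral_prod_right' (f := fun q : (PathSpace d × ℝ) × ℝ =>
      ((S * c : ℝ≥0) : ℝ≥0∞) * potential γ 0 (incr q.1.1 q.1.2 (q.1.2 + q.2))) (by fun_prop)
  have hE : ∀ x, energy γ (intensity g α T) x ≤ ∫⁻ s, A x s ∂μ := fun x => by
    refine (energy_intensity_le hg (S := S) (by simp [hS]) hc x).trans (le_of_eq ?_)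
    have e : ∀ s, A x s = S * ∫⁻ r in Ioc 0 (S : ℝ), c * potential γ 0 (incr x s (s + r)) :=
      fun s => by
        rw [← lintegral_const_mul' _ _ ENNReal.coe_ne_top]
        refine lintegral_congr fun r => ?_
        rw [ENNReal.coe_mul, mul_assoc]
    simp_rw [e]
    rw [lintegral_const_mul' _ _ ENNReal.coe_ne_top, hμ, lintegral_smul_measure, smul_eq_mul,
      ENNReal.mul_inv_cancel_left hSE ENNReal.coe_ne_top]
  have hstat : ∀ s ∈ Icc (0 : ℝ) S, ∫⁻ x, expENN (A x s) ∂W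
      = expMoment W (fun y => (S * c : ℝ≥0) * potential γ 0 y) 0 S := fun s hs =>
    hW.lintegral_expENN_incr (V := fun y => (S * c : ℝ≥0) * potential γ 0 y) (by fun_prop)
      ⟨s, hs.1⟩ S
  refine ne_top_of_le_ne_top (hW.expMoment_potential_ne_top hd hγ hγ' (S * c) hS0.le) ?_
  calc partitionZ W γ g α T ≤ ∫⁻ x, ∫⁻ s, expENN (A x s) ∂μ ∂W :=
        lintegral_mono fun x => (expENN_mono (hE x)).trans
          (expENN_lintegral_le μ _)
    _ = ∫⁻ s, ∫⁻ x, expENN (A x s) ∂W ∂μ :=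
        lintegral_lintegral_swap (measurable_expENN.comp hAm).aemeasurable
    _ = ∫⁻ _, expMoment W (fun y => (S * c : ℝ≥0) * potential γ 0 y) 0 S ∂μ := by
        rw [hμ, lintegral_smul_measure, lintegral_smul_measure]
        congr 1
        exact setLIntegral_congr_fun measurableSet_Icc hstat
    _ = _ := by simp

end finiteness

end Polaron

end

/-! ### The proposition -/

theorem mainTheorem2 {d : ℕ} (hd : 2 ≤ d) (W : Measure (PathSpace d)) (hW : IsWienerMeasure W)
    (γ : ℝ) (hγ : 1 ≤ γ) (hγ' : γ < 2)
    (g : ℝ → ℝ) (hg_meas : Measurable g) (hg_pos : ∀ t, 0 ≤ t → 0 < g t)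
    (hg_int : ∫ t in Ici (0 : ℝ), g t = 1)
    (hg_moment : IntegrableOn (fun t => t * g t) (Ici (0 : ℝ)))
    (hg_bdd : ∃ K : ℝ, ∀ t, 0 ≤ t → (1 + t) * g t ≤ K)
    (α : ℝ) (hα : 0 < α) :
    (∃ σ2 : ℝ≥0, IsDiffusionConstant W γ g α σ2 ∧
      ∀ ε : ℝ, 0 ≤ ε →
        Tendsto (fun T : ℝ =>
            ∫⁻ ξ, (∫⁻ u, sigmaSq W T ξ u ∂(kappa W γ ε ξ)) ∂(perturbedLaw W γ g ε α T))
          atTop (𝓝 (σ2 : ℝ≥0∞))) ∧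
    (∀ (T : ℝ), 0 < T →
      ∀ (n : ℕ) (s t : Fin n → ℝ≥0), (∀ i, s i < t i) →
      ∀ (u : Fin n → ℝ), (∀ i, 0 ≤ u i) →
      ∀ {Ω : Type*} [MeasurableSpace Ω] (P : Measure Ω) [IsProbabilityMeasure P]
        (B : ℝ≥0 → Ω → ℝ) (Z : Fin n → Ω → ℝ),
        IsBrownianReal B P →
        iIndepFun Z P →
        (∀ i, HasLaw (Z i) (gaussianReal 0 1) P) →
        IndepFun (fun ω i => Z i ω) (fun ω r => B r ω) P →
        sigmaSq W T ⟨n, fun i => (s i, t i)⟩ u =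
          (ENNReal.ofReal T)⁻¹ *
            l2DistSpan P (fun ω => B T.toNNReal ω - B 0 ω)
              (fun i ω => u i * (B (t i) ω - B (s i) ω) + Z i ω) ^ 2) := by
  have hγ0 : 0 < γ := by linarith
  have hd0 : 0 < d := by omega
  -- Without integrability the integral would be `0` by convention, not `1`.
  have hgi : IntegrableOn g (Ici 0) := by
    by_contra h
    rw [integral_undef h] at hg_int
    exact zero_ne_one hg_int
  obtain ⟨K, hK⟩ := hg_bdd
  have hgK : ∀ t, 0 ≤ t → α * g t ≤ (α * K).toNNReal := fun t ht => by
    refine le_trans (mul_le_mul_of_nonneg_left ?_ hα.le) (Real.le_coe_toNNReal _)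
    nlinarith [hK t ht, hg_pos t ht]
  have hZ : ∀ T : ℝ≥0, partitionZ W γ g α T ≠ ∞ :=
    hW.partitionZ_ne_top hd hγ0 hγ' hg_meas hgK
  refine ⟨?_, ?_⟩
  · obtain ⟨σ2, hσ⟩ := hW.exists_isDiffusionConstant hd0 hγ0 hg_meas hα.le hZ
    -- The mixture and the mean square displacement agree for every `T ≥ 0`, so they have the same
    -- limit.
    refine ⟨σ2, hσ, fun ε _ => Tendsto.congr' ?_ hσ⟩
    filter_upwards [eventually_ge_atTop 0] with T hT
    exact (hW.lintegral_perturbedLaw hγ0 hg_meas hgi hα.le ε T (hZ ⟨T, hT⟩)).symm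
  · intro T hT n s t _ u _ Ω _ P _ B Z hB hZi hZl hZB
    exact hW.sigmaSq_eq s t u hd0 hT hB.toIsPreBrownianReal hZi hZl hZB
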